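/- **Setting.** Let $\Omega\subseteq\mathbb{R}^d$ be a bounded simplicial Lipschitz domain (open, connected, and $\overline\Omega$ is the underlying space of a finite simplicial complex $\mathcal T$). Let $\Gamma_I,\Gamma_D,\Gamma_N\subseteq\partial\Omega$ be pairwise disjoint, relatively open, with $\Gamma_I\neq\emptyset$ and $\partial\Omega=\overline\Gamma_I\cup\overline\Gamma_D\cup\overline\Gamma_N$, and assume that the relative interior of every $(d-1)$-dimensional simplex of $\mathcal T$ contained in $\partial\Omega$ is contained in one of $\Gamma_I,\Gamma_D,\Gamma_N$. Write $(\cdot,\cdot)_\omega$ for the integral of the product and $\|\cdot\|_{p,\omega}$ for the $L^p$-norm (with $\|\cdot\|_\Omega=\|\cdot\|_{2,\Omega}$), with respect to Lebesgue measure on $\Omega$ and surface measure on boundary parts. Functions in $H^1(\Omega)$ are evaluated on the boundary through their trace $\mathrm{tr}$. For $X\in\{I,D,N\}$ let $H^1_X(\Omega)=\{v\in H^1(\Omega):\mathrm{tr}\,v=0\text{ a.e. on }\Gamma_X\}$, let $H^{1/2}(\Gamma_X)$ be the range of $v\mapsto(\mathrm{tr}\,v)|_{\Gamma_X}$ on $H^1(\Omega)$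 with the quotient norm, and $H^{-1/2}(\Gamma_X)$ its topological dual. For $y\in H(\mathrm{div};\Omega)=\{y\in L^2(\Omega)^d:\mathrm{div}\,y\in L^2(\Omega)\}$ and $v\in H^1(\Omega)$ put $\langle y\cdot n,v\rangle_{\partial\Omega}=(\nabla v,y)_\Omega+(v,\mathrm{div}\,y)_\Omega$. Let $\overline H_I(\mathrm{div};\Omega)$ be the set of those $y\in H(\mathrm{div};\Omega)$ for which there is an $\overline{y\cdot n}\in L^\infty(\Gamma_I)$ (necessarily unique) with $(\overline{y\cdot n},v)_{\Gamma_I}=\langle y\cdot n,v\rangle_{\partial\Omega}$ for all $v\in H^1_D(\Omega)\cap H^1_N(\Omega)$. Let $m>0$, $f\in L^2(\Omega)$, $g\in H^{-1/2}(\Gamma_N)$, $u_D\in H^{1/2}(\Gamma_D)$, and let $\widehat u_D\in H^1(\Omega)$ satisfy $\widehat u_D=u_D$ a.e. on $\Gamma_D$. For $v\in H^1(\Omega)$ define $$I(v)=\tfrac12\|\nabla v\|_\Omega^2+\tfrac1{2m}\|v\|_{1,\Gamma_I}^2-(f,v)_\Omega-\langle g,v\rangle_{\Gamma_N}\quad\text{if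 }v=u_D\text{ a.e. on }\Gamma_D,\qquad I(v)=+\infty\text{ otherwise.}$$ For $y\in\overline H_I(\mathrm{div};\Omega)$ define $$D(y)=-\tfrac12\|y\|_\Omega^2-\tfrac m2\|\overline{y\cdot n}\|_{\infty,\Gamma_I}^2+\langle y\cdot n,\widehat u_D\rangle_{\partial\Omega}-(\overline{y\cdot n},\widehat u_D)_{\Gamma_I}-\langle g,\widehat u_D\rangle_{\Gamma_N}$$ if $\mathrm{div}\,y=-f$ a.e. in $\Omega$ and $\langle y\cdot n,v\rangle_{\partial\Omega}=\langle g,v\rangle_{\Gamma_N}$ for all $v\in H^1_I(\Omega)\cap H^1_D(\Omega)$, and $D(y)=-\infty$ otherwise. **Theorem.** (i) The maximization of $D$ is a Fenchel dual problem to the minimization of $I$: with $G(y)=\tfrac12\|y\|_\Omega^2$ on $L^2(\Omega)^d$ and, on $H^1(\Omega)$, $F(v)=-(f,v)_\Omega-\langle g,v\rangle_{\Gamma_N}+\tfrac1{2m}\|v\|_{1,\Gamma_I}^2$ if $v=u_D$ a.e. on $\Gamma_D$ and $F(v)=+\infty$ otherwise, the functionals $G$ and $F$ are proper, convex and lower semicontinuous,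 $I(v)=G(\nabla v)+F(v)$ for all $v\in H^1(\Omega)$, and for $y\in L^2(\Omega)^d$ the Fenchel dual functional $-G^*(y)-F^*(-\nabla^*y)$ equals $D(y)$ if $y\in\overline H_I(\mathrm{div};\Omega)$ and $-\infty$ otherwise. Here $G^*,F^*$ are the Fenchel conjugates, $(L^2(\Omega)^d)^*$ is identified with $L^2(\Omega)^d$, and $\nabla^*:L^2(\Omega)^d\to H^1(\Omega)^*$ is the adjoint of $\nabla:H^1(\Omega)\to L^2(\Omega)^d$. (ii) $I$ has a minimizer. There is a unique maximizer $z\in\overline H_I(\mathrm{div};\Omega)$ of $D$, and it satisfies $\mathrm{div}\,z=-f$ a.e. in $\Omega$ and $\langle z\cdot n,v\rangle_{\partial\Omega}-(\overline{z\cdot n},v)_{\Gamma_I}=\langle g,v\rangle_{\Gamma_N}$ for all $v\in H^1_D(\Omega)$. For every minimizer $u$ of $I$, strong duality $I(u)=D(z)$ holds. (iii) For every minimizer $u$ of $I$, one has $z=\nabla u$ a.e. in $\Omega$ and $$-(\overline{z\cdot n},u)_{\Gamma_I}=\tfrac m2\|\overline{z\cdot n}\|_{\infty,\Gamma_I}^2+\tfrac1{2m}\|u\|_{1,\Gamma_I}^2.$$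 -/

import Mathlib

open MeasureTheory Set Filter Topology
open scoped ENNReal ContDiff InnerProductSpace

noncomputable section

namespace Insulation

/-! ### Fenchel duality on real normed spaces -/

section Fenchel

variable {V Y : Type*} [NormedAddCommGroup V] [NormedSpace ℝ V]
  [NormedAddCommGroup Y] [NormedSpace ℝ Y]

/-- Proper, convex (i.e. with convex epigraph), lower semicontinuous functional. -/
def ProperConvexLsc (F : V → EReal) : Prop :=
  ((∃ v, F v ≠ ⊤) ∧ ∀ v, F v ≠ ⊥) ∧
    Convex ℝ {p : V × ℝ | F p.1 ≤ (p.2 : EReal)} ∧ LowerSemicontinuous F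

/-- The Fenchel conjugate `F*(ℓ) = sup_v (⟨ℓ, v⟩ - F v)` on the topological dual. -/
def conjugate (F : V → EReal) (l : StrongDual ℝ V) : EReal :=
  ⨆ v : V, ((l v : ℝ) : EReal) - F v

/-- The Fenchel dual functional `p ↦ -G*(p) - F*(-Λ* p)` of `v ↦ G (Λ v) + F v`. -/
def fenchelDual (G : Y → EReal) (F : V → EReal) (L : V →L[ℝ] Y) (p : StrongDual ℝ Y) : EReal :=
  -conjugate G p - conjugate F (-(p.comp L))

end Fenchel

/-- Euclidean space `ℝ^d`. -/
abbrev E (d : ℕ) : Type := EuclideanSpace ℝ (Fin d)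

variable {d : ℕ}

/-! ### The geometric setting -/

/-- `Ω` is locally, at each of its boundary points, the strict epigraph of a Lipschitz function
over the hyperplane orthogonal to some unit vector `e`. -/
def HasLipschitzBoundary (Ω : Set (E d)) : Prop :=
  ∀ x ∈ frontier Ω, ∃ e : E d, ‖e‖ = 1 ∧ ∃ (K : NNReal) (h : E d → ℝ), LipschitzWith K h ∧
    ∃ r > 0, ∀ y ∈ Metric.ball x r, y ∈ Ω ↔ h (y - ⟪e, y⟫_ℝ • e) < ⟪e, y⟫_ℝ

/-- Relatively open part of the boundary. -/
def IsBoundaryPart (Ω Γ : Set (E d)) : Prop :=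
  ∃ U : Set (E d), IsOpen U ∧ Γ = U ∩ frontier Ω

/-- A bounded simplicial Lipschitz domain whose boundary is split into an insulated part `ΓI`, a
Dirichlet part `ΓD` and a Neumann part `ΓN`, such that some triangulation of the domain resolves
this splitting. -/
structure IsInsulationDomain (Ω ΓI ΓD ΓN : Set (E d)) : Prop where
  isOpen : IsOpen Ω
  isConnected : IsConnected Ω
  isBounded : Bornology.IsBounded Ω
  lipschitz : HasLipschitzBoundary Ω
  partI : IsBoundaryPart Ω ΓI
  partD : IsBoundaryPart Ω ΓD
  partN : IsBoundaryPart Ω ΓN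
  disjointID : Disjoint ΓI ΓD
  disjointIN : Disjoint ΓI ΓN
  disjointDN : Disjoint ΓD ΓN
  cover : frontier Ω = closure ΓI ∪ closure ΓD ∪ closure ΓN
  nonemptyI : ΓI.Nonempty
  /-- There is a finite triangulation of `closure Ω` such that the relative interior of each
  boundary side (i.e. `(d-1)`-dimensional simplex inside the boundary) lies in one of the parts. -/
  simplicial : ∃ T : Geometry.SimplicialComplex ℝ (E d), T.faces.Finite ∧ T.space = closure Ω ∧
    ∀ s ∈ T.faces, s.card = d → convexHull ℝ (s : Set (E d)) ⊆ frontier Ω →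
      intrinsicInterior ℝ (convexHull ℝ (s : Set (E d))) ⊆ ΓI ∨
      intrinsicInterior ℝ (convexHull ℝ (s : Set (E d))) ⊆ ΓD ∨
      intrinsicInterior ℝ (convexHull ℝ (s : Set (E d))) ⊆ ΓN

/-- Surface measure: the `(d-1)`-dimensional Hausdorff measure, normalized so as to agree with
`(d-1)`-dimensional Lebesgue measure on hyperplanes. -/
def surf (d : ℕ) : Measure (E d) := Measure.euclideanHausdorffMeasure (d - 1)

/-! ### The spaces `L²(Ω)`, `H¹(Ω)` and `H(div; Ω)` -/

/-- `L²(Ω)`. -/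
abbrev L2 (Ω : Set (E d)) : Type := Lp ℝ 2 (volume.restrict Ω)

/-- `L²(Ω)^d`. -/
abbrev L2v (Ω : Set (E d)) : Type := Lp (E d) 2 (volume.restrict Ω)

/-- `φ ∈ C_c^∞(Ω)`. -/
def IsTest (Ω : Set (E d)) (φ : E d → ℝ) : Prop :=
  ContDiff ℝ ∞ φ ∧ HasCompactSupport φ ∧ tsupport φ ⊆ Ω

/-- `w` is the weak gradient of `v` in `Ω`. -/
def IsWeakGrad (Ω : Set (E d)) (v : L2 Ω) (w : L2v Ω) : Prop :=
  ∀ φ, IsTest Ω φ → ∀ i : Fin d,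
    ∫ x in Ω, v x * fderiv ℝ φ x (EuclideanSpace.single i 1) = -∫ x in Ω, w x i * φ x

/-- `q` is the weak divergence of `y` in `Ω`. -/
def IsWeakDiv (Ω : Set (E d)) (y : L2v Ω) (q : L2 Ω) : Prop :=
  ∀ φ, IsTest Ω φ → ∫ x in Ω, fderiv ℝ φ x (y x) = -∫ x in Ω, q x * φ x

theorem IsTest.memLp {Ω : Set (E d)} {φ : E d → ℝ} (h : IsTest Ω φ) :
    MemLp φ 2 (volume.restrict Ω) :=
  (h.1.continuous.memLp_of_hasCompactSupport h.2.1).restrict Ω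

theorem IsTest.memLp_fderiv {Ω : Set (E d)} {φ : E d → ℝ} (h : IsTest Ω φ) (a : E d) :
    MemLp (fun x => fderiv ℝ φ x a) 2 (volume.restrict Ω) := by
  have hc : Continuous fun x => fderiv ℝ φ x a :=
    (h.1.continuous_fderiv (by simp)).clm_apply continuous_const
  exact (hc.memLp_of_hasCompactSupport (h.2.1.fderiv_apply ℝ a)).restrict Ω

theorem IsTest.integrable_left {Ω : Set (E d)} {φ : E d → ℝ} (h : IsTest Ω φ) (v : L2 Ω) (a : E d) :
    Integrable (fun x => v x * fderiv ℝ φ x a) (volume.restrict Ω) :=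
  (Lp.memLp v).integrable_mul (h.memLp_fderiv a)

theorem IsTest.integrable_mul {Ω : Set (E d)} {φ : E d → ℝ} (h : IsTest Ω φ) (v : L2 Ω) :
    Integrable (fun x => v x * φ x) (volume.restrict Ω) :=
  (Lp.memLp v).integrable_mul h.memLp

theorem memLp_coord {Ω : Set (E d)} (w : L2v Ω) (i : Fin d) :
    MemLp (fun x => w x i) 2 (volume.restrict Ω) :=
  (Lp.memLp w).continuousLinearMap_comp (EuclideanSpace.proj i : E d →L[ℝ] ℝ)

theorem IsTest.integrable_coord {Ω : Set (E d)} {φ : E d → ℝ} (h : IsTest Ω φ) (w : L2v Ω)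
    (i : Fin d) : Integrable (fun x => w x i * φ x) (volume.restrict Ω) :=
  (memLp_coord w i).integrable_mul h.memLp

theorem IsTest.integrable_fderiv {Ω : Set (E d)} {φ : E d → ℝ} (h : IsTest Ω φ) (y : L2v Ω) :
    Integrable (fun x => fderiv ℝ φ x (y x)) (volume.restrict Ω) := by
  have : (fun x => fderiv ℝ φ x (y x)) =
      fun x => ∑ i, y x i * fderiv ℝ φ x (EuclideanSpace.single i 1) := by
    funext x
    conv_lhs => rw [← (EuclideanSpace.basisFun (Fin d) ℝ).sum_repr (y x)]
    simp [map_sum]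
  rw [this]
  exact integrable_finsetSum _ fun i _ => (memLp_coord y i).integrable_mul (h.memLp_fderiv _)

/-- `H¹(Ω)`, as the space of pairs `(v, ∇v)` with the norm `(‖v‖² + ‖∇v‖²)^{1/2}`. -/
def H1 (Ω : Set (E d)) : Submodule ℝ (WithLp 2 (L2 Ω × L2v Ω)) where
  carrier := {p | IsWeakGrad Ω p.fst p.snd}
  zero_mem' := by
    intro φ _ i
    have h1 : (fun x => (0 : L2 Ω) x * fderiv ℝ φ x (EuclideanSpace.single i 1))
        =ᵐ[volume.restrict Ω] 0 := by
      filter_upwards [Lp.coeFn_zero ℝ 2 (volume.restrict Ω)] with x hx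
      rw [hx]
      simp
    have h2 : (fun x => (0 : L2v Ω) x i * φ x) =ᵐ[volume.restrict Ω] 0 := by
      filter_upwards [Lp.coeFn_zero (E d) 2 (volume.restrict Ω)] with x hx
      rw [hx]
      simp
    change ∫ x in Ω, (0 : L2 Ω) x * fderiv ℝ φ x (EuclideanSpace.single i 1)
      = -∫ x in Ω, (0 : L2v Ω) x i * φ x
    rw [integral_congr_ae h1, integral_congr_ae h2]
    simp
  add_mem' := by
    intro p q hp hq φ hφ i
    have h1 : (fun x => (p.fst + q.fst) x * fderiv ℝ φ x (EuclideanSpace.single i 1))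
        =ᵐ[volume.restrict Ω] fun x => p.fst x * fderiv ℝ φ x (EuclideanSpace.single i 1) +
          q.fst x * fderiv ℝ φ x (EuclideanSpace.single i 1) := by
      filter_upwards [Lp.coeFn_add p.fst q.fst] with x hx
      rw [hx]
      simp [add_mul]
    have h2 : (fun x => (p.snd + q.snd) x i * φ x) =ᵐ[volume.restrict Ω]
        fun x => p.snd x i * φ x + q.snd x i * φ x := by
      filter_upwards [Lp.coeFn_add p.snd q.snd] with x hx
      rw [hx]
      simp [add_mul]
    change ∫ x in Ω, (p.fst + q.fst) x * fderiv ℝ φ x (EuclideanSpace.single i 1)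
      = -∫ x in Ω, (p.snd + q.snd) x i * φ x
    rw [integral_congr_ae h1, integral_congr_ae h2,
      integral_add (hφ.integrable_left _ _) (hφ.integrable_left _ _),
      integral_add (hφ.integrable_coord _ _) (hφ.integrable_coord _ _), hp φ hφ i, hq φ hφ i]
    ring
  smul_mem' := by
    intro c p hp φ hφ i
    have h1 : (fun x => (c • p.fst) x * fderiv ℝ φ x (EuclideanSpace.single i 1))
        =ᵐ[volume.restrict Ω]
          fun x => c * (p.fst x * fderiv ℝ φ x (EuclideanSpace.single i 1)) := by
      filter_upwards [Lp.coeFn_smul c p.fst] with x hx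
      rw [hx]
      simp [mul_assoc]
    have h2 : (fun x => (c • p.snd) x i * φ x) =ᵐ[volume.restrict Ω]
        fun x => c * (p.snd x i * φ x) := by
      filter_upwards [Lp.coeFn_smul c p.snd] with x hx
      rw [hx]
      simp [mul_assoc]
    change ∫ x in Ω, (c • p.fst) x * fderiv ℝ φ x (EuclideanSpace.single i 1)
      = -∫ x in Ω, (c • p.snd) x i * φ x
    rw [integral_congr_ae h1, integral_congr_ae h2, integral_const_mul, integral_const_mul,
      hp φ hφ i]
    ring

/-- `H(div; Ω)`, as the space of pairs `(y, div y)` with the norm `(‖y‖² + ‖div y‖²)^{1/2}`. -/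
def HDiv (Ω : Set (E d)) : Submodule ℝ (WithLp 2 (L2v Ω × L2 Ω)) where
  carrier := {p | IsWeakDiv Ω p.fst p.snd}
  zero_mem' := by
    intro φ _
    have h1 : (fun x => fderiv ℝ φ x ((0 : L2v Ω) x)) =ᵐ[volume.restrict Ω] 0 := by
      filter_upwards [Lp.coeFn_zero (E d) 2 (volume.restrict Ω)] with x hx
      rw [hx]
      simp
    have h2 : (fun x => (0 : L2 Ω) x * φ x) =ᵐ[volume.restrict Ω] 0 := by
      filter_upwards [Lp.coeFn_zero ℝ 2 (volume.restrict Ω)] with x hx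
      rw [hx]
      simp
    change ∫ x in Ω, fderiv ℝ φ x ((0 : L2v Ω) x) = -∫ x in Ω, (0 : L2 Ω) x * φ x
    rw [integral_congr_ae h1, integral_congr_ae h2]
    simp
  add_mem' := by
    intro p q hp hq φ hφ
    have h1 : (fun x => fderiv ℝ φ x ((p.fst + q.fst) x)) =ᵐ[volume.restrict Ω]
        fun x => fderiv ℝ φ x (p.fst x) + fderiv ℝ φ x (q.fst x) := by
      filter_upwards [Lp.coeFn_add p.fst q.fst] with x hx
      rw [hx]
      simp
    have h2 : (fun x => (p.snd + q.snd) x * φ x) =ᵐ[volume.restrict Ω]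
        fun x => p.snd x * φ x + q.snd x * φ x := by
      filter_upwards [Lp.coeFn_add p.snd q.snd] with x hx
      rw [hx]
      simp [add_mul]
    change ∫ x in Ω, fderiv ℝ φ x ((p.fst + q.fst) x) = -∫ x in Ω, (p.snd + q.snd) x * φ x
    rw [integral_congr_ae h1, integral_congr_ae h2,
      integral_add (hφ.integrable_fderiv _) (hφ.integrable_fderiv _),
      integral_add (hφ.integrable_mul _) (hφ.integrable_mul _), hp φ hφ, hq φ hφ]
    ring
  smul_mem' := by
    intro c p hp φ hφ
    have h1 : (fun x => fderiv ℝ φ x ((c • p.fst) x)) =ᵐ[volume.restrict Ω]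
        fun x => c * fderiv ℝ φ x (p.fst x) := by
      filter_upwards [Lp.coeFn_smul c p.fst] with x hx
      rw [hx]
      simp
    have h2 : (fun x => (c • p.snd) x * φ x) =ᵐ[volume.restrict Ω]
        fun x => c * (p.snd x * φ x) := by
      filter_upwards [Lp.coeFn_smul c p.snd] with x hx
      rw [hx]
      simp [mul_assoc]
    change ∫ x in Ω, fderiv ℝ φ x ((c • p.fst) x) = -∫ x in Ω, (c • p.snd) x * φ x
    rw [integral_congr_ae h1, integral_congr_ae h2, integral_const_mul, integral_const_mul,
      hp φ hφ]
    ring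

/-- The underlying `L²` function of `v ∈ H¹(Ω)`. -/
def fn {Ω : Set (E d)} (v : H1 Ω) : L2 Ω := (v : WithLp 2 (L2 Ω × L2v Ω)).fst

/-- The gradient `∇ : H¹(Ω) → L²(Ω)^d`. -/
def grad (Ω : Set (E d)) : H1 Ω →L[ℝ] L2v Ω :=
  (WithLp.sndL 2 ℝ (L2 Ω) (L2v Ω)).comp (H1 Ω).subtypeL

/-- The underlying `L²` vector field of `y ∈ H(div; Ω)`. -/
def vec {Ω : Set (E d)} (y : HDiv Ω) : L2v Ω := (y : WithLp 2 (L2v Ω × L2 Ω)).fst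

/-- The divergence of `y ∈ H(div; Ω)`. -/
def div {Ω : Set (E d)} (y : HDiv Ω) : L2 Ω := (y : WithLp 2 (L2v Ω × L2 Ω)).snd

/-! ### Traces -/

/-- `L²(∂Ω)` with respect to surface measure. -/
abbrev L2bd (Ω : Set (E d)) : Type := Lp ℝ 2 ((surf d).restrict (frontier Ω))

/-- The restriction `φ|_Ω ↦ φ|_∂Ω` for `φ ∈ C_c^∞(ℝ^d)`, as a subspace of `H¹(Ω) × L²(∂Ω)`. -/
def smoothTraceGraph (Ω : Set (E d)) : Submodule ℝ (H1 Ω × L2bd Ω) where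
  carrier := {p | ∃ φ : E d → ℝ, ContDiff ℝ ∞ φ ∧ HasCompactSupport φ ∧
    fn p.1 =ᵐ[volume.restrict Ω] φ ∧ p.2 =ᵐ[(surf d).restrict (frontier Ω)] φ}
  zero_mem' := ⟨0, contDiff_const, HasCompactSupport.zero, Lp.coeFn_zero _ _ _,
    Lp.coeFn_zero _ _ _⟩
  add_mem' := by
    rintro p q ⟨φ, h1, h2, h3, h4⟩ ⟨ψ, k1, k2, k3, k4⟩
    exact ⟨φ + ψ, h1.add k1, h2.add k2, (Lp.coeFn_add (fn p.1) (fn q.1)).trans (h3.add k3),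
      (Lp.coeFn_add p.2 q.2).trans (h4.add k4)⟩
  smul_mem' := by
    rintro c p ⟨φ, h1, h2, h3, h4⟩
    exact ⟨c • φ, h1.const_smul c, h2.smul_left (f := fun _ => c),
      (Lp.coeFn_smul c (fn p.1)).trans (h3.const_smul c),
      (Lp.coeFn_smul c p.2).trans (h4.const_smul c)⟩

/-- The graph of the trace operator: the closure in `H¹(Ω) × L²(∂Ω)` of the graph of the
restriction map of smooth functions. -/
def traceGraph (Ω : Set (E d)) : Submodule ℝ (H1 Ω × L2bd Ω) :=
  (smoothTraceGraph Ω).topologicalClosure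

open Classical in
/-- The trace `tr v ∈ L²(∂Ω)` of `v ∈ H¹(Ω)` (on a bounded Lipschitz domain, `traceGraph` is the
graph of an everywhere defined operator, so that the second case does not occur). -/
def trace {Ω : Set (E d)} (v : H1 Ω) : L2bd Ω :=
  if h : ∃ w, (v, w) ∈ traceGraph Ω then h.choose else 0

/-- `{v ∈ H¹(Ω) : tr v = 0 a.e. on γ}` for `γ ⊆ ∂Ω`. -/
def H1zero (Ω γ : Set (E d)) : Submodule ℝ (H1 Ω) where
  carrier := {v | ∃ w : L2bd Ω, (v, w) ∈ traceGraph Ω ∧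
    ∀ᵐ x ∂((surf d).restrict (frontier Ω)), x ∈ γ → w x = 0}
  zero_mem' := by
    refine ⟨0, (traceGraph Ω).zero_mem, ?_⟩
    filter_upwards [Lp.coeFn_zero ℝ 2 ((surf d).restrict (frontier Ω))] with x hx _
    rw [hx]
    simp
  add_mem' := by
    rintro v v' ⟨w, h1, h2⟩ ⟨w', h1', h2'⟩
    refine ⟨w + w', (traceGraph Ω).add_mem h1 h1', ?_⟩
    filter_upwards [h2, h2', Lp.coeFn_add w w'] with x hx hx' h hγ
    rw [h]
    simp [hx hγ, hx' hγ]
  smul_mem' := by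
    rintro c v ⟨w, h1, h2⟩
    refine ⟨c • w, (traceGraph Ω).smul_mem c h1, ?_⟩
    filter_upwards [h2, Lp.coeFn_smul c w] with x hx h hγ
    simp [h, hx hγ]

/-- `H^{1/2}(γ)`, the range of `v ↦ (tr v)|_γ` on `H¹(Ω)` with the quotient norm
`inf {‖v‖ : (tr v)|_γ = ·}`, realized as the quotient of `H¹(Ω)` by the kernel of that map. -/
abbrev HHalf (Ω γ : Set (E d)) : Type := H1 Ω ⧸ H1zero Ω γ

/-- `(tr v)|_γ ∈ H^{1/2}(γ)`. -/
def traceOn {Ω : Set (E d)} (γ : Set (E d)) (v : H1 Ω) : HHalf Ω γ := (H1zero Ω γ).mkQ v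

/-- `⟨y·n, v⟩_∂Ω`, the normal trace of `y ∈ H(div; Ω)` applied to `v ∈ H¹(Ω)`. -/
def normalTrace {Ω : Set (E d)} (y : HDiv Ω) (v : H1 Ω) : ℝ :=
  ⟪grad Ω v, vec y⟫_ℝ + ⟪fn v, div y⟫_ℝ

/-- `L^∞(γ)` with respect to surface measure. -/
abbrev Linf (γ : Set (E d)) : Type := Lp ℝ ∞ ((surf d).restrict γ)

/-- `(b, tr v)_γ` for `b ∈ L^∞(γ)`, `v ∈ H¹(Ω)`. -/
def bdPair {Ω : Set (E d)} (γ : Set (E d)) (b : Linf γ) (v : H1 Ω) : ℝ :=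
  ∫ x in γ, b x * trace v x ∂(surf d)

/-- `‖tr v‖_{1,γ}`. -/
def bdNorm1 {Ω : Set (E d)} (γ : Set (E d)) (v : H1 Ω) : ℝ :=
  ∫ x in γ, |trace v x| ∂(surf d)

/-- `b ∈ L^∞(ΓI)` extends the normal trace of `y`, tested with the functions in `H¹(Ω)` that vanish
on `ΓD` and `ΓN`. -/
def IsNormalExt {Ω : Set (E d)} (ΓI ΓD ΓN : Set (E d)) (y : HDiv Ω) (b : Linf ΓI) : Prop :=
  ∀ v ∈ H1zero Ω ΓD ⊓ H1zero Ω ΓN, bdPair ΓI b v = normalTrace y v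

/-- The space `H̄_I(div; Ω)`. -/
def HBar (Ω ΓI ΓD ΓN : Set (E d)) : Set (HDiv Ω) :=
  {y | ∃ b : Linf ΓI, IsNormalExt ΓI ΓD ΓN y b}

open Classical in
/-- The extended normal trace in `L^∞(ΓI)` of `y ∈ H̄_I(div; Ω)`. -/
def normalExt {Ω : Set (E d)} (ΓI ΓD ΓN : Set (E d)) (y : HDiv Ω) : Linf ΓI :=
  if h : ∃ b : Linf ΓI, IsNormalExt ΓI ΓD ΓN y b then h.choose else 0

/-! ### The primal and the dual energy functional -/

open Classical in
/-- The indicator functional of convex analysis: `0` if `P` holds and `+∞` otherwise. -/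
def ind (P : Prop) : EReal := if P then 0 else ⊤

variable {Ω : Set (E d)}

/-- `G(y) = ½ ‖y‖²` on `L²(Ω)^d`. -/
def G (Ω : Set (E d)) (y : L2v Ω) : EReal := ((1 / 2 * ‖y‖ ^ 2 : ℝ) : EReal)

/-- `F(v) = -(f,v)_Ω - ⟨g,v⟩_{ΓN} + 1/(2m) ‖v‖²_{1,ΓI} + I_{v = uD on ΓD}` on `H¹(Ω)`. -/
def F (ΓI ΓD ΓN : Set (E d)) (m : ℝ) (f : L2 Ω) (g : StrongDual ℝ (HHalf Ω ΓN))
    (uD : HHalf Ω ΓD) (v : H1 Ω) : EReal :=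
  ((-⟪f, fn v⟫_ℝ - g (traceOn ΓN v) + 1 / (2 * m) * bdNorm1 ΓI v ^ 2 : ℝ) : EReal)
    + ind (traceOn ΓD v = uD)

/-- The primal energy functional `I : H¹(Ω) → ℝ ∪ {+∞}`. -/
def primal (ΓI ΓD ΓN : Set (E d)) (m : ℝ) (f : L2 Ω) (g : StrongDual ℝ (HHalf Ω ΓN))
    (uD : HHalf Ω ΓD) (v : H1 Ω) : EReal :=
  ((1 / 2 * ‖grad Ω v‖ ^ 2 + 1 / (2 * m) * bdNorm1 ΓI v ^ 2 - ⟪f, fn v⟫_ℝ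
      - g (traceOn ΓN v) : ℝ) : EReal)
    + ind (traceOn ΓD v = uD)

/-- The dual energy functional `D`, to be considered on `H̄_I(div; Ω)`; here `hatu` is a lift of the
Dirichlet datum. -/
def dual (ΓI ΓD ΓN : Set (E d)) (m : ℝ) (f : L2 Ω) (g : StrongDual ℝ (HHalf Ω ΓN))
    (hatu : H1 Ω) (y : HDiv Ω) : EReal :=
  ((-(1 / 2) * ‖vec y‖ ^ 2 - m / 2 * ‖normalExt ΓI ΓD ΓN y‖ ^ 2
      + normalTrace y hatu - bdPair ΓI (normalExt ΓI ΓD ΓN y) hatu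
      - g (traceOn ΓN hatu) : ℝ) : EReal)
    - ind (div y = -f)
    - ind (∀ v ∈ H1zero Ω ΓI ⊓ H1zero Ω ΓD, normalTrace y v = g (traceOn ΓN v))

end Insulation

end

/-! For a feasible `v` and a field `y` that satisfies the constraints, with boundary flux `b`, the
duality gap has a closed form: I(v) - D(y) = 1/2 ‖∇v - y‖² + (m/2 ‖b‖_∞² + 1/(2m) ‖v‖_1² + (b, v)),
the last three terms being taken on Γ_I (`primal_eq_dual_add`). The bracket is nonnegative by Hölder
and Young (`bdPair_add_nonneg`). This is weak duality. If the gap vanishes, then y = ∇v and the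
boundary relation holds (`optimality_of_primal_eq_dual`); in particular the dual solution is
determined by any one primal solution.

The gap does vanish. A minimizer u exists by the direct method, coercivity coming from a Poincaré
inequality with the L¹-norm on Γ_I (`exists_poincare`). With N = ‖u‖_1, the residual R(w) = (f, w) +
⟨g, w⟩ - (∇u, ∇w) satisfies R(w) ≤ N/m (‖u + w‖_1 - N) for all w in H¹_D. Hahn-Banach in L¹(Γ_I),
with the value N²/m prescribed at tr u, together with the duality of L¹ and L^∞
(`exists_Linf_of_dual`) turns R into a bounded flux with norm at most N/m
(`exists_flux_of_minimizer`), and z = ∇u with this flux closes the gap.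

The Fenchel dual is computed in the same spirit. Finiteness of F*(-∇* y) forces the residual of y to
factor through the trace on Γ_I, so that y has a bounded flux in the sense of `IsEquilibrium`. The
supremum then only sees traces, and these are dense in L¹(Γ_I), which gives m/2 ‖b‖²
(`conjugate_F`).

The delicate point is that membership in the extended space and the constraint in D express the
balance of forces only for test functions of H¹_D that vanish in addition on Γ_N, respectively on
Γ_I, whereas all of H¹_D is needed. `map_eq_zero_of_separate` bridges this: a function of H¹_D is
cut off near the common boundary of Γ_I and Γ_N and then split into two admissible pieces. The
triangulation puts the common boundary into simplices of dimension at most d - 2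
(`IsInsulationDomain.smallTubes`), so that tubes of radius δ have volume O(δ²), and cutoffs with
gradients of order 1/δ stay bounded in H¹. Weak limits do the rest.

The trace operator is obtained from the trace inequality in Lipschitz charts and from the density of
smooth functions. Density is proved by orthogonality, so that weak convergence of mollifications
suffices. -/

noncomputable section

namespace Insulation

/-! ### Functional-analytic preliminaries -/

section Functional

/-- A linear functional dominated by `κ ‖T ·‖` factors through `T` by a bounded functional. -/
theorem exists_dual_comp_eq {W X : Type*} [AddCommGroup W] [Module ℝ W] [NormedAddCommGroup X]
    [NormedSpace ℝ X] (T : W →ₗ[ℝ] X) (M : W →ₗ[ℝ] ℝ) {κ : ℝ} (hκ : 0 ≤ κ)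
    (h : ∀ w, M w ≤ κ * ‖T w‖) :
    ∃ l : StrongDual ℝ X, ‖l‖ ≤ κ ∧ ∀ w, l (T w) = M w := by
  have habs : ∀ w, |M w| ≤ κ * ‖T w‖ := fun w => by
    rw [abs_le]
    have := h (-w)
    simp only [map_neg, norm_neg] at this
    exact ⟨by linarith, h w⟩
  -- A linear section of `T` defines the functional on the range. The choice of the section is
  -- immaterial, since `M` vanishes on the kernel of `T` by `habs`.
  obtain ⟨s, hs⟩ := T.rangeRestrict.exists_rightInverse_of_surjective T.range_rangeRestrict
  have hs' : ∀ x, T (s x) = x := fun x => congrArg Subtype.val (LinearMap.congr_fun hs x)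
  let f : StrongDual ℝ (LinearMap.range T) := (M.comp s).mkContinuous κ fun x => by
    have := habs (s x)
    rw [hs'] at this
    exact this
  obtain ⟨l, hl, hn⟩ := exists_extension_norm_eq (LinearMap.range T) f
  refine ⟨l, hn ▸ LinearMap.mkContinuous_norm_le _ hκ _, fun w => ?_⟩
  have h1 : l (T w) = M (s ⟨T w, LinearMap.mem_range_self T w⟩) :=
    hl ⟨T w, LinearMap.mem_range_self T w⟩
  rw [h1, ← sub_eq_zero, ← map_sub, ← abs_eq_zero]
  refine le_antisymm ((habs _).trans ?_) (abs_nonneg _)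
  rw [map_sub, hs']
  simp

/-- If a bounded sequence in a closed subspace `K` of a Hilbert space has convergent images under
a bounded operator `J`, then the limit is the image of an element of `K` with the same bound. -/
theorem exists_mem_of_tendsto_of_bounded {H H' : Type*} [NormedAddCommGroup H]
    [InnerProductSpace ℝ H] [CompleteSpace H] [NormedAddCommGroup H'] [InnerProductSpace ℝ H']
    [CompleteSpace H'] (J : H →L[ℝ] H') {K : Submodule ℝ H} (hK : IsClosed (K : Set H))
    {x : ℕ → H} (hxK : ∀ n, x n ∈ K) {C : ℝ} (hC : ∀ n, ‖x n‖ ≤ C) {a : H'}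
    (ha : Tendsto (fun n => J (x n)) atTop (𝓝 a)) : ∃ y ∈ K, ‖y‖ ≤ C ∧ J y = a := by
  have : CompleteSpace K := hK.completeSpace_coe
  let J' : K →L[ℝ] H' := J.comp K.subtypeL
  have hC0 : 0 ≤ C := (norm_nonneg _).trans (hC 0)
  -- Passing to the limit in ⟪J x_n, s⟫ = ⟪x_n, J* s⟫ gives ⟪a, s⟫ ≤ C ‖J* s‖. So ⟪a, ·⟫ factors
  -- through J* and the Riesz representative of the factor is the desired preimage; this takes the
  -- place of weak compactness.
  obtain ⟨l, hl, hlT⟩ := exists_dual_comp_eq (J'.adjoint : H' →ₗ[ℝ] K)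
    ((innerSL ℝ a : H' →L[ℝ] ℝ) : H' →ₗ[ℝ] ℝ) hC0 (fun s => by
      have h1 : Tendsto (fun n => ⟪J (x n), s⟫_ℝ) atTop (𝓝 ⟪a, s⟫_ℝ) :=
        ha.inner tendsto_const_nhds
      refine le_of_tendsto h1 (Eventually.of_forall fun n => ?_)
      have h2 : ⟪J (x n), s⟫_ℝ = ⟪(⟨x n, hxK n⟩ : K), J'.adjoint s⟫_ℝ := by
        rw [ContinuousLinearMap.adjoint_inner_right]
        rfl
      rw [h2]
      refine (real_inner_le_norm _ _).trans ?_
      exact mul_le_mul_of_nonneg_right (hC n) (norm_nonneg _))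
  let y : K := (InnerProductSpace.toDual ℝ K).symm l
  refine ⟨y, y.2, ?_, ?_⟩
  · have : ‖y‖ = ‖l‖ := LinearIsometryEquiv.norm_map _ _
    exact this ▸ hl
  · refine ext_inner_right ℝ fun s => ?_
    have h1 : l (J'.adjoint s) = ⟪a, s⟫_ℝ := hlT s
    have h2 : ⟪y, J'.adjoint s⟫_ℝ = l (J'.adjoint s) := InnerProductSpace.toDual_symm_apply
    rw [ContinuousLinearMap.adjoint_inner_right, h1] at h2
    exact h2

/-- A decreasing sequence of nonempty bounded closed convex sets in a Hilbert space has a common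
point. -/
theorem exists_mem_of_antitone_convex {H : Type*} [NormedAddCommGroup H] [InnerProductSpace ℝ H]
    [CompleteSpace H] {C : ℕ → Set H} (hne : ∀ n, (C n).Nonempty) (hcl : ∀ n, IsClosed (C n))
    (hcv : ∀ n, Convex ℝ (C n)) (hanti : Antitone C) (hb : Bornology.IsBounded (C 0)) :
    ∃ x, ∀ n, x ∈ C n := by
  have hex : ∀ n, ∃ v ∈ C n, ∀ w ∈ C n, ‖v‖ ≤ ‖w‖ := fun n => by
    obtain ⟨v, hv, h⟩ := exists_norm_eq_iInf_of_complete_convex (hne n) (hcl n).isComplete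
      (hcv n) 0
    refine ⟨v, hv, fun w hw => ?_⟩
    have h1 : ‖0 - v‖ ≤ ‖0 - w‖ := by
      rw [h]
      exact ciInf_le (f := fun w : C n => ‖0 - (w : H)‖)
        ⟨0, by rintro _ ⟨w, rfl⟩; exact norm_nonneg _⟩ ⟨w, hw⟩
    simpa using h1
  choose x hx hmin using hex
  have hmono : Monotone fun n => ‖x n‖ ^ 2 := fun n k hnk => by
    have := hmin n (x k) (hanti hnk (hx k))
    dsimp only
    gcongr
  obtain ⟨R, hR⟩ := hb.exists_norm_le
  have hbdd : BddAbove (range fun n => ‖x n‖ ^ 2) := by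
    refine ⟨R ^ 2, ?_⟩
    rintro _ ⟨n, rfl⟩
    have := hR (x n) (hanti (Nat.zero_le n) (hx n))
    dsimp only
    gcongr
  have hconv : CauchySeq fun n => ‖x n‖ ^ 2 := (tendsto_atTop_ciSup hmono hbdd).cauchySeq
  -- The midpoint of `x n` and `x k` lies in `C n`, so its norm is at least `‖x n‖`; the
  -- parallelogram law does the rest.
  have hpar : ∀ n k, n ≤ k → ‖x n - x k‖ ^ 2 ≤ 2 * (‖x k‖ ^ 2 - ‖x n‖ ^ 2) := by
    intro n k hnk
    have h1 := hmin n ((1 / 2 : ℝ) • x n + (1 / 2 : ℝ) • x k)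
      (hcv n (hx n) (hanti hnk (hx k)) (by norm_num) (by norm_num) (by norm_num))
    rw [← smul_add, norm_smul, Real.norm_of_nonneg (by norm_num)] at h1
    have h2 := parallelogram_law_with_norm ℝ (x n) (x k)
    have h3 : ‖x n‖ ^ 2 ≤ (1 / 2 * ‖x n + x k‖) ^ 2 := by gcongr
    nlinarith
  have hx' : CauchySeq x := by
    rw [Metric.cauchySeq_iff'] at hconv ⊢
    intro ε hε
    obtain ⟨N, hN⟩ := hconv (ε ^ 2 / 2) (by positivity)
    refine ⟨N, fun n hn => ?_⟩
    have h1 := hN n hn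
    rw [Real.dist_eq] at h1
    have h2 := hpar N n hn
    have h3 := (abs_lt.1 h1).2
    rw [dist_comm, dist_eq_norm]
    refine lt_of_pow_lt_pow_left₀ 2 hε.le ?_
    linarith
  obtain ⟨y, hy⟩ := cauchySeq_tendsto_of_complete hx'
  refine ⟨y, fun n => (hcl n).mem_of_tendsto hy ?_⟩
  filter_upwards [eventually_ge_atTop n] with k hk using hanti hk (hx k)

/-- The direct method: a proper convex lower semicontinuous functional on a Hilbert space with
bounded sublevel sets has a minimizer. -/
theorem ProperConvexLsc.exists_forall_le {H : Type*} [NormedAddCommGroup H]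
    [InnerProductSpace ℝ H] [CompleteSpace H] {J : H → EReal} (hJ : ProperConvexLsc J)
    (hb : ∀ c : ℝ, Bornology.IsBounded {v | J v ≤ c}) : ∃ u, ∀ v, J u ≤ J v := by
  obtain ⟨⟨⟨v₀, hv₀⟩, hbot⟩, hcv, hlsc⟩ := hJ
  set i : EReal := ⨅ v, J v with hi
  have hilt : i < ⊤ := (iInf_le _ v₀).trans_lt (lt_top_iff_ne_top.2 hv₀)
  obtain ⟨c, hc, hcm, hct⟩ := exists_seq_strictAnti_tendsto' hilt
  -- Convexity is phrased through the real epigraph, so the levels have to be real; lying strictly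
  -- between `i` and `⊤` makes them so.
  have hreal : ∀ n, ((c n).toReal : EReal) = c n := fun n =>
    EReal.coe_toReal (hcm n).2.ne (bot_le.trans_lt (hcm n).1).ne'
  obtain ⟨u, hu⟩ := exists_mem_of_antitone_convex (C := fun n => {v | J v ≤ c n})
    (fun n => by
      obtain ⟨v, hv⟩ := iInf_lt_iff.1 (hcm n).1
      exact ⟨v, hv.le⟩)
    (fun n => hlsc.isClosed_preimage _)
    (fun n => by
      intro v hv w hw a b ha hb hab
      have hv' : J v ≤ ((c n).toReal : EReal) := by rw [hreal]; exact hv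
      have hw' : J w ≤ ((c n).toReal : EReal) := by rw [hreal]; exact hw
      have := hcv (x := (v, (c n).toReal)) hv' (y := (w, (c n).toReal)) hw' ha hb hab
      simp only [Prod.smul_mk, Prod.mk_add_mk, mem_ofPred_eq, smul_eq_mul, ← add_mul, hab,
        one_mul, hreal] at this
      exact this)
    (fun n k hnk v hv => le_trans hv (hc.antitone hnk))
    (by
      have := hb (c 0).toReal
      rwa [hreal] at this)
  exact ⟨u, fun v => (ge_of_tendsto' hct fun n => hu n).trans (iInf_le _ v)⟩

end Functional

/-! ### The dual of `L¹` for finite measures -/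

section DualL1

variable {X : Type*} [MeasurableSpace X] {μ : Measure X}

theorem Linf_ae_norm_le (b : Lp ℝ ∞ μ) : ∀ᵐ x ∂μ, ‖b x‖ ≤ ‖b‖ := by
  filter_upwards [enorm_ae_le_eLpNormEssSup b μ] with x hx
  rw [← eLpNorm_exponent_top] at hx
  have := ENNReal.toReal_mono (Lp.eLpNorm_ne_top b) hx
  rwa [toReal_enorm] at this

/-- The pairing of `L^∞` and `L¹`. -/
theorem Linf_integrable_mul (b : Lp ℝ ∞ μ) {f : X → ℝ} (hf : Integrable f μ) :
    Integrable (fun x => b x * f x) μ :=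
  hf.bdd_mul (c := ‖b‖) (Lp.aestronglyMeasurable b) (by
    filter_upwards [Linf_ae_norm_le b] with x hx using hx)

theorem Linf_integral_le (b : Lp ℝ ∞ μ) {f : X → ℝ} (hf : Integrable f μ) :
    |∫ x, b x * f x ∂μ| ≤ ‖b‖ * ∫ x, |f x| ∂μ := by
  rw [← integral_const_mul, ← Real.norm_eq_abs]
  refine norm_integral_le_of_norm_le (hf.abs.const_mul _) ?_
  filter_upwards [Linf_ae_norm_le b] with x hx
  rw [norm_mul]
  gcongr
  exact (Real.norm_eq_abs _).le

/-- For a finite measure L² embeds into L¹, so the restriction of `l` to L² has a Riesz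
representative `b₂`. Testing with indicators gives |∫_s b₂| ≤ ‖l‖ μ(s), hence |b₂| ≤ ‖l‖ almost
everywhere, and the representation extends to L¹ by density of simple functions. -/
theorem exists_Linf_of_dual [IsFiniteMeasure μ] (l : StrongDual ℝ (Lp ℝ 1 μ)) :
    ∃ b : Lp ℝ ∞ μ, ‖b‖ ≤ ‖l‖ ∧ ∀ f : Lp ℝ 1 μ, l f = ∫ x, b x * f x ∂μ := by
  have hmem : ∀ f : Lp ℝ 2 μ, MemLp f 1 μ := fun f => (Lp.memLp f).mono_exponent (by norm_num)
  let ι : Lp ℝ 2 μ →ₗ[ℝ] Lp ℝ 1 μ :=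
    { toFun := fun f => (hmem f).toLp f
      map_add' := fun f g => by
        rw [← MemLp.toLp_add]
        exact MemLp.toLp_congr _ _ (Lp.coeFn_add f g)
      map_smul' := fun c f => by
        rw [RingHom.id_apply, ← MemLp.toLp_const_smul]
        exact MemLp.toLp_congr _ _ (Lp.coeFn_smul c f) }
  set A : ℝ≥0∞ := μ univ ^ (1 / (1 : ℝ≥0∞).toReal - 1 / (2 : ℝ≥0∞).toReal) with hA
  have hAtop : A ≠ ⊤ := by
    refine ENNReal.rpow_ne_top_of_nonneg (by norm_num) (measure_ne_top _ _)
  have hι : ∀ f, ‖ι f‖ ≤ A.toReal * ‖f‖ := fun f => by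
    change ‖(hmem f).toLp f‖ ≤ _
    rw [Lp.norm_toLp, Lp.norm_def, mul_comm, ← ENNReal.toReal_mul]
    refine ENNReal.toReal_mono (ENNReal.mul_ne_top (Lp.eLpNorm_ne_top f) hAtop) ?_
    exact eLpNorm_le_eLpNorm_mul_rpow_measure_univ (by norm_num) (Lp.aestronglyMeasurable f)
  let b₂ : Lp ℝ 2 μ := (InnerProductSpace.toDual ℝ (Lp ℝ 2 μ)).symm (l.comp (ι.mkContinuous _ hι))
  have hb₂i : Integrable b₂ μ := memLp_one_iff_integrable.1 (hmem b₂)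
  have key : ∀ s (hs : MeasurableSet s) (c : ℝ),
      l (indicatorConstLp 1 hs (measure_ne_top μ s) c) = c * ∫ x in s, b₂ x ∂μ := by
    intro s hs c
    have h1 : ⟪b₂, indicatorConstLp 2 hs (measure_ne_top μ s) c⟫_ℝ =
        l (ι (indicatorConstLp 2 hs (measure_ne_top μ s) c)) :=
      InnerProductSpace.toDual_symm_apply
    have h2 : ι (indicatorConstLp 2 hs (measure_ne_top μ s) c)
        = indicatorConstLp 1 hs (measure_ne_top μ s) c := by
      refine Lp.ext ?_
      exact ((hmem _).coeFn_toLp).trans (indicatorConstLp_coeFn.trans indicatorConstLp_coeFn.symm)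
    rw [← h2, ← h1, real_inner_comm, L2.inner_indicatorConstLp_eq_inner_setIntegral]
    simp [mul_comm]
  have hle : ∀ s, MeasurableSet s → |∫ x in s, b₂ x ∂μ| ≤ ∫ _ in s, ‖l‖ ∂μ := by
    intro s hs
    have h1 := l.le_opNorm (indicatorConstLp 1 hs (measure_ne_top μ s) 1)
    rw [key, one_mul, norm_indicatorConstLp (by norm_num) (by norm_num)] at h1
    simpa [mul_comm, Measure.real] using h1
  have hup : ∀ᵐ x ∂μ, b₂ x ≤ ‖l‖ :=
    ae_le_of_forall_setIntegral_le hb₂i (integrable_const _) fun s hs _ =>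
      (le_abs_self _).trans (hle s hs)
  have hlo : ∀ᵐ x ∂μ, -b₂ x ≤ ‖l‖ :=
    ae_le_of_forall_setIntegral_le hb₂i.neg (integrable_const _) fun s hs _ => by
      simp only [integral_neg]
      exact (neg_le_abs _).trans (hle s hs)
  have hbd : ∀ᵐ x ∂μ, ‖b₂ x‖ ≤ ‖l‖ := by
    filter_upwards [hup, hlo] with x h1 h2
    exact abs_le.2 ⟨by linarith, h1⟩
  have hmb : MemLp b₂ ∞ μ := memLp_top_of_bound (Lp.aestronglyMeasurable _) _ hbd
  have hae : hmb.toLp b₂ =ᵐ[μ] b₂ := hmb.coeFn_toLp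
  refine ⟨hmb.toLp b₂, ?_, fun f => ?_⟩
  · have := Lp.norm_le_of_ae_bound (f := hmb.toLp b₂) (norm_nonneg l) (by
      filter_upwards [hae, hbd] with x h1 h2
      rw [h1]
      exact h2)
    simpa using this
  · refine Lp.induction (by norm_num) (motive := fun f : Lp ℝ 1 μ =>
      l f = ∫ x, hmb.toLp b₂ x * f x ∂μ) ?_ ?_ ?_ f
    · intro c s hs hμs
      have h1 := key s hs c
      rw [Lp.simpleFunc.coe_indicatorConst, h1, ← integral_const_mul, ← integral_indicator hs]
      refine integral_congr_ae ?_
      filter_upwards [hae, indicatorConstLp_coeFn (p := 1) (hs := hs) (hμs := hμs.ne) (c := c)]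
        with x h1 h2
      rw [h1, h2]
      by_cases hx : x ∈ s <;> simp [hx, mul_comm]
    · intro f g hf hg _ h1 h2
      rw [map_add, h1, h2, ← integral_add]
      · refine integral_congr_ae ?_
        filter_upwards [Lp.coeFn_add (hf.toLp f) (hg.toLp g)] with x hx
        rw [hx]
        simp [mul_add]
      · exact Linf_integrable_mul _ (L1.integrable_coeFn _)
      · exact Linf_integrable_mul _ (L1.integrable_coeFn _)
    · refine isClosed_eq l.continuous ?_
      refine LipschitzWith.continuous (K := ‖hmb.toLp b₂‖₊) (LipschitzWith.of_dist_le_mul ?_)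
      intro f g
      rw [Real.dist_eq, ← integral_sub (Linf_integrable_mul _ (L1.integrable_coeFn _))
        (Linf_integrable_mul _ (L1.integrable_coeFn _)), dist_eq_norm, L1.norm_eq_integral_norm]
      have h1 : ∫ x, (hmb.toLp b₂ x * f x - hmb.toLp b₂ x * g x) ∂μ
          = ∫ x, hmb.toLp b₂ x * (f - g : Lp ℝ 1 μ) x ∂μ := by
        refine integral_congr_ae ?_
        filter_upwards [Lp.coeFn_sub f g] with x hx
        rw [hx]
        simp [mul_sub]
      rw [h1]
      exact Linf_integral_le _ (L1.integrable_coeFn _)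

end DualL1

end Insulation

namespace Insulation

/-! ### Pointwise multipliers on `L²` -/

section Multiplier

variable {X F G : Type*} [MeasurableSpace X] {μ : Measure X}
  [NormedAddCommGroup F] [NormedSpace ℝ F] [NormedAddCommGroup G] [NormedSpace ℝ G]

theorem memLp_clm_apply {T : X → F →L[ℝ] G} (hT : AEStronglyMeasurable T μ) {C : ℝ}
    (hC : ∀ᵐ x ∂μ, ‖T x‖ ≤ C) (f : Lp F 2 μ) : MemLp (fun x => T x (f x)) 2 μ := by
  refine (Lp.memLp f).of_le_mul (c := C) ?_ ?_
  · exact (ContinuousLinearMap.id ℝ (F →L[ℝ] G)).aestronglyMeasurable_comp₂ hT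
      (Lp.aestronglyMeasurable f)
  · filter_upwards [hC] with x hx
    exact (T x).le_of_opNorm_le hx _

/-- The operator `f ↦ (x ↦ T x (f x))` on `L²` for a bounded measurable family `T`. -/
def multL {T : X → F →L[ℝ] G} (hT : AEStronglyMeasurable T μ) {C : ℝ}
    (hC : ∀ᵐ x ∂μ, ‖T x‖ ≤ C) : Lp F 2 μ →L[ℝ] Lp G 2 μ :=
  LinearMap.mkContinuous
    { toFun := fun f => (memLp_clm_apply hT hC f).toLp _
      map_add' := fun f g => by
        rw [← MemLp.toLp_add]
        refine MemLp.toLp_congr _ _ ?_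
        filter_upwards [Lp.coeFn_add f g] with x hx
        rw [hx, Pi.add_apply, Pi.add_apply, map_add]
      map_smul' := fun c f => by
        rw [RingHom.id_apply, ← MemLp.toLp_const_smul]
        refine MemLp.toLp_congr _ _ ?_
        filter_upwards [Lp.coeFn_smul c f] with x hx
        rw [hx, Pi.smul_apply, Pi.smul_apply, map_smul] }
    C fun f => by
      refine Lp.norm_le_mul_norm_of_ae_le_mul ?_
      filter_upwards [hC, (memLp_clm_apply hT hC f).coeFn_toLp] with x hx h
      simp only [LinearMap.coe_mk, AddHom.coe_mk]
      rw [h]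
      exact (T x).le_of_opNorm_le hx _

theorem coeFn_multL {T : X → F →L[ℝ] G} (hT : AEStronglyMeasurable T μ) {C : ℝ}
    (hC : ∀ᵐ x ∂μ, ‖T x‖ ≤ C) (f : Lp F 2 μ) : multL hT hC f =ᵐ[μ] fun x => T x (f x) :=
  (memLp_clm_apply hT hC f).coeFn_toLp

end Multiplier

variable {d : ℕ} {Ω : Set (E d)}

/-! ### Basic properties of `H¹(Ω)` -/

theorem gradient_apply (φ : E d → ℝ) (x : E d) (i : Fin d) :
    gradient φ x i = fderiv ℝ φ x (EuclideanSpace.single i 1) := by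
  have h := inner_gradient_left (𝕜 := ℝ) (f := φ) (x := x) (y := EuclideanSpace.single i 1)
  rw [← h, EuclideanSpace.inner_single_right]
  simp

theorem norm_gradient (φ : E d → ℝ) (x : E d) : ‖gradient φ x‖ = ‖fderiv ℝ φ x‖ := by
  simp [gradient]

theorem continuous_gradient {φ : E d → ℝ} (hφ : ContDiff ℝ ∞ φ) : Continuous (gradient φ) :=
  (LinearIsometryEquiv.continuous _).comp (hφ.continuous_fderiv (by simp))

theorem hasCompactSupport_gradient {φ : E d → ℝ} (h : HasCompactSupport φ) :
    HasCompactSupport (gradient φ) :=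
  (h.fderiv ℝ).comp_left (map_zero _)

theorem inner_H1 (v w : H1 Ω) : ⟪v, w⟫_ℝ = ⟪fn v, fn w⟫_ℝ + ⟪grad Ω v, grad Ω w⟫_ℝ :=
  WithLp.prod_inner_apply (𝕜 := ℝ) (v : WithLp 2 (L2 Ω × L2v Ω)) w

theorem norm_sq_H1 (v : H1 Ω) : ‖v‖ ^ 2 = ‖fn v‖ ^ 2 + ‖grad Ω v‖ ^ 2 :=
  WithLp.prod_norm_sq_eq_of_L2 (v : WithLp 2 (L2 Ω × L2v Ω))

/-- The inclusion `H¹(Ω) → L²(Ω)`. -/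
def fnL (Ω : Set (E d)) : H1 Ω →L[ℝ] L2 Ω :=
  (WithLp.fstL 2 ℝ (L2 Ω) (L2v Ω)).comp (H1 Ω).subtypeL

theorem fnL_apply (v : H1 Ω) : fnL Ω v = fn v := rfl

theorem norm_fn_le (v : H1 Ω) : ‖fn v‖ ≤ ‖v‖ := by
  have := norm_sq_H1 v
  nlinarith [norm_nonneg v, norm_nonneg (fn v), sq_nonneg ‖grad Ω v‖]

theorem norm_grad_le (v : H1 Ω) : ‖grad Ω v‖ ≤ ‖v‖ := by
  have := norm_sq_H1 v
  nlinarith [norm_nonneg v, norm_nonneg (grad Ω v), sq_nonneg ‖fn v‖]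

theorem isWeakGrad_grad (v : H1 Ω) : IsWeakGrad Ω (fn v) (grad Ω v) := v.2

theorem inner_L2_toLp {μ : Measure (E d)} (v : Lp ℝ 2 μ) {φ : E d → ℝ} (h : MemLp φ 2 μ) :
    ⟪v, h.toLp φ⟫_ℝ = ∫ x, v x * φ x ∂μ := by
  rw [L2.inner_def]
  refine integral_congr_ae ?_
  filter_upwards [h.coeFn_toLp] with x hx
  rw [hx]
  simp [mul_comm]

theorem isClosed_H1 : IsClosed (H1 Ω : Set (WithLp 2 (L2 Ω × L2v Ω))) := by
  have : (H1 Ω : Set (WithLp 2 (L2 Ω × L2v Ω))) = ⋂ (φ : E d → ℝ) (hφ : IsTest Ω φ) (i : Fin d),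
      {p | ⟪p.fst, (hφ.memLp_fderiv (EuclideanSpace.single i 1)).toLp _⟫_ℝ =
        -∫ x in Ω, p.snd x i * φ x} := by
    ext p
    simp only [mem_iInter, mem_ofPred_eq]
    refine forall_congr' fun φ => forall_congr' fun hφ => forall_congr' fun i => ?_
    rw [inner_L2_toLp]
  rw [this]
  refine isClosed_iInter fun φ => isClosed_iInter fun hφ => isClosed_iInter fun i => ?_
  let P : L2v Ω →L[ℝ] L2 Ω := (EuclideanSpace.proj i : E d →L[ℝ] ℝ).compLpL 2 (volume.restrict Ω)
  have hP : ∀ w : L2v Ω, ∫ x in Ω, w x i * φ x = ⟪P w, hφ.memLp.toLp φ⟫_ℝ := fun w => by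
    rw [inner_L2_toLp]
    refine integral_congr_ae ?_
    filter_upwards [(EuclideanSpace.proj i : E d →L[ℝ] ℝ).coeFn_compLp w] with x hx
    change _ = ((EuclideanSpace.proj i : E d →L[ℝ] ℝ).compLp w) x * _
    rw [hx]
    rfl
  simp_rw [hP]
  exact isClosed_eq ((WithLp.fstL 2 ℝ (L2 Ω) (L2v Ω)).continuous.inner continuous_const)
    ((P.continuous.comp (WithLp.sndL 2 ℝ (L2 Ω) (L2v Ω)).continuous).inner continuous_const).neg

instance : CompleteSpace (H1 Ω) := isClosed_H1.completeSpace_coe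

/-- The weak gradient is unique. -/
theorem fn_injective (hΩ : IsOpen Ω) : Function.Injective (fn : H1 Ω → L2 Ω) := by
  intro v w hvw
  have h1 : grad Ω v = grad Ω w := by
    have key : ∀ i : Fin d, ∀ᵐ x ∂(volume.restrict Ω), grad Ω v x i = grad Ω w x i := by
      intro i
      have hloc : LocallyIntegrableOn (fun x => grad Ω v x i - grad Ω w x i) Ω
          (volume.restrict Ω) :=
        LocallyIntegrable.locallyIntegrableOn
          (((memLp_coord _ i).sub (memLp_coord _ i)).locallyIntegrable (by norm_num)) Ω
      have := hΩ.ae_eq_zero_of_integral_contDiff_smul_eq_zero hloc (fun φ h1 h2 h3 => by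
        have hφ : IsTest Ω φ := ⟨h1, h2, h3⟩
        have e1 := isWeakGrad_grad v φ hφ i
        have e2 := isWeakGrad_grad w φ hφ i
        rw [hvw, e2, neg_inj] at e1
        have : ∀ x, φ x • (grad Ω v x i - grad Ω w x i) =
            grad Ω v x i * φ x - grad Ω w x i * φ x := fun x => by
          rw [smul_eq_mul]
          ring
        simp_rw [this]
        rw [integral_sub (hφ.integrable_coord _ _) (hφ.integrable_coord _ _), e1, sub_self])
      filter_upwards [this, ae_restrict_mem hΩ.measurableSet] with x hx hxΩ
      exact sub_eq_zero.1 (hx hxΩ)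
    refine Lp.ext ?_
    filter_upwards [ae_all_iff.2 key] with x hx
    ext i
    exact hx i
  exact Subtype.ext ((WithLp.ofLp_injective 2) (Prod.ext hvw h1))

theorem fn_add (v w : H1 Ω) : fn (v + w) = fn v + fn w := rfl

theorem fn_smul (c : ℝ) (v : H1 Ω) : fn (c • v) = c • fn v := rfl

/-- An element of `H¹(Ω)` from functions. -/
def mkH1 {v : E d → ℝ} {w : E d → E d} (hv : MemLp v 2 (volume.restrict Ω))
    (hw : MemLp w 2 (volume.restrict Ω))
    (h : ∀ φ, IsTest Ω φ → ∀ i : Fin d,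
      ∫ x in Ω, v x * fderiv ℝ φ x (EuclideanSpace.single i 1) = -∫ x in Ω, w x i * φ x) : H1 Ω :=
  ⟨WithLp.toLp 2 (hv.toLp v, hw.toLp w), fun φ hφ i => by
    change ∫ x in Ω, hv.toLp v x * _ = -∫ x in Ω, hw.toLp w x i * _
    have h1 : ∫ x in Ω, hv.toLp v x * fderiv ℝ φ x (EuclideanSpace.single i 1) =
        ∫ x in Ω, v x * fderiv ℝ φ x (EuclideanSpace.single i 1) := by
      refine integral_congr_ae ?_
      filter_upwards [hv.coeFn_toLp] with x hx
      rw [hx]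
    have h2 : ∫ x in Ω, hw.toLp w x i * φ x = ∫ x in Ω, w x i * φ x := by
      refine integral_congr_ae ?_
      filter_upwards [hw.coeFn_toLp] with x hx
      rw [hx]
    rw [h1, h2, h φ hφ i]⟩

theorem fn_mkH1 {v : E d → ℝ} {w : E d → E d} (hv : MemLp v 2 (volume.restrict Ω))
    (hw : MemLp w 2 (volume.restrict Ω)) (h) :
    fn (mkH1 hv hw h) =ᵐ[volume.restrict Ω] v := hv.coeFn_toLp

theorem grad_mkH1 {v : E d → ℝ} {w : E d → E d} (hv : MemLp v 2 (volume.restrict Ω))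
    (hw : MemLp w 2 (volume.restrict Ω)) (h) :
    grad Ω (mkH1 hv hw h) =ᵐ[volume.restrict Ω] w := hw.coeFn_toLp

theorem memLp_restrict_of_compact {F : Type*} [NormedAddCommGroup F] {φ : E d → F}
    (h : Continuous φ) (hc : HasCompactSupport φ) : MemLp φ 2 (volume.restrict Ω) :=
  (h.memLp_of_hasCompactSupport hc).restrict Ω

/-- The restriction to `Ω` of a function in `C_c^∞(ℝ^d)`. -/
def smoothH1 (Ω : Set (E d)) {φ : E d → ℝ} (hφ : ContDiff ℝ ∞ φ) (hc : HasCompactSupport φ) :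
    H1 Ω :=
  mkH1 (v := φ) (w := gradient φ) (memLp_restrict_of_compact hφ.continuous hc)
    (memLp_restrict_of_compact (continuous_gradient hφ) (hasCompactSupport_gradient hc)) (by
      intro ψ hψ i
      -- Both integrands vanish outside `Ω` because `ψ` does, so the integration by parts takes
      -- place in the whole space and needs no regularity of the boundary.
      have h1 : ∫ x in Ω, φ x * fderiv ℝ ψ x (EuclideanSpace.single i 1) =
          ∫ x, φ x * fderiv ℝ ψ x (EuclideanSpace.single i 1) := by
        refine setIntegral_eq_integral_of_forall_compl_eq_zero fun x hx => ?_
        have : x ∉ tsupport (fderiv ℝ ψ) := fun h =>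
          hx (hψ.2.2 (tsupport_fderiv_subset ℝ h))
        rw [image_eq_zero_of_notMem_tsupport this]
        simp
      have h2 : ∫ x in Ω, gradient φ x i * ψ x = ∫ x, gradient φ x i * ψ x := by
        refine setIntegral_eq_integral_of_forall_compl_eq_zero fun x hx => ?_
        have : x ∉ tsupport ψ := fun h => hx (hψ.2.2 h)
        rw [image_eq_zero_of_notMem_tsupport this, mul_zero]
      rw [h1, h2]
      simp_rw [gradient_apply]
      have c1 : Continuous fun x => fderiv ℝ φ x (EuclideanSpace.single i 1) :=
        (hφ.continuous_fderiv (by simp)).clm_apply continuous_const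
      have c2 : Continuous fun x => fderiv ℝ ψ x (EuclideanSpace.single i 1) :=
        (hψ.1.continuous_fderiv (by simp)).clm_apply continuous_const
      refine integral_mul_fderiv_eq_neg_fderiv_mul_of_integrable ?_ ?_ ?_ ?_ ?_
      · exact (c1.mul hψ.1.continuous).integrable_of_hasCompactSupport (hψ.2.1.mul_left)
      · exact (hφ.continuous.mul c2).integrable_of_hasCompactSupport (hc.mul_right)
      · exact (hφ.continuous.mul hψ.1.continuous).integrable_of_hasCompactSupport (hc.mul_right)
      · exact fun x _ => hφ.differentiable (by simp) x
      · exact fun x _ => hψ.1.differentiable (by simp) x)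

theorem fn_smoothH1 {φ : E d → ℝ} (hφ : ContDiff ℝ ∞ φ) (hc : HasCompactSupport φ) :
    fn (smoothH1 Ω hφ hc) =ᵐ[volume.restrict Ω] φ := fn_mkH1 _ _ _

theorem grad_smoothH1 {φ : E d → ℝ} (hφ : ContDiff ℝ ∞ φ) (hc : HasCompactSupport φ) :
    grad Ω (smoothH1 Ω hφ hc) =ᵐ[volume.restrict Ω] gradient φ := grad_mkH1 _ _ _

theorem eq_smoothH1 (hΩ : IsOpen Ω) {φ : E d → ℝ} (hφ : ContDiff ℝ ∞ φ) (hc : HasCompactSupport φ)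
    {v : H1 Ω} (hv : fn v =ᵐ[volume.restrict Ω] φ) : v = smoothH1 Ω hφ hc :=
  fn_injective hΩ (Lp.ext (hv.trans (fn_smoothH1 hφ hc).symm))

/-! ### Multiplication by smooth functions -/

theorem exists_bound_on {F : Type*} [NormedAddCommGroup F] (hb : Bornology.IsBounded Ω)
    {ψ : E d → F} (hψ : Continuous ψ) : ∃ C, ∀ x ∈ closure Ω, ‖ψ x‖ ≤ C :=
  hb.isCompact_closure.exists_bound_of_continuousOn hψ.continuousOn

theorem IsTest.mul_smooth {φ ψ : E d → ℝ} (hφ : IsTest Ω φ) (hψ : ContDiff ℝ ∞ ψ) :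
    IsTest Ω (fun x => ψ x * φ x) :=
  ⟨hψ.mul hφ.1, hφ.2.1.mul_left, (tsupport_mul_subset_right).trans hφ.2.2⟩

theorem memLp_smooth_smul (hΩ : IsOpen Ω) (hb : Bornology.IsBounded Ω) {F : Type*}
    [NormedAddCommGroup F] [NormedSpace ℝ F] {ψ : E d → ℝ} (hψ : Continuous ψ)
    (w : Lp F 2 (volume.restrict Ω)) :
    MemLp (fun x => ψ x • w x) 2 (volume.restrict Ω) := by
  obtain ⟨C, hC⟩ := exists_bound_on hb hψ
  refine (Lp.memLp w).of_le_mul (c := C)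
    (hψ.aestronglyMeasurable.smul (Lp.aestronglyMeasurable w)) ?_
  filter_upwards [ae_restrict_mem hΩ.measurableSet] with x hx
  rw [norm_smul]
  gcongr
  exact hC x (subset_closure hx)

theorem memLp_smul_smooth (hΩ : IsOpen Ω) (hb : Bornology.IsBounded Ω) {F : Type*}
    [NormedAddCommGroup F] [NormedSpace ℝ F] {ψ : E d → F} (hψ : Continuous ψ) (w : L2 Ω) :
    MemLp (fun x => w x • ψ x) 2 (volume.restrict Ω) := by
  obtain ⟨C, hC⟩ := exists_bound_on hb hψ
  refine (Lp.memLp w).of_le_mul (c := C)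
    ((Lp.aestronglyMeasurable w).smul hψ.aestronglyMeasurable) ?_
  filter_upwards [ae_restrict_mem hΩ.measurableSet] with x hx
  rw [norm_smul, mul_comm]
  gcongr
  exact hC x (subset_closure hx)

theorem memLp_product_grad (hΩ : IsOpen Ω) (hb : Bornology.IsBounded Ω) {ψ : E d → ℝ}
    (hψ : ContDiff ℝ ∞ ψ) (v : H1 Ω) :
    MemLp (fun x => ψ x • grad Ω v x + fn v x • gradient ψ x) 2 (volume.restrict Ω) :=
  MemLp.add (f := fun x => ψ x • grad Ω v x) (g := fun x => fn v x • gradient ψ x)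
    (memLp_smooth_smul hΩ hb hψ.continuous _)
    (memLp_smul_smooth hΩ hb (continuous_gradient hψ) _)

/-- The product `ψ φ` is again a test function; inserting it into the weak gradient identity of `v`
and expanding its derivative gives the product rule. -/
theorem weakGrad_product {ψ : E d → ℝ} (hψ : ContDiff ℝ ∞ ψ) (v : H1 Ω) :
    ∀ φ, IsTest Ω φ → ∀ i : Fin d,
      ∫ x in Ω, ψ x • fn v x * fderiv ℝ φ x (EuclideanSpace.single i 1) =
        -∫ x in Ω, (ψ x • grad Ω v x + fn v x • gradient ψ x) i * φ x := by
  intro φ hφ i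
  have hφψ := hφ.mul_smooth hψ
  have e := isWeakGrad_grad v _ hφψ i
  have hd : ∀ x, fderiv ℝ (fun x => ψ x * φ x) x (EuclideanSpace.single i 1) =
      ψ x * fderiv ℝ φ x (EuclideanSpace.single i 1) + gradient ψ x i * φ x := fun x => by
    rw [fderiv_fun_mul (hψ.differentiable (by simp) x) (hφ.1.differentiable (by simp) x),
      gradient_apply]
    simp [mul_comm]
  have i1 : Integrable (fun x => fn v x * (gradient ψ x i * φ x)) (volume.restrict Ω) := by
    have h1 : IsTest Ω (fun x => gradient ψ x i * φ x) := by
      refine hφ.mul_smooth ?_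
      simp_rw [gradient_apply]
      exact (hψ.fderiv_right (m := ∞) (by simp)).clm_apply contDiff_const
    exact h1.integrable_mul _
  have i2 := hφψ.integrable_left (fn v) (EuclideanSpace.single i 1)
  have i3 := hφψ.integrable_coord (grad Ω v) i
  have h1 : ∫ x in Ω, ψ x • fn v x * fderiv ℝ φ x (EuclideanSpace.single i 1) =
      ∫ x in Ω, (fn v x * fderiv ℝ (fun x => ψ x * φ x) x (EuclideanSpace.single i 1) -
        fn v x * (gradient ψ x i * φ x)) := by
    congr 1
    funext x
    rw [hd, smul_eq_mul]
    ring
  have h2 : ∫ x in Ω, (ψ x • grad Ω v x + fn v x • gradient ψ x) i * φ x =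
      ∫ x in Ω, (grad Ω v x i * (ψ x * φ x) + fn v x * (gradient ψ x i * φ x)) := by
    congr 1
    funext x
    simp only [PiLp.add_apply, PiLp.smul_apply, smul_eq_mul]
    ring
  rw [h1, h2, integral_sub i2 i1, integral_add i3 i1, e]
  ring

/-- Multiplication of an element of `H¹(Ω)`, `Ω` bounded, with a smooth function. -/
def mulH1 (hΩ : IsOpen Ω) (hb : Bornology.IsBounded Ω) {ψ : E d → ℝ} (hψ : ContDiff ℝ ∞ ψ)
    (v : H1 Ω) : H1 Ω :=
  mkH1 (memLp_smooth_smul hΩ hb hψ.continuous _) (memLp_product_grad hΩ hb hψ v)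
    (weakGrad_product hψ v)

section

variable (hΩ : IsOpen Ω) (hb : Bornology.IsBounded Ω) {ψ : E d → ℝ} (hψ : ContDiff ℝ ∞ ψ)

theorem fn_mulH1 (v : H1 Ω) :
    fn (mulH1 hΩ hb hψ v) =ᵐ[volume.restrict Ω] fun x => ψ x * fn v x := fn_mkH1 _ _ _

theorem grad_mulH1 (v : H1 Ω) : grad Ω (mulH1 hΩ hb hψ v) =ᵐ[volume.restrict Ω]
    fun x => ψ x • grad Ω v x + fn v x • gradient ψ x := grad_mkH1 _ _ _

theorem norm_mulH1_le {A B : ℝ} (hA : ∀ x ∈ Ω, |ψ x| ≤ A) (hB : ∀ x ∈ Ω, ‖gradient ψ x‖ ≤ B)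
    (hB0 : 0 ≤ B) (v : H1 Ω) : ‖mulH1 hΩ hb hψ v‖ ≤ (2 * A + B) * ‖v‖ := by
  -- If `Ω` is empty, `hA` says nothing about the sign of `A`; both norms then vanish.
  rcases Ω.eq_empty_or_nonempty with rfl | ⟨x₀, hx₀⟩
  · have h1 : ∀ v : H1 (∅ : Set (E d)), ‖v‖ = 0 := fun v => by
      have := norm_sq_H1 v
      have e1 : ‖fn v‖ = 0 := by
        rw [norm_eq_zero]; exact Lp.ext (by simp [Filter.EventuallyEq])
      have e2 : ‖grad _ v‖ = 0 := by
        rw [norm_eq_zero]; exact Lp.ext (by simp [Filter.EventuallyEq])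
      rw [e1, e2] at this
      simpa using this
    rw [h1, h1, mul_zero]
  have hA0 : 0 ≤ A := (abs_nonneg _).trans (hA x₀ hx₀)
  have e1 : ‖fn (mulH1 hΩ hb hψ v)‖ ≤ A * ‖fn v‖ := by
    refine Lp.norm_le_mul_norm_of_ae_le_mul ?_
    filter_upwards [fn_mulH1 hΩ hb hψ v, ae_restrict_mem hΩ.measurableSet] with x h1 h2
    rw [h1, norm_mul]
    exact mul_le_mul_of_nonneg_right (hA x h2) (norm_nonneg _)
  have e2 : ‖grad Ω (mulH1 hΩ hb hψ v)‖ ≤ A * ‖grad Ω v‖ + B * ‖fn v‖ := by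
    let p := (memLp_smooth_smul hΩ hb hψ.continuous (grad Ω v)).toLp _
    let q := (memLp_smul_smooth hΩ hb (continuous_gradient hψ) (fn v)).toLp _
    have hpq : grad Ω (mulH1 hΩ hb hψ v) = p + q := MemLp.toLp_add _ _
    rw [hpq]
    refine (norm_add_le _ _).trans (add_le_add ?_ ?_)
    · refine Lp.norm_le_mul_norm_of_ae_le_mul ?_
      filter_upwards [(memLp_smooth_smul hΩ hb hψ.continuous (grad Ω v)).coeFn_toLp,
        ae_restrict_mem hΩ.measurableSet] with x h1 h2
      rw [h1, norm_smul]
      exact mul_le_mul_of_nonneg_right (hA x h2) (norm_nonneg _)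
    · refine Lp.norm_le_mul_norm_of_ae_le_mul ?_
      filter_upwards [(memLp_smul_smooth hΩ hb (continuous_gradient hψ) (fn v)).coeFn_toLp,
        ae_restrict_mem hΩ.measurableSet] with x h1 h2
      rw [h1, norm_smul, mul_comm]
      exact mul_le_mul_of_nonneg_right (hB x h2) (norm_nonneg _)
  have e3 : ‖mulH1 hΩ hb hψ v‖ ≤ ‖fn (mulH1 hΩ hb hψ v)‖ + ‖grad Ω (mulH1 hΩ hb hψ v)‖ := by
    have := norm_sq_H1 (mulH1 hΩ hb hψ v)
    refine abs_le_of_sq_le_sq' ?_ (by positivity) |>.2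
    nlinarith [norm_nonneg (fn (mulH1 hΩ hb hψ v)), norm_nonneg (grad Ω (mulH1 hΩ hb hψ v))]
  have e4 := norm_fn_le v
  have e5 := norm_grad_le v
  nlinarith [mul_le_mul_of_nonneg_left e4 hA0, mul_le_mul_of_nonneg_left e5 hA0,
    mul_le_mul_of_nonneg_left e4 hB0]

/-- `mulH1` as a bounded operator. -/
def mulH1L : H1 Ω →L[ℝ] H1 Ω :=
  LinearMap.mkContinuousOfExistsBound
    { toFun := mulH1 hΩ hb hψ
      map_add' := fun v w => fn_injective hΩ (Lp.ext (by
        rw [fn_add]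
        filter_upwards [fn_mulH1 hΩ hb hψ v, fn_mulH1 hΩ hb hψ w, fn_mulH1 hΩ hb hψ (v + w),
          Lp.coeFn_add (fn v) (fn w),
          Lp.coeFn_add (fn (mulH1 hΩ hb hψ v)) (fn (mulH1 hΩ hb hψ w))] with x h1 h2 h3 h4 h5
        rw [h3, h5, fn_add, h4, Pi.add_apply, Pi.add_apply, h1, h2, mul_add]))
      map_smul' := fun c v => fn_injective hΩ (Lp.ext (by
        rw [fn_smul]
        filter_upwards [fn_mulH1 hΩ hb hψ v, fn_mulH1 hΩ hb hψ (c • v),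
          Lp.coeFn_smul c (fn v), Lp.coeFn_smul c (fn (mulH1 hΩ hb hψ v))] with x h1 h3 h4 h5
        rw [h3, RingHom.id_apply, h5, fn_smul, h4, Pi.smul_apply, Pi.smul_apply, h1, smul_eq_mul,
          smul_eq_mul]
        ring)) }
    (by
      obtain ⟨A, hA⟩ := exists_bound_on hb hψ.continuous
      obtain ⟨B, hB⟩ := exists_bound_on hb (continuous_gradient hψ)
      exact ⟨2 * A + max B 0, fun v => norm_mulH1_le hΩ hb hψ
        (fun x hx => hA x (subset_closure hx))
        (fun x hx => (hB x (subset_closure hx)).trans (le_max_left _ _)) (le_max_right _ _) v⟩)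

end

end Insulation

namespace Insulation

variable {d : ℕ} {Ω : Set (E d)}

/-! ### Lipschitz graphs -/

section Graph

variable {e : E d}

theorem inner_self_unit (he : ‖e‖ = 1) : ⟪e, e⟫_ℝ = 1 := by
  rw [real_inner_self_eq_norm_sq, he, one_pow]

/-- The part of `y` orthogonal to the unit vector `e`. -/
def perp (e y : E d) : E d := y - ⟪e, y⟫_ℝ • e

theorem perp_add (y z : E d) : perp e (y + z) = perp e y + perp e z := by
  simp only [perp, inner_add_right, add_smul]
  abel

theorem perp_smul_self (he : ‖e‖ = 1) (s : ℝ) : perp e (s • e) = 0 := by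
  simp [perp, inner_smul_right, he]

theorem perp_add_smul_self (he : ‖e‖ = 1) (y : E d) (s : ℝ) : perp e (y + s • e) = perp e y := by
  rw [perp_add, perp_smul_self he, add_zero]

theorem inner_add_smul_self (he : ‖e‖ = 1) (y : E d) (s : ℝ) :
    ⟪e, y + s • e⟫_ℝ = ⟪e, y⟫_ℝ + s := by
  rw [inner_add_right, inner_smul_right, inner_self_unit he, mul_one]

theorem norm_perp_le (he : ‖e‖ = 1) (y : E d) : ‖perp e y‖ ≤ ‖y‖ := by
  have h : ‖perp e y‖ ^ 2 = ‖y‖ ^ 2 - ⟪e, y⟫_ℝ ^ 2 := by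
    rw [perp, norm_sub_sq_real, inner_smul_right, norm_smul, he, real_inner_comm e y]
    rw [mul_one, Real.norm_eq_abs, sq_abs]
    ring
  nlinarith [norm_nonneg y, norm_nonneg (perp e y), sq_nonneg ⟪e, y⟫_ℝ]

theorem continuous_perp : Continuous (perp e) := by
  unfold perp
  fun_prop

theorem perp_coe_orthogonal (y : (ℝ ∙ e)ᗮ) : perp e (y : E d) = y := by
  have : ⟪e, (y : E d)⟫_ℝ = 0 := Submodule.mem_orthogonal_singleton_iff_inner_right.1 y.2
  simp [perp, this]

theorem inner_coe_orthogonal (y : (ℝ ∙ e)ᗮ) : ⟪e, (y : E d)⟫_ℝ = 0 :=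
  Submodule.mem_orthogonal_singleton_iff_inner_right.1 y.2

theorem perp_mem_orthogonal (he : ‖e‖ = 1) (y : E d) : perp e y ∈ (ℝ ∙ e)ᗮ := by
  rw [Submodule.mem_orthogonal_singleton_iff_inner_right, perp, inner_sub_right, inner_smul_right,
    inner_self_unit he, mul_one, sub_self]

theorem finrank_orthogonal_unit (he : ‖e‖ = 1) : Module.finrank ℝ (ℝ ∙ e)ᗮ = d - 1 := by
  have h1 := (ℝ ∙ e).finrank_add_finrank_orthogonal
  rw [finrank_span_singleton (by rintro rfl; simp at he), finrank_euclideanSpace_fin] at h1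
  omega

/-- Fubini's theorem along the direction `e`. -/
theorem lintegral_eq_lintegral_orthogonal (he : ‖e‖ = 1) {f : E d → ℝ≥0∞} (hf : Measurable f) :
    ∫⁻ x, f x = ∫⁻ y : (ℝ ∙ e)ᗮ, ∫⁻ s : ℝ, f (y + s • e) := by
  have hmp := (ℝ ∙ e).measurePreserving_measurableEquivProd (0 : E d)
  rw [InnerProductSpace.euclideanHausdorffMeasure_eq_volume] at hmp
  have h1 := (MeasurePreserving.symm ((ℝ ∙ e).measurableEquivProd (0 : E d)) hmp).lintegral_comp hf
  rw [← h1, Measure.volume_eq_prod, lintegral_prod_symm _ (by fun_prop)]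
  refine lintegral_congr fun y => ?_
  have h2 := (LinearIsometryEquiv.toSpanUnitSingleton e he).measurePreserving
  have hm : Measurable fun x : (ℝ ∙ e) => f ((x : E d) + y) := by fun_prop
  have h3 := h2.lintegral_comp hm
  simp only [Submodule.measurableEquivProd_symm_apply, vadd_eq_add, add_zero]
  rw [← h3]
  simp [add_comm]

/-- The graph of `h` over the hyperplane orthogonal to `e`. -/
def graphSet (e : E d) (h : E d → ℝ) : Set (E d) := {y | h (perp e y) = ⟪e, y⟫_ℝ}

/-- The parametrization of the graph of `h` over the hyperplane orthogonal to `e`. -/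
def graphMap (e : E d) (h : E d → ℝ) (y : (ℝ ∙ e)ᗮ) : E d := y + h y • e

variable {h : E d → ℝ} {K : NNReal}

theorem perp_graphMap (he : ‖e‖ = 1) (y : (ℝ ∙ e)ᗮ) : perp e (graphMap e h y) = y := by
  rw [graphMap, perp_add_smul_self he, perp_coe_orthogonal]

theorem graphMap_mem (he : ‖e‖ = 1) (y : (ℝ ∙ e)ᗮ) : graphMap e h y ∈ graphSet e h := by
  change h (perp e (graphMap e h y)) = _
  rw [perp_graphMap he, graphMap, inner_add_smul_self he, inner_coe_orthogonal, zero_add]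

theorem graphMap_perp (he : ‖e‖ = 1) {y : E d} (hy : y ∈ graphSet e h) :
    graphMap e h ⟨perp e y, perp_mem_orthogonal he y⟩ = y := by
  have : h (perp e y) = ⟪e, y⟫_ℝ := hy
  simp only [graphMap, this]
  simp [perp]

theorem lipschitz_graphMap (he : ‖e‖ = 1) (hh : LipschitzWith K h) :
    LipschitzWith (1 + K) (graphMap e h) := by
  refine LipschitzWith.of_dist_le_mul fun y z => ?_
  have h1 := hh.dist_le_mul (y : E d) z
  rw [dist_eq_norm, dist_eq_norm] at *
  have h2 : graphMap e h y - graphMap e h z = ((y - z : (ℝ ∙ e)ᗮ) : E d) + (h y - h z) • e := by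
    simp only [graphMap, Submodule.coe_sub, sub_smul]
    abel
  have h3 : ‖(y : E d) - z‖ = ‖y - z‖ := rfl
  rw [h2]
  refine (norm_add_le _ _).trans ?_
  rw [norm_smul, he, mul_one]
  push_cast
  rw [h3] at h1
  rw [h3]
  linarith

/-- A map with Lipschitz constant L enlarges the (d-1)-dimensional Hausdorff measure at most by the
factor L^(d-1), and on the hyperplane the normalized Hausdorff measure is Lebesgue measure. -/
theorem surf_image_graphMap_le (he : ‖e‖ = 1) (hh : LipschitzWith K h) (s : Set (ℝ ∙ e)ᗮ) :
    surf d (graphMap e h '' s) ≤ (1 + K : NNReal) ^ (d - 1) * volume s := by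
  have h1 := ((lipschitz_graphMap he hh).lipschitzOnWith (s := s)).hausdorffMeasure_image_le
    (d := ((d - 1 : ℕ) : ℝ)) (by positivity)
  rw [← InnerProductSpace.euclideanHausdorffMeasure_eq_volume (V := (ℝ ∙ e)ᗮ),
    finrank_orthogonal_unit he]
  rw [surf, Measure.euclideanHausdorffMeasure_def, Measure.euclideanHausdorffMeasure_def]
  simp only [Measure.smul_apply, ENNReal.smul_def, smul_eq_mul]
  rw [mul_left_comm]
  gcongr
  rw [← ENNReal.rpow_natCast]
  exact_mod_cast h1

/-- The orthogonal projection is 1-Lipschitz. This bounds surface measure from below, as needed for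
the positivity of the measure of boundary parts. -/
theorem volume_image_perp_le (he : ‖e‖ = 1) (s : Set (E d)) :
    volume ((fun y => (⟨perp e y, perp_mem_orthogonal he y⟩ : (ℝ ∙ e)ᗮ)) '' s) ≤ surf d s := by
  have hl : LipschitzWith 1 (fun y => (⟨perp e y, perp_mem_orthogonal he y⟩ : (ℝ ∙ e)ᗮ)) := by
    refine LipschitzWith.of_dist_le_mul fun y z => ?_
    rw [NNReal.coe_one, one_mul, dist_eq_norm y z, Subtype.dist_eq, dist_eq_norm]
    have : perp e y - perp e z = perp e (y - z) := by
      rw [sub_eq_iff_eq_add, ← perp_add, sub_add_cancel]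
    simp only [this]
    exact norm_perp_le he _
  have h1 := (hl.lipschitzOnWith (s := s)).hausdorffMeasure_image_le
    (d := ((d - 1 : ℕ) : ℝ)) (by positivity)
  rw [← InnerProductSpace.euclideanHausdorffMeasure_eq_volume (V := (ℝ ∙ e)ᗮ),
    finrank_orthogonal_unit he]
  rw [surf, Measure.euclideanHausdorffMeasure_def, Measure.euclideanHausdorffMeasure_def]
  simp only [Measure.smul_apply, ENNReal.smul_def, smul_eq_mul]
  gcongr
  simpa using h1

theorem surf_restrict_graphSet_le (he : ‖e‖ = 1) (hh : LipschitzWith K h) :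
    (surf d).restrict (graphSet e h) ≤
      (((1 + K : NNReal) ^ (d - 1) : NNReal) : ℝ≥0∞) • Measure.map (graphMap e h) volume := by
  refine Measure.le_iff.2 fun s hs => ?_
  rw [Measure.restrict_apply hs, Measure.smul_apply,
    Measure.map_apply (lipschitz_graphMap he hh).continuous.measurable hs, smul_eq_mul]
  refine le_trans (measure_mono ?_)
    ((surf_image_graphMap_le he hh (graphMap e h ⁻¹' s)).trans_eq (by push_cast; rfl))
  rintro y ⟨hy1, hy2⟩
  exact ⟨⟨perp e y, perp_mem_orthogonal he y⟩, by
    rw [mem_preimage, graphMap_perp he hy2]; exact hy1, graphMap_perp he hy2⟩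

/-- Integrating over the translates of a Lipschitz graph in the direction `e` is controlled by
integration over the whole space. -/
theorem lintegral_graph_translates_le (he : ‖e‖ = 1) (hh : LipschitzWith K h) {f : E d → ℝ≥0∞}
    (hf : Measurable f) :
    ∫⁻ p in graphSet e h, (∫⁻ s : ℝ, f (p + s • e)) ∂(surf d) ≤
      (((1 + K : NNReal) ^ (d - 1) : NNReal) : ℝ≥0∞) * ∫⁻ x, f x := by
  refine (lintegral_mono' (surf_restrict_graphSet_le he hh) le_rfl).trans ?_
  rw [lintegral_smul_measure, smul_eq_mul,
    lintegral_map _ (lipschitz_graphMap he hh).continuous.measurable]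
  · rw [lintegral_eq_lintegral_orthogonal he hf]
    refine mul_le_mul_right (lintegral_mono fun y => ?_) _
    simp only [graphMap, add_assoc, ← add_smul]
    -- The height `h y` of the graph only translates the parameter of the line, and Lebesgue measure
    -- does not notice this.
    exact (lintegral_add_left_eq_self (μ := volume) (fun s : ℝ => f (y + s • e)) (h y)).le
  · exact Measurable.lintegral_prod_right' (f := fun q : E d × ℝ => f (q.1 + q.2 • e)) (by fun_prop)

end Graph

/-! ### Charts of Lipschitz domains -/

/-- In the ball of radius `r` about `x`, the set `Ω` is the strict epigraph in direction `e` of the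
Lipschitz function `h`. -/
structure IsChart (Ω : Set (E d)) (x e : E d) (K : NNReal) (h : E d → ℝ) (r : ℝ) : Prop where
  unit : ‖e‖ = 1
  lip : LipschitzWith K h
  pos : 0 < r
  mem_iff : ∀ y ∈ Metric.ball x r, y ∈ Ω ↔ h (perp e y) < ⟪e, y⟫_ℝ

theorem HasLipschitzBoundary.exists_chart (hΩ : HasLipschitzBoundary Ω) {x : E d}
    (hx : x ∈ frontier Ω) : ∃ e K h r, IsChart Ω x e K h r := by
  obtain ⟨e, he, K, h, hh, r, hr, H⟩ := hΩ x hx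
  exact ⟨e, K, h, r, he, hh, hr, H⟩

namespace IsChart

variable {x e : E d} {K : NNReal} {h : E d → ℝ} {r : ℝ}

theorem le_of_mem_closure (hc : IsChart Ω x e K h r) {y : E d} (hy : y ∈ Metric.ball x r)
    (hyc : y ∈ closure Ω) : h (perp e y) ≤ ⟪e, y⟫_ℝ := by
  by_contra! hlt
  have ho : IsOpen ({z | ⟪e, z⟫_ℝ < h (perp e z)} ∩ Metric.ball x r) :=
    (isOpen_lt (by fun_prop) (hc.lip.continuous.comp continuous_perp)).inter Metric.isOpen_ball
  obtain ⟨z, ⟨hz1, hz2⟩, hz3⟩ := mem_closure_iff.1 hyc _ ho ⟨hlt, hy⟩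
  exact lt_asymm hz1 ((hc.mem_iff z hz2).1 hz3)

theorem mem_graphSet (hc : IsChart Ω x e K h r) (hΩ : IsOpen Ω) {y : E d}
    (hy : y ∈ Metric.ball x r) (hyf : y ∈ frontier Ω) : y ∈ graphSet e h := by
  rw [hΩ.frontier_eq] at hyf
  refine le_antisymm (hc.le_of_mem_closure hy hyf.1) ?_
  by_contra! hlt
  exact hyf.2 ((hc.mem_iff y hy).2 hlt)

/-- The displacement `q` lies in the open cone about `e` in which the vertical gain exceeds the
largest possible rise of a `K`-Lipschitz graph. -/
theorem add_mem (hc : IsChart Ω x e K h r) {y q : E d} (hy : y ∈ Metric.ball x r)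
    (hyc : y ∈ closure Ω) (hyq : y + q ∈ Metric.ball x r) (hq : K * ‖perp e q‖ < ⟪e, q⟫_ℝ) :
    y + q ∈ Ω := by
  rw [hc.mem_iff _ hyq, perp_add, inner_add_right]
  have h1 := hc.lip.dist_le_mul (perp e y + perp e q) (perp e y)
  rw [Real.dist_eq, dist_eq_norm, add_sub_cancel_left] at h1
  have h2 := hc.le_of_mem_closure hy hyc
  have h3 := le_abs_self (h (perp e y + perp e q) - h (perp e y))
  linarith

theorem add_smul_mem (hc : IsChart Ω x e K h r) {y : E d} {s : ℝ} (hs : 0 < s)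
    (hy : y ∈ Metric.ball x r) (hyc : y ∈ closure Ω) (hyq : y + s • e ∈ Metric.ball x r) :
    y + s • e ∈ Ω := by
  refine hc.add_mem hy hyc hyq ?_
  rw [perp_smul_self hc.unit, inner_smul_right, inner_self_unit hc.unit]
  simpa using hs

theorem mem_frontier (hc : IsChart Ω x e K h r) (hΩ : IsOpen Ω) {y : E d}
    (hy : y ∈ Metric.ball x r) (hyg : y ∈ graphSet e h) : y ∈ frontier Ω := by
  have hyg' : h (perp e y) = ⟪e, y⟫_ℝ := hyg
  rw [hΩ.frontier_eq]
  refine ⟨?_, fun hyΩ => ((hc.mem_iff y hy).1 hyΩ).ne hyg'⟩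
  have ht : Tendsto (fun s : ℝ => y + s • e) (𝓝[>] 0) (𝓝 y) := by
    have : Tendsto (fun s : ℝ => y + s • e) (𝓝 0) (𝓝 (y + (0 : ℝ) • e)) :=
      (continuous_const.add (continuous_id.smul continuous_const)).tendsto 0
    rw [zero_smul, add_zero] at this
    exact this.mono_left nhdsWithin_le_nhds
  refine mem_closure_of_tendsto ht ?_
  filter_upwards [self_mem_nhdsWithin, ht (Metric.isOpen_ball.mem_nhds hy)] with s hs hsb
  rw [hc.mem_iff _ hsb, perp_add_smul_self hc.unit, inner_add_smul_self hc.unit, hyg']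
  exact lt_add_of_pos_right _ hs

theorem mem_ball_add_smul (hc : IsChart Ω x e K h r) {y : E d} {s ρ : ℝ} (hs : 0 ≤ s)
    (hy : y ∈ Metric.ball x ρ) (hρ : ρ + s ≤ r) : y + s • e ∈ Metric.ball x r := by
  rw [mem_ball_iff_norm] at hy ⊢
  have h1 : y + s • e - x = (y - x) + s • e := by abel
  rw [h1]
  refine (norm_add_le _ _).trans_lt ?_
  rw [norm_smul, hc.unit, mul_one, Real.norm_of_nonneg hs]
  linarith

end IsChart

/-- A boundary point leaves the closure when it is moved in direction `-e` of a chart, so it cannot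
be interior to the closure. This identifies `Ω` as the interior of the triangulated set. -/
theorem interior_closure_eq (hΩ : IsOpen Ω) (hl : HasLipschitzBoundary Ω) :
    interior (closure Ω) = Ω := by
  refine subset_antisymm (fun x hx => ?_) (interior_maximal subset_closure hΩ)
  by_contra hxΩ
  have hxf : x ∈ frontier Ω := by
    rw [hΩ.frontier_eq]
    exact ⟨interior_subset hx, hxΩ⟩
  obtain ⟨e, K, h, r, hc⟩ := hl.exists_chart hxf
  have hg : h (perp e x) = ⟪e, x⟫_ℝ := hc.mem_graphSet hΩ (Metric.mem_ball_self hc.pos) hxf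
  have ht : Tendsto (fun s : ℝ => x + (-s) • e) (𝓝[>] 0) (𝓝 x) := by
    have : Tendsto (fun s : ℝ => x + (-s) • e) (𝓝 0) (𝓝 (x + (-0 : ℝ) • e)) :=
      (continuous_const.add (continuous_neg.smul continuous_const)).tendsto 0
    rw [neg_zero, zero_smul, add_zero] at this
    exact this.mono_left nhdsWithin_le_nhds
  have hev : ∀ᶠ s : ℝ in 𝓝[>] 0, 0 < s ∧ x + (-s) • e ∈ interior (closure Ω) ∧
      x + (-s) • e ∈ Metric.ball x r :=
    (eventually_mem_nhdsWithin).and ((ht.eventually (isOpen_interior.mem_nhds hx)).and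
      (ht.eventually (Metric.isOpen_ball.mem_nhds (Metric.mem_ball_self hc.pos))))
  obtain ⟨s, hs, h1, h2⟩ := hev.exists
  have h3 := hc.le_of_mem_closure h2 (interior_subset h1)
  rw [perp_add_smul_self hc.unit, inner_add_smul_self hc.unit, hg] at h3
  linarith

/-! ### One-dimensional estimates -/

/-- The Cauchy-Schwarz inequality against the constant 1. -/
theorem lintegral_sq_le {X : Type*} [MeasurableSpace X] {μ : Measure X} {f : X → ℝ≥0∞}
    (hf : AEMeasurable f μ) : (∫⁻ x, f x ∂μ) ^ 2 ≤ μ univ * ∫⁻ x, f x ^ 2 ∂μ := by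
  have h := ENNReal.lintegral_mul_le_Lp_mul_Lq μ Real.HolderConjugate.two_two
    (aemeasurable_const (b := (1 : ℝ≥0∞))) hf
  simp only [Pi.mul_apply, one_mul, ENNReal.rpow_ofNat, one_pow, lintegral_one] at h
  calc (∫⁻ x, f x ∂μ) ^ 2
      ≤ (μ univ ^ (1 / 2 : ℝ) * (∫⁻ x, f x ^ 2 ∂μ) ^ (1 / 2 : ℝ)) ^ 2 := by gcongr
    _ = μ univ * ∫⁻ x, f x ^ 2 ∂μ := by
      rw [mul_pow, ← ENNReal.rpow_natCast, ← ENNReal.rpow_natCast, ← ENNReal.rpow_mul,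
        ← ENNReal.rpow_mul]
      norm_num

theorem enorm_add_sq_le {F : Type*} [NormedAddCommGroup F] (a b : F) :
    ‖a + b‖ₑ ^ 2 ≤ 2 * ‖a‖ₑ ^ 2 + 2 * ‖b‖ₑ ^ 2 := by
  have h : ‖a + b‖ ^ 2 ≤ 2 * ‖a‖ ^ 2 + 2 * ‖b‖ ^ 2 := by
    have h1 := norm_add_le a b
    nlinarith [sq_nonneg (‖a‖ - ‖b‖), norm_nonneg (a + b), norm_nonneg a, norm_nonneg b]
  simp only [enorm_eq_nnnorm]
  exact_mod_cast h

/-- The fundamental theorem of calculus along the segment and Cauchy-Schwarz on an interval of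
length `δ`. The right-hand side does not depend on `s`, so the estimate can be averaged over `s`. -/
theorem enorm_sub_sq_le_lintegral_gradient {φ : E d → ℝ} (hφ : ContDiff ℝ ∞ φ) (p w : E d)
    {s δ : ℝ} (hs : 0 ≤ s) (hsδ : s ≤ δ) :
    ‖φ (p + s • w) - φ p‖ₑ ^ 2 ≤
      ENNReal.ofReal δ * ‖w‖ₑ ^ 2 * ∫⁻ τ in Ioc 0 δ, ‖gradient φ (p + τ • w)‖ₑ ^ 2 := by
  have hd : ∀ τ : ℝ, HasDerivAt (fun τ : ℝ => φ (p + τ • w)) (fderiv ℝ φ (p + τ • w) w) τ := by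
    intro τ
    have h1 : HasDerivAt (fun τ : ℝ => p + τ • w) w τ := by
      simpa using ((hasDerivAt_id τ).smul_const w).const_add p
    exact (hφ.differentiable (by simp) _).hasFDerivAt.comp_hasDerivAt τ h1
  have hcont : Continuous fun τ : ℝ => fderiv ℝ φ (p + τ • w) w :=
    ((hφ.continuous_fderiv (by simp)).comp (by fun_prop)).clm_apply continuous_const
  have hinteg : ∫ τ in (0 : ℝ)..s, fderiv ℝ φ (p + τ • w) w = φ (p + s • w) - φ p := by
    rw [intervalIntegral.integral_eq_sub_of_hasDerivAt (fun τ _ => hd τ)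
      (hcont.intervalIntegrable _ _)]
    simp
  have hgc : Continuous fun τ : ℝ => gradient φ (p + τ • w) :=
    (continuous_gradient hφ).comp (by fun_prop)
  have h1 : ‖φ (p + s • w) - φ p‖ₑ ≤ ∫⁻ τ in Ioc 0 δ, ‖w‖ₑ * ‖gradient φ (p + τ • w)‖ₑ := by
    rw [← hinteg, intervalIntegral.integral_of_le hs]
    refine (enorm_integral_le_lintegral_enorm _).trans ?_
    refine (lintegral_mono_set (Ioc_subset_Ioc_right hsδ)).trans ?_
    refine lintegral_mono fun τ => ?_
    have : ‖fderiv ℝ φ (p + τ • w) w‖ ≤ ‖w‖ * ‖gradient φ (p + τ • w)‖ := by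
      rw [norm_gradient, mul_comm]
      exact ContinuousLinearMap.le_opNorm _ _
    simp only [enorm_eq_nnnorm]
    exact_mod_cast this
  rw [lintegral_const_mul _ hgc.enorm.measurable] at h1
  calc ‖φ (p + s • w) - φ p‖ₑ ^ 2
      ≤ (‖w‖ₑ * ∫⁻ τ in Ioc 0 δ, ‖gradient φ (p + τ • w)‖ₑ) ^ 2 := by gcongr
    _ ≤ ‖w‖ₑ ^ 2 * (ENNReal.ofReal δ * ∫⁻ τ in Ioc 0 δ, ‖gradient φ (p + τ • w)‖ₑ ^ 2) := by
      rw [mul_pow]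
      gcongr
      refine (lintegral_sq_le hgc.enorm.aemeasurable).trans_eq ?_
      simp
    _ = _ := by ring

/-! ### The trace inequality for smooth functions -/

/-- The square of the `H¹(Ω)`-norm of a smooth function. -/
def energy (Ω : Set (E d)) (φ : E d → ℝ) : ℝ≥0∞ :=
  (∫⁻ x in Ω, ‖φ x‖ₑ ^ 2) + ∫⁻ x in Ω, ‖gradient φ x‖ₑ ^ 2

/-- Ball radius and segment length are both `r / 2`, so `p + s • e` does not leave the chart and
lies in `Ω` for `s > 0`; the bound for graphs then applies to `f` cut off outside of `Ω`. -/
theorem IsChart.lintegral_frontier_translates_le {x e : E d} {K : NNReal} {h : E d → ℝ} {r : ℝ}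
    (hc : IsChart Ω x e K h r) (hΩ : IsOpen Ω) {f : E d → ℝ≥0∞} (hf : Measurable f) :
    ∫⁻ p in frontier Ω ∩ Metric.ball x (r / 2),
      (∫⁻ s in Ioc 0 (r / 2), f (p + s • e)) ∂(surf d) ≤
      (((1 + K : NNReal) ^ (d - 1) : NNReal) : ℝ≥0∞) * ∫⁻ x in Ω, f x := by
  have hr := hc.pos
  have hsub : frontier Ω ∩ Metric.ball x (r / 2) ⊆ graphSet e h := fun p hp =>
    hc.mem_graphSet hΩ (Metric.ball_subset_ball (by linarith) hp.2) hp.1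
  have hms : MeasurableSet (frontier Ω ∩ Metric.ball x (r / 2)) :=
    isClosed_frontier.measurableSet.inter Metric.isOpen_ball.measurableSet
  have h1 := lintegral_graph_translates_le hc.unit hc.lip (hf.indicator hΩ.measurableSet)
  rw [lintegral_indicator hΩ.measurableSet] at h1
  refine le_trans ?_ h1
  refine le_trans ?_ (lintegral_mono_set hsub)
  refine setLIntegral_mono_ae' hms (Eventually.of_forall fun p hp => ?_)
  refine le_trans ?_ (setLIntegral_le_lintegral (Ioc 0 (r / 2)) _)
  refine setLIntegral_mono_ae' measurableSet_Ioc (Eventually.of_forall fun s hs => ?_)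
  have hb := hc.mem_ball_add_smul hs.1.le hp.2 (by linarith [hs.2])
  have : p + s • e ∈ Ω := hc.add_smul_mem hs.1 (Metric.ball_subset_ball (by linarith) hp.2)
    (frontier_subset_closure hp.1) hb
  rw [indicator_of_mem this]

/-- Write φ(p) as φ(p + s e) minus the increment along the segment and average over s in (0, δ].
Integrating over the boundary piece turns the two resulting line integrals into volume integrals
over `Ω`. -/
theorem IsChart.lintegral_frontier_sq_le {x e : E d} {K : NNReal} {h : E d → ℝ} {r : ℝ}
    (hc : IsChart Ω x e K h r) (hΩ : IsOpen Ω) : ∃ C : NNReal, ∀ φ : E d → ℝ, ContDiff ℝ ∞ φ →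
    ∫⁻ p in frontier Ω ∩ Metric.ball x (r / 2), ‖φ p‖ₑ ^ 2 ∂(surf d) ≤ C * energy Ω φ := by
  have hr := hc.pos
  set δ : ℝ := r / 2 with hδ
  set D : ℝ≥0∞ := ENNReal.ofReal δ with hD
  have hD0 : D ≠ 0 := by simp [hD, hδ, hr]
  have hDt : D ≠ ⊤ := ENNReal.ofReal_ne_top
  set M : ℝ≥0∞ := (((1 + K : NNReal) ^ (d - 1) : NNReal) : ℝ≥0∞)
  refine ⟨(D⁻¹ * ((2 + 2 * D ^ 2) * M)).toNNReal, fun φ hφ => ?_⟩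
  rw [ENNReal.coe_toNNReal (by
    refine ENNReal.mul_ne_top (by simpa using hD0) (ENNReal.mul_ne_top ?_ ENNReal.coe_ne_top)
    finiteness)]
  have hm1 : Measurable fun y => ‖φ y‖ₑ ^ 2 := (hφ.continuous.enorm.measurable).pow_const 2
  have hm2 : Measurable fun y => ‖gradient φ y‖ₑ ^ 2 :=
    ((continuous_gradient hφ).enorm.measurable).pow_const 2
  have hpt : ∀ p, D * ‖φ p‖ₑ ^ 2 ≤ 2 * (∫⁻ s in Ioc 0 δ, ‖φ (p + s • e)‖ₑ ^ 2) +
      2 * D ^ 2 * ∫⁻ s in Ioc 0 δ, ‖gradient φ (p + s • e)‖ₑ ^ 2 := by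
    intro p
    have hms : Measurable fun s : ℝ => ‖φ (p + s • e)‖ₑ ^ 2 :=
      hm1.comp (by fun_prop : Measurable fun s : ℝ => p + s • e)
    have e1 : D * ‖φ p‖ₑ ^ 2 = ∫⁻ s in Ioc 0 δ, ‖φ p‖ₑ ^ 2 := by
      rw [setLIntegral_const, Real.volume_Ioc, sub_zero, mul_comm]
    rw [e1]
    calc ∫⁻ s in Ioc 0 δ, ‖φ p‖ₑ ^ 2
        ≤ ∫⁻ s in Ioc 0 δ, (2 * ‖φ (p + s • e)‖ₑ ^ 2 +
          2 * (D * ∫⁻ τ in Ioc 0 δ, ‖gradient φ (p + τ • e)‖ₑ ^ 2)) := by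
          refine setLIntegral_mono_ae' measurableSet_Ioc (Eventually.of_forall fun s hs => ?_)
          have h1 := enorm_sub_sq_le_lintegral_gradient hφ p e hs.1.le hs.2
          have h2 := enorm_add_sq_le (φ (p + s • e)) (φ p - φ (p + s • e))
          rw [add_sub_cancel, enorm_sub_rev] at h2
          have h3 : ‖e‖ₑ = 1 := by rw [← ofReal_norm, hc.unit, ENNReal.ofReal_one]
          rw [h3, one_pow, mul_one] at h1
          exact h2.trans (by gcongr)
      _ = _ := by
          rw [lintegral_add_right _ measurable_const, lintegral_const_mul _ hms,
            setLIntegral_const, Real.volume_Ioc, sub_zero]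
          ring
  have hmeas : ∀ f : E d → ℝ≥0∞, Measurable f →
      Measurable fun p : E d => ∫⁻ s in Ioc 0 δ, f (p + s • e) := fun f hf =>
    Measurable.lintegral_prod_right' (f := fun q : E d × ℝ => f (q.1 + q.2 • e)) (by fun_prop)
  have hI : D * ∫⁻ p in frontier Ω ∩ Metric.ball x δ, ‖φ p‖ₑ ^ 2 ∂(surf d) ≤
      (2 + 2 * D ^ 2) * M * energy Ω φ := by
    rw [← lintegral_const_mul _ hm1]
    refine (lintegral_mono fun p => hpt p).trans ?_
    rw [lintegral_add_left ((hmeas _ hm1).const_mul _), lintegral_const_mul _ (hmeas _ hm1),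
      lintegral_const_mul _ (hmeas _ hm2)]
    calc _ ≤ 2 * (M * ∫⁻ x in Ω, ‖φ x‖ₑ ^ 2) +
        2 * D ^ 2 * (M * ∫⁻ x in Ω, ‖gradient φ x‖ₑ ^ 2) := by
          gcongr
          · exact hc.lintegral_frontier_translates_le hΩ hm1
          · exact hc.lintegral_frontier_translates_le hΩ hm2
      _ ≤ (2 + 2 * D ^ 2) * (M * ∫⁻ x in Ω, ‖φ x‖ₑ ^ 2) +
        (2 + 2 * D ^ 2) * (M * ∫⁻ x in Ω, ‖gradient φ x‖ₑ ^ 2) := by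
          gcongr
          · exact le_self_add
          · exact le_add_self
      _ = _ := by
          rw [energy]
          ring
  calc _ = D⁻¹ * (D * ∫⁻ p in frontier Ω ∩ Metric.ball x δ, ‖φ p‖ₑ ^ 2 ∂(surf d)) := by
        rw [← mul_assoc, ENNReal.inv_mul_cancel hD0 hDt, one_mul]
    _ ≤ D⁻¹ * ((2 + 2 * D ^ 2) * M * energy Ω φ) := by gcongr
    _ = _ := by ring

theorem exists_trace_inequality (hΩ : IsOpen Ω) (hb : Bornology.IsBounded Ω)
    (hl : HasLipschitzBoundary Ω) : ∃ C : NNReal, ∀ φ : E d → ℝ, ContDiff ℝ ∞ φ →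
    ∫⁻ p in frontier Ω, ‖φ p‖ₑ ^ 2 ∂(surf d) ≤ C * energy Ω φ := by
  have hcpt : IsCompact (frontier Ω) :=
    hb.isCompact_closure.of_isClosed_subset isClosed_frontier frontier_subset_closure
  refine hcpt.induction_on (p := fun S => ∃ C : NNReal, ∀ φ : E d → ℝ, ContDiff ℝ ∞ φ →
    ∫⁻ p in S, ‖φ p‖ₑ ^ 2 ∂(surf d) ≤ C * energy Ω φ) ⟨0, by simp⟩ ?_ ?_ ?_
  · rintro s t hst ⟨C, hC⟩
    exact ⟨C, fun φ hφ => (lintegral_mono_set hst).trans (hC φ hφ)⟩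
  · rintro s t ⟨C, hC⟩ ⟨C', hC'⟩
    refine ⟨C + C', fun φ hφ => (lintegral_union_le _ _ _).trans ?_⟩
    push_cast
    rw [add_mul]
    exact add_le_add (hC φ hφ) (hC' φ hφ)
  · intro x hx
    obtain ⟨e, K, h, r, hc⟩ := hl.exists_chart hx
    refine ⟨frontier Ω ∩ Metric.ball x (r / 2), inter_mem_nhdsWithin _
      (Metric.ball_mem_nhds x (half_pos hc.pos)), hc.lintegral_frontier_sq_le hΩ⟩

theorem surf_frontier_lt_top (hΩ : IsOpen Ω) (hb : Bornology.IsBounded Ω)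
    (hl : HasLipschitzBoundary Ω) : surf d (frontier Ω) < ⊤ := by
  have hcpt : IsCompact (frontier Ω) :=
    hb.isCompact_closure.of_isClosed_subset isClosed_frontier frontier_subset_closure
  refine hcpt.measure_lt_top_of_nhdsWithin fun x hx => ?_
  obtain ⟨e, K, h, r, hc⟩ := hl.exists_chart hx
  refine ⟨frontier Ω ∩ Metric.ball x r, inter_mem_nhdsWithin _
      (Metric.ball_mem_nhds x hc.pos), ?_⟩
  have hsub : frontier Ω ∩ Metric.ball x r ⊆
      graphMap e h '' Metric.ball 0 (‖x‖ + r) := by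
    rintro y ⟨hy1, hy2⟩
    refine ⟨⟨perp e y, perp_mem_orthogonal hc.unit y⟩, ?_,
      graphMap_perp hc.unit (hc.mem_graphSet hΩ hy2 hy1)⟩
    rw [mem_ball_zero_iff]
    refine (norm_perp_le hc.unit y).trans_lt ?_
    rw [mem_ball_iff_norm] at hy2
    linarith [norm_le_norm_add_norm_sub' y x]
  refine (measure_mono hsub).trans_lt ((surf_image_graphMap_le hc.unit hc.lip _).trans_lt ?_)
  exact ENNReal.mul_lt_top (by finiteness) measure_ball_lt_top

/-- Nonempty relatively open boundary parts have positive surface measure. -/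
theorem surf_frontier_inter_pos (hΩ : IsOpen Ω) (hl : HasLipschitzBoundary Ω) {x : E d}
    (hx : x ∈ frontier Ω) {U : Set (E d)} (hU : IsOpen U) (hxU : x ∈ U) :
    0 < surf d (frontier Ω ∩ U) := by
  obtain ⟨e, K, h, r, hc⟩ := hl.exists_chart hx
  have hg := graphMap_perp hc.unit (hc.mem_graphSet hΩ (Metric.mem_ball_self hc.pos) hx)
  have hopen : IsOpen (graphMap e h ⁻¹' (Metric.ball x r ∩ U)) :=
    (Metric.isOpen_ball.inter hU).preimage (lipschitz_graphMap hc.unit hc.lip).continuous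
  have hpos : 0 < volume (graphMap e h ⁻¹' (Metric.ball x r ∩ U)) := by
    refine hopen.measure_pos _ ⟨⟨perp e x, perp_mem_orthogonal hc.unit x⟩, ?_⟩
    rw [mem_preimage, hg]
    exact ⟨Metric.mem_ball_self hc.pos, hxU⟩
  refine hpos.trans_le (le_trans (measure_mono ?_) (volume_image_perp_le hc.unit _))
  intro y hy
  refine ⟨graphMap e h y, ⟨hc.mem_frontier hΩ hy.1 (graphMap_mem hc.unit y), hy.2⟩, ?_⟩
  exact Subtype.ext (perp_graphMap hc.unit y)

end Insulation

namespace Insulation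

variable {d : ℕ} {Ω : Set (E d)}

/-! ### Weak convergence of mollifications -/

/-- Translations act strongly continuously on L². -/
theorem continuous_integral_mul_translate {R A : E d → ℝ} (hR : MemLp R 2 volume)
    (hA : MemLp A 2 volume) : Continuous fun t : E d => ∫ x, R x * A (x - t) := by
  let g : E d → C(E d, E d) := fun t => ⟨fun x => x - t, by fun_prop⟩
  have hg : Continuous g :=
    (ContinuousMap.curry (⟨fun q : E d × E d => q.2 - q.1, by fun_prop⟩ : C(E d × E d, E d))).continuous
  have hgm : ∀ t, MeasurePreserving (g t) volume volume := fun t =>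
    measurePreserving_sub_right volume t
  have h1 := (continuous_const (y := hA.toLp A) (X := E d)).compMeasurePreservingLp hg hgm (by simp)
  have h2 : Continuous fun t => ⟪hR.toLp R, Lp.compMeasurePreserving (g t) (hgm t) (hA.toLp A)⟫_ℝ :=
    continuous_const.inner h1
  refine h2.congr fun t => ?_
  rw [L2.inner_def]
  refine integral_congr_ae ?_
  filter_upwards [hR.coeFn_toLp, Lp.coeFn_compMeasurePreserving (hA.toLp A) (hgm t),
    (hgm t).quasiMeasurePreserving.ae_eq_comp hA.coeFn_toLp] with x e1 e2 e3
  rw [e1, e2]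
  have : (hA.toLp A ∘ g t) x = A (x - t) := e3
  rw [this]
  simp [mul_comm]

theorem integral_mul_convolution {R A k : E d → ℝ} (hR : MemLp R 2 volume)
    (hA : MemLp A 2 volume) (hk : Continuous k) (hkc : HasCompactSupport k) :
    ∫ x, R x * (∫ t, k t * A (x - t)) = ∫ t, k t * ∫ x, R x * A (x - t) := by
  have hinteg : Integrable (Function.uncurry fun x t : E d => R x * (k t * A (x - t)))
      (volume.prod volume) := by
    have hm : AEStronglyMeasurable (Function.uncurry fun x t : E d => R x * (k t * A (x - t)))
        (volume.prod volume) := by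
      refine (hR.1.comp_fst).mul ?_
      exact AEStronglyMeasurable.convolution_integrand (ContinuousLinearMap.mul ℝ ℝ)
        hk.aestronglyMeasurable hA.1
    rw [integrable_prod_iff' hm]
    have hmp : ∀ t : E d, MemLp (fun x => A (x - t)) 2 volume := fun t =>
      hA.comp_measurePreserving (measurePreserving_sub_right volume t)
    constructor
    · refine Eventually.of_forall fun t => ?_
      have h1 : Integrable (fun x => R x * A (x - t)) := hR.integrable_mul (hmp t)
      refine (h1.const_mul (k t)).congr (Eventually.of_forall fun x => ?_)
      simp only [Function.uncurry]
      ring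
    · have h1 := continuous_integral_mul_translate hR.norm hA.norm
      have h2 : Continuous fun t => ‖k t‖ * ∫ x, ‖R x‖ * ‖A (x - t)‖ := hk.norm.mul h1
      refine (h2.integrable_of_hasCompactSupport (hkc.norm.mul_right)).congr
        (Eventually.of_forall fun t => ?_)
      simp only [Function.uncurry]
      rw [← integral_const_mul]
      congr 1
      funext x
      rw [norm_mul, norm_mul]
      ring
  have h1 : ∀ x, R x * (∫ t, k t * A (x - t)) = ∫ t, R x * (k t * A (x - t)) := fun x =>
    (integral_const_mul _ _).symm
  simp_rw [h1]
  rw [integral_integral_swap hinteg]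
  congr 1
  funext t
  rw [← integral_const_mul]
  congr 1
  funext x
  ring

/-- By Fubini the pairing with the mollification is the `k n`-average of the continuous function
`T`, and the kernels concentrate at the origin. This weak form of convergence is enough for a
density proof by orthogonality. -/
theorem tendsto_integral_mul_convolution {R A : E d → ℝ} (hR : MemLp R 2 volume)
    (hA : MemLp A 2 volume) {k : ℕ → E d → ℝ} (hk : ∀ n, Continuous (k n))
    (hkc : ∀ n, HasCompactSupport (k n)) (hk0 : ∀ n x, 0 ≤ k n x) (hk1 : ∀ n, ∫ x, k n x = 1)
    {ρ : ℕ → ℝ} (hks : ∀ n x, k n x ≠ 0 → ‖x‖ ≤ ρ n) (hρ : Tendsto ρ atTop (𝓝 0)) :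
    Tendsto (fun n => ∫ x, R x * (∫ t, k n t * A (x - t))) atTop (𝓝 (∫ x, R x * A x)) := by
  simp_rw [fun n => integral_mul_convolution hR hA (hk n) (hkc n)]
  have hT := continuous_integral_mul_translate hR hA
  set T : E d → ℝ := fun t => ∫ x, R x * A (x - t) with hTdef
  have hT0 : ∫ x, R x * A x = T 0 := by simp [hTdef]
  rw [hT0, Metric.tendsto_atTop]
  intro ε hε
  obtain ⟨δ, hδ, hδT⟩ := Metric.continuous_iff.1 hT 0 (ε / 2) (half_pos hε)
  obtain ⟨N, hN⟩ := Metric.tendsto_atTop.1 hρ δ hδ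
  refine ⟨N, fun n hn => ?_⟩
  have i1 : Integrable (fun t => k n t * T t) :=
    ((hk n).mul hT).integrable_of_hasCompactSupport ((hkc n).mul_right)
  have i2 : Integrable (fun t => k n t * T 0) :=
    ((hk n).integrable_of_hasCompactSupport (hkc n)).mul_const _
  have i3 : Integrable (fun t => k n t * (ε / 2)) :=
    ((hk n).integrable_of_hasCompactSupport (hkc n)).mul_const _
  have e1 : T 0 = ∫ t, k n t * T 0 := by rw [integral_mul_const, hk1, one_mul]
  rw [dist_eq_norm]
  conv_lhs => rw [e1]
  rw [← integral_sub i1 i2]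
  have e2 : ε / 2 = ∫ t, k n t * (ε / 2) := by rw [integral_mul_const, hk1, one_mul]
  refine lt_of_le_of_lt ?_ (half_lt_self hε)
  rw [e2]
  refine norm_integral_le_of_norm_le i3 (Eventually.of_forall fun t => ?_)
  rw [← mul_sub, norm_mul, Real.norm_of_nonneg (hk0 n t)]
  by_cases hkt : k n t = 0
  · simp [hkt]
  · refine mul_le_mul_of_nonneg_left ?_ (hk0 n t)
    have h1 := hks n t hkt
    have h2 := hN n hn
    rw [Real.dist_eq, sub_zero] at h2
    have h3 := hδT t (by rw [dist_zero_right]; exact h1.trans_lt ((le_abs_self _).trans_lt h2))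
    rw [dist_eq_norm] at h3
    exact h3.le

/-! ### Inward directions of Lipschitz domains -/

/-- Near any point of the closure there is a direction `c` such that shifting by `ε • c`, with an
error proportional to `ε`, keeps `Ω` inside `Ω`. It allows one to mollify with kernels that only use
values from within `Ω`. -/
theorem exists_inward (hΩ : IsOpen Ω) (hl : HasLipschitzBoundary Ω) {x₀ : E d}
    (hx₀ : x₀ ∈ closure Ω) : ∃ (c : E d) (κ r ε₀ : ℝ), 0 < κ ∧ 0 < r ∧ 0 < ε₀ ∧
      ∀ ε, 0 < ε → ε < ε₀ → ∀ x ∈ Ω, x ∈ Metric.ball x₀ r →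
        ∀ q ∈ Metric.closedBall (ε • c) (ε * κ), x + q ∈ Ω := by
  by_cases hx : x₀ ∈ Ω
  · obtain ⟨r, hr, hball⟩ := Metric.isOpen_iff.1 hΩ x₀ hx
    refine ⟨0, 1, r / 2, r / 2, one_pos, half_pos hr, half_pos hr, ?_⟩
    intro ε hε hε' x _ hxb q hq
    apply hball
    rw [smul_zero, mem_closedBall_zero_iff, mul_one] at hq
    rw [mem_ball_iff_norm] at hxb ⊢
    have : x + q - x₀ = (x - x₀) + q := by abel
    rw [this]
    linarith [norm_add_le (x - x₀) q]
  · have hxf : x₀ ∈ frontier Ω := by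
      rw [hΩ.frontier_eq]
      exact ⟨hx₀, hx⟩
    obtain ⟨e, K, h, r, hc⟩ := hl.exists_chart hxf
    have hr := hc.pos
    have hK : (0 : ℝ) ≤ K := K.2
    -- A vector `q` of the ball satisfies ‖perp q‖ ≤ εκ and ⟪e, q⟫ ≥ ε(1 - κ). The cone condition
    -- thus reads Kκ < 1 - κ, which κ = 1/(K + 2) fulfils. As ‖q‖ ≤ 2ε, the bound ε < r/4 keeps the
    -- point in the chart.
    refine ⟨e, 1 / (K + 2), r / 2, r / 4, by positivity, by positivity, by positivity, ?_⟩
    intro ε hε hε' x hxΩ hxb q hq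
    rw [mem_closedBall_iff_norm] at hq
    set κ : ℝ := 1 / (K + 2) with hκ
    have hκK : (K + 2) * κ = 1 := by rw [hκ]; field_simp
    have hκ0 : 0 < κ := by positivity
    have hκ1 : κ ≤ 1 := by nlinarith
    have hqn : ‖q‖ ≤ 2 * ε := by
      have h1 := norm_le_norm_add_norm_sub' q (ε • e)
      rw [norm_smul, hc.unit, Real.norm_of_nonneg hε.le] at h1
      nlinarith
    refine hc.add_mem (Metric.ball_subset_ball (by linarith) hxb) (subset_closure hxΩ) ?_ ?_
    · rw [mem_ball_iff_norm] at hxb ⊢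
      have : x + q - x₀ = (x - x₀) + q := by abel
      rw [this]
      linarith [norm_add_le (x - x₀) q]
    · have hq' : q = (q - ε • e) + ε • e := by abel
      have h1 : ‖perp e q‖ ≤ ε * κ := by
        rw [hq', perp_add_smul_self hc.unit]
        exact (norm_perp_le hc.unit _).trans hq
      have h2 : ε - ε * κ ≤ ⟪e, q⟫_ℝ := by
        rw [hq', inner_add_smul_self hc.unit]
        have := abs_real_inner_le_norm e (q - ε • e)
        rw [hc.unit, one_mul] at this
        linarith [neg_abs_le ⟪e, q - ε • e⟫_ℝ]
      have h3 : (K : ℝ) * ‖perp e q‖ ≤ K * (ε * κ) := by gcongr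
      have h4 : K * (ε * κ) < ε - ε * κ := by nlinarith
      linarith

/-! ### Mollification of functions in `H¹` -/

/-- The mollification of `g`, extended by zero outside of `Ω`, with the kernel `k`. -/
def moll (Ω : Set (E d)) (k g : E d → ℝ) (x : E d) : ℝ := ∫ t, k t * Ω.indicator g (x - t)

theorem moll_eq_convolution (k g : E d → ℝ) :
    moll Ω k g = convolution k (Ω.indicator g) (ContinuousLinearMap.lsmul ℝ ℝ) volume := rfl

theorem moll_eq_setIntegral (hΩ : IsOpen Ω) (k g : E d → ℝ) (x : E d) :
    moll Ω k g x = ∫ y in Ω, k (x - y) * g y := by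
  rw [moll_eq_convolution, convolution_lsmul_swap, ← integral_indicator hΩ.measurableSet]
  congr 1
  funext y
  by_cases hy : y ∈ Ω <;> simp [hy]

section

variable {k g : E d → ℝ}

theorem memLp_indicator (hΩ : IsOpen Ω) (hg : MemLp g 2 (volume.restrict Ω)) :
    MemLp (Ω.indicator g) 2 volume := (memLp_indicator_iff_restrict hΩ.measurableSet).2 hg

theorem contDiff_moll (hΩ : IsOpen Ω) (hg : MemLp g 2 (volume.restrict Ω))
    (hk : ContDiff ℝ ∞ k) (hkc : HasCompactSupport k) : ContDiff ℝ ∞ (moll Ω k g) := by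
  rw [moll_eq_convolution]
  exact hkc.contDiff_convolution_left (n := ⊤) _ hk
    ((memLp_indicator hΩ hg).locallyIntegrable (by norm_num))

theorem hasCompactSupport_moll (hb : Bornology.IsBounded Ω) (hkc : HasCompactSupport k) :
    HasCompactSupport (moll Ω k g) := by
  rw [moll_eq_convolution]
  refine hkc.convolution _ (HasCompactSupport.of_support_subset_isCompact hb.isCompact_closure ?_)
  exact support_indicator_subset.trans subset_closure

theorem fderiv_moll (hΩ : IsOpen Ω) (hg : MemLp g 2 (volume.restrict Ω))
    (hk : ContDiff ℝ ∞ k) (hkc : HasCompactSupport k) (x a : E d) :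
    fderiv ℝ (moll Ω k g) x a = ∫ y in Ω, fderiv ℝ k (x - y) a * g y := by
  have hloc : LocallyIntegrable (Ω.indicator g) volume :=
    (memLp_indicator hΩ hg).locallyIntegrable (by norm_num)
  have h1 := hkc.hasFDerivAt_convolution_left (ContinuousLinearMap.lsmul ℝ ℝ)
    (hk.of_le (by simp)) hloc x
  rw [← moll_eq_convolution] at h1
  rw [h1.fderiv, convolution_eq_swap]
  have hex := (hkc.fderiv ℝ).convolutionExists_left
    ((ContinuousLinearMap.lsmul ℝ ℝ : ℝ →L[ℝ] ℝ →L[ℝ] ℝ).precompL (E d))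
    (hk.continuous_fderiv (by simp)) hloc x
  have hex' := hex.integrable_swap
  rw [ContinuousLinearMap.integral_apply hex', ← integral_indicator hΩ.measurableSet]
  congr 1
  funext y
  by_cases hy : y ∈ Ω <;> simp [hy, ContinuousLinearMap.precompL]

end

/-! ### Density of smooth functions -/

theorem inner_H1_eq_integral (v w : H1 Ω) : ⟪v, w⟫_ℝ =
    (∫ x in Ω, fn v x * fn w x) + ∑ i, ∫ x in Ω, grad Ω v x i * grad Ω w x i := by
  rw [inner_H1, L2.inner_def, L2.inner_def, ← integral_finsetSum]
  · congr 1
    · refine integral_congr_ae (Eventually.of_forall fun x => ?_)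
      dsimp only
      rw [RCLike.inner_apply, conj_trivial, mul_comm]
    · refine integral_congr_ae (Eventually.of_forall fun x => ?_)
      dsimp only
      rw [PiLp.inner_apply]
      refine Finset.sum_congr rfl fun i _ => ?_
      rw [RCLike.inner_apply, conj_trivial, mul_comm]
  · exact fun i _ => (memLp_coord _ i).integrable_mul (memLp_coord _ i)

theorem setIntegral_eq_integral_indicator_mul (hΩ : IsOpen Ω) (f g : E d → ℝ) :
    ∫ x in Ω, f x * g x = ∫ x, Ω.indicator f x * g x := by
  rw [← integral_indicator hΩ.measurableSet]
  congr 1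
  funext x
  by_cases hx : x ∈ Ω <;> simp [hx]

/-- Under `hx` the function y ↦ k(x - y) is a test function in `Ω`, so the weak gradient can be
tested with it. Without such a condition the jump of the zero extension across the boundary would
enter. -/
theorem gradient_moll_of_test (hΩ : IsOpen Ω) {k : E d → ℝ} (hk : ContDiff ℝ ∞ k)
    (hkc : HasCompactSupport k) (w : H1 Ω) {x : E d} (hx : ∀ y, x - y ∈ tsupport k → y ∈ Ω)
    (i : Fin d) :
    gradient (moll Ω k (fn w)) x i = moll Ω k (fun y => grad Ω w y i) x := by
  rw [gradient_apply, fderiv_moll hΩ (Lp.memLp _) hk hkc, moll_eq_setIntegral hΩ]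
  have hθ : IsTest Ω fun y => k (x - y) := by
    refine ⟨hk.comp (contDiff_const.sub contDiff_id),
      hkc.comp_homeomorph (Homeomorph.subLeft x), ?_⟩
    refine closure_minimal (t := (fun y => x - y) ⁻¹' tsupport k) ?_
      ((isClosed_tsupport k).preimage (by fun_prop)) |>.trans fun y hy => hx y hy
    intro y hy
    exact subset_tsupport _ hy
  have h1 := isWeakGrad_grad w _ hθ i
  have hd : ∀ y, fderiv ℝ (fun y => k (x - y)) y (EuclideanSpace.single i 1) =
      -fderiv ℝ k (x - y) (EuclideanSpace.single i 1) := fun y => by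
    have h2 : HasFDerivAt (fun y => k (x - y))
        ((fderiv ℝ k (x - y)).comp (-ContinuousLinearMap.id ℝ (E d))) y :=
      (hk.differentiable (by simp) (x - y)).hasFDerivAt.comp y
        ((hasFDerivAt_id y).const_sub x)
    rw [h2.fderiv]
    simp
  simp_rw [hd, mul_neg, integral_neg, neg_inj] at h1
  simp_rw [mul_comm (fderiv ℝ k _ _), mul_comm (k _)]
  exact h1

/-- Localized to a small ball, `w = ψ v` is mollified with kernels shifted in the inward direction.
In `Ω` the gradient commutes with these mollifications, which are smooth and hence orthogonal to
`r`; weak convergence gives ⟪r, w⟫ = 0. -/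
theorem inner_mulH1_eq_zero_of_orthogonal (hΩ : IsOpen Ω) (hb : Bornology.IsBounded Ω)
    (hl : HasLipschitzBoundary Ω) {r : H1 Ω}
    (hr : ∀ φ (h1 : ContDiff ℝ ∞ φ) (h2 : HasCompactSupport φ), ⟪r, smoothH1 Ω h1 h2⟫_ℝ = 0)
    {x₀ : E d} (hx₀ : x₀ ∈ closure Ω) : ∃ ρ > 0, ∀ ψ (hψ : ContDiff ℝ ∞ ψ),
      tsupport ψ ⊆ Metric.ball x₀ ρ → ∀ v, ⟪r, mulH1 hΩ hb hψ v⟫_ℝ = 0 := by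
  obtain ⟨c, κ, R, ε₀, hκ, hR, hε₀, hin⟩ := exists_inward hΩ hl hx₀
  refine ⟨R / 2, half_pos hR, fun ψ hψ hψs v => ?_⟩
  set w := mulH1 hΩ hb hψ v with hw
  -- The kernels reach less than `R / 2`. As the support of `ψ` lies in the ball of radius `R / 2`,
  -- points outside the ball of radius `R` do not see `w` at all.
  set ε₁ : ℝ := min ε₀ (R / 2 / (‖c‖ + κ)) with hε₁
  have hck : 0 < ‖c‖ + κ := by positivity
  have hε₁0 : 0 < ε₁ := lt_min hε₀ (by positivity)
  let ε : ℕ → ℝ := fun n => ε₁ / (n + 2)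
  have hε0 : ∀ n, 0 < ε n := fun n => by positivity
  have hεlt : ∀ n, ε n < ε₁ := fun n => by
    refine div_lt_self hε₁0 ?_
    have : (0 : ℝ) ≤ n := n.cast_nonneg
    linarith
  have hεR : ∀ n, ε n * (‖c‖ + κ) < R / 2 := fun n => by
    have := (hεlt n).trans_le (min_le_right _ _)
    rwa [lt_div_iff₀ hck] at this
  -- The kernel is centred at `-(ε n • c)`: the convolution evaluates `w` at x - t with t near this
  -- centre, i.e. at points x + q with q near `ε n • c`.
  let B : ∀ n, ContDiffBump (-(ε n • c)) := fun n =>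
    ⟨ε n * κ / 2, ε n * κ, half_pos (mul_pos (hε0 n) hκ), half_lt_self (mul_pos (hε0 n) hκ)⟩
  let k : ℕ → E d → ℝ := fun n => (B n).normed volume
  have hk : ∀ n, ContDiff ℝ ∞ (k n) := fun n => (B n).contDiff_normed (n := ⊤)
  have hkc : ∀ n, HasCompactSupport (k n) := fun n => (B n).hasCompactSupport_normed
  have hks : ∀ n, tsupport (k n) = Metric.closedBall (-(ε n • c)) (ε n * κ) := fun n =>
    (B n).tsupport_normed_eq
  have hkn : ∀ n t, t ∈ tsupport (k n) → ‖t‖ ≤ ε n * (‖c‖ + κ) := fun n t ht => by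
    rw [hks, mem_closedBall_iff_norm] at ht
    have h1 := norm_le_norm_add_norm_sub' t (-(ε n • c))
    rw [norm_neg, norm_smul, Real.norm_of_nonneg (hε0 n).le] at h1
    linarith
  have hρ : Tendsto (fun n => ε n * (‖c‖ + κ)) atTop (𝓝 0) := by
    have h1 : Tendsto ε atTop (𝓝 0) :=
      tendsto_const_nhds.div_atTop
        (tendsto_atTop_add_const_right _ _ tendsto_natCast_atTop_atTop)
    simpa using h1.mul_const (‖c‖ + κ)
  have hzero : ∀ᵐ y ∂(volume.restrict Ω), y ∉ tsupport ψ → fn w y = 0 ∧ grad Ω w y = 0 := by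
    filter_upwards [fn_mulH1 hΩ hb hψ v, grad_mulH1 hΩ hb hψ v] with y h1 h2 hy
    have e1 : ψ y = 0 := image_eq_zero_of_notMem_tsupport hy
    have e2 : fderiv ℝ ψ y = 0 :=
      image_eq_zero_of_notMem_tsupport fun h => hy (tsupport_fderiv_subset ℝ h)
    have e3 : gradient ψ y = 0 := by rw [← norm_eq_zero, norm_gradient, e2, norm_zero]
    rw [hw, h1, h2, e1, e3]
    simp
  have hgrad : ∀ n, ∀ x ∈ Ω, ∀ i,
      gradient (moll Ω (k n) (fn w)) x i = moll Ω (k n) (fun y => grad Ω w y i) x := by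
    intro n x hx i
    by_cases hxb : x ∈ Metric.ball x₀ R
    · refine gradient_moll_of_test hΩ (hk n) (hkc n) w (fun y hy => ?_) i
      have := hin (ε n) (hε0 n) ((hεlt n).trans_le (min_le_left _ _)) x hx hxb (y - x) (by
        rw [hks, mem_closedBall_iff_norm] at hy
        have e1 : y - x - ε n • c = -(x - y - -(ε n • c)) := by abel
        rwa [mem_closedBall_iff_norm, e1, norm_neg])
      simpa using this
    · have hfar : ∀ y ∈ tsupport ψ, x - y ∉ tsupport (k n) := fun y hy hxy => by
        have h1 := hkn n _ hxy
        have h2 := hψs hy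
        rw [mem_ball_iff_norm] at h2 hxb
        have h3 := norm_add_le (x - y) (y - x₀)
        rw [sub_add_sub_cancel] at h3
        linarith [hεR n]
      rw [gradient_apply, fderiv_moll hΩ (Lp.memLp _) (hk n) (hkc n), moll_eq_setIntegral hΩ]
      refine integral_congr_ae ?_
      filter_upwards [hzero] with y hy
      by_cases hyψ : y ∈ tsupport ψ
      · have e1 : k n (x - y) = 0 := image_eq_zero_of_notMem_tsupport (hfar y hyψ)
        have e2 : fderiv ℝ (k n) (x - y) = 0 := image_eq_zero_of_notMem_tsupport fun h =>
          hfar y hyψ (tsupport_fderiv_subset ℝ h)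
        rw [e1, e2]
        simp
      · rw [(hy hyψ).1, (hy hyψ).2]
        simp
  have hsum : ∀ n, (∫ x, Ω.indicator (fn r) x * moll Ω (k n) (fn w) x) +
      ∑ i, ∫ x, Ω.indicator (fun y => grad Ω r y i) x *
        moll Ω (k n) (fun y => grad Ω w y i) x = 0 := by
    intro n
    have h1 := contDiff_moll hΩ (Lp.memLp (fn w)) (hk n) (hkc n)
    have h2 : HasCompactSupport (moll Ω (k n) (fn w)) := hasCompactSupport_moll hb (hkc n)
    rw [← hr _ h1 h2, inner_H1_eq_integral]
    congr 1
    · rw [← setIntegral_eq_integral_indicator_mul hΩ]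
      refine integral_congr_ae ?_
      filter_upwards [fn_smoothH1 (Ω := Ω) h1 h2] with x hx
      rw [hx]
    · refine Finset.sum_congr rfl fun i _ => ?_
      rw [← setIntegral_eq_integral_indicator_mul hΩ]
      refine integral_congr_ae ?_
      filter_upwards [grad_smoothH1 (Ω := Ω) h1 h2, ae_restrict_mem hΩ.measurableSet] with x hx hxΩ
      rw [hx, hgrad n x hxΩ i]
  have hlim : ∀ f g : E d → ℝ, MemLp f 2 (volume.restrict Ω) → MemLp g 2 (volume.restrict Ω) →
      Tendsto (fun n => ∫ x, Ω.indicator f x * moll Ω (k n) g x) atTop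
        (𝓝 (∫ x in Ω, f x * g x)) := by
    intro f g hf hg
    have h1 := tendsto_integral_mul_convolution (memLp_indicator hΩ hf) (memLp_indicator hΩ hg)
      (fun n => (hk n).continuous) hkc (fun n x => (B n).nonneg_normed x)
      (fun n => (B n).integral_normed) (fun n t ht => hkn n t (subset_tsupport _ ht)) hρ
    have h2 : ∫ x in Ω, f x * g x = ∫ x, Ω.indicator f x * Ω.indicator g x := by
      rw [← integral_indicator hΩ.measurableSet]
      congr 1
      funext x
      by_cases hx : x ∈ Ω <;> simp [hx]
    rw [h2]
    exact h1
  rw [inner_H1_eq_integral]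
  refine tendsto_nhds_unique ?_ (tendsto_const_nhds (x := (0 : ℝ)) (f := (atTop : Filter ℕ)))
  have := (hlim _ _ (Lp.memLp (fn r)) (Lp.memLp (fn w))).add
    (tendsto_finsetSum Finset.univ fun i _ =>
      hlim _ _ (memLp_coord (grad Ω r) i) (memLp_coord (grad Ω w) i))
  refine this.congr fun n => ?_
  exact hsum n

/-- A smooth partition of unity on the compact closure writes `r` as a sum of localized products `f
i * r`, each orthogonal to `r`; hence ⟪r, r⟫ = 0. -/
theorem eq_zero_of_orthogonal_smooth (hΩ : IsOpen Ω) (hb : Bornology.IsBounded Ω)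
    (hl : HasLipschitzBoundary Ω) {r : H1 Ω}
    (hr : ∀ φ (h1 : ContDiff ℝ ∞ φ) (h2 : HasCompactSupport φ), ⟪r, smoothH1 Ω h1 h2⟫_ℝ = 0) :
    r = 0 := by
  choose! ρ hρ hloc using fun x (hx : x ∈ closure Ω) =>
    inner_mulH1_eq_zero_of_orthogonal hΩ hb hl hr hx
  obtain ⟨t, ht, htc⟩ := hb.isCompact_closure.elim_nhds_subcover (fun x => Metric.ball x (ρ x))
    fun x hx => Metric.ball_mem_nhds x (hρ x hx)
  obtain ⟨f, hf⟩ := SmoothPartitionOfUnity.exists_isSubordinate (modelWithCornersSelf ℝ (E d))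
    (isClosed_closure (s := Ω)) (fun x : t => Metric.ball (x : E d) (ρ x))
    (fun _ => Metric.isOpen_ball) (by
      intro x hx
      obtain ⟨y, hy, hxy⟩ := mem_iUnion₂.1 (htc hx)
      exact mem_iUnion.2 ⟨⟨y, hy⟩, hxy⟩)
  have hfs : ∀ i : t, ContDiff ℝ ∞ (f i) := fun i => (f i).contMDiff.contDiff
  have hsum : r = ∑ i : t, mulH1 hΩ hb (hfs i) r := by
    refine fn_injective hΩ ?_
    have h1 : fn (∑ i : t, mulH1 hΩ hb (hfs i) r) = ∑ i : t, fn (mulH1 hΩ hb (hfs i) r) := by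
      simp_rw [← fnL_apply, map_sum]
    rw [h1]
    refine Lp.ext ?_
    have h2 : ∀ i : t, ∀ᵐ x ∂(volume.restrict Ω), fn (mulH1 hΩ hb (hfs i) r) x = f i x * fn r x :=
      fun i => fn_mulH1 hΩ hb (hfs i) r
    filter_upwards [ae_all_iff.2 h2, 
      Lp.coeFn_finsetSum Finset.univ fun i : t => fn (mulH1 hΩ hb (hfs i) r),
      ae_restrict_mem hΩ.measurableSet] with x e1 e2 hx
    rw [e2, Finset.sum_apply]
    simp_rw [e1]
    rw [← Finset.sum_mul, ← finsum_eq_sum_of_fintype, f.sum_eq_one (subset_closure hx), one_mul]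
  have hz : ⟪r, r⟫_ℝ = 0 := by
    have h1 : ⟪r, r⟫_ℝ = ⟪r, ∑ i : t, mulH1 hΩ hb (hfs i) r⟫_ℝ := congrArg _ hsum
    rw [h1, inner_sum]
    exact Finset.sum_eq_zero fun i _ => hloc i (ht i i.2) _ (hfs i) (hf i) r
  exact inner_self_eq_zero.1 hz

end Insulation

namespace Insulation

variable {d : ℕ} {Ω γ : Set (E d)}

/-! ### The trace operator -/

/-- Bounded Lipschitz domains. -/
structure IsLipDomain (Ω : Set (E d)) : Prop where
  isOpen : IsOpen Ω
  isBounded : Bornology.IsBounded Ω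
  lipschitz : HasLipschitzBoundary Ω

theorem IsLipDomain.isFiniteMeasure (hΩ : IsLipDomain Ω) :
    IsFiniteMeasure ((surf d).restrict (frontier Ω)) :=
  ⟨by
    rw [Measure.restrict_apply_univ]
    exact surf_frontier_lt_top hΩ.isOpen hΩ.isBounded hΩ.lipschitz⟩

theorem enorm_sq_Lp {X F : Type*} [MeasurableSpace X] {μ : Measure X} [NormedAddCommGroup F]
    (f : Lp F 2 μ) : ‖f‖ₑ ^ 2 = ∫⁻ x, ‖f x‖ₑ ^ 2 ∂μ := by
  have h := eLpNorm_nnreal_pow_eq_lintegral (f := f) (μ := μ) (p := 2) (by norm_num)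
  rw [Lp.enorm_def]
  simpa using h

theorem enorm_sq_H1 (v : H1 Ω) : ‖v‖ₑ ^ 2 = ‖fn v‖ₑ ^ 2 + ‖grad Ω v‖ₑ ^ 2 := by
  have h : ‖v‖₊ ^ 2 = ‖fn v‖₊ ^ 2 + ‖grad Ω v‖₊ ^ 2 := NNReal.eq (norm_sq_H1 v)
  simp only [enorm_eq_nnnorm]
  exact_mod_cast h

theorem enorm_sq_smoothH1 {φ : E d → ℝ} (hφ : ContDiff ℝ ∞ φ) (hc : HasCompactSupport φ) :
    ‖smoothH1 Ω hφ hc‖ₑ ^ 2 = energy Ω φ := by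
  rw [enorm_sq_H1, enorm_sq_Lp, enorm_sq_Lp, energy]
  congr 1
  · refine lintegral_congr_ae ?_
    filter_upwards [fn_smoothH1 (Ω := Ω) hφ hc] with x hx
    rw [hx]
  · refine lintegral_congr_ae ?_
    filter_upwards [grad_smoothH1 (Ω := Ω) hφ hc] with x hx
    rw [hx]

theorem IsLipDomain.memLp_frontier (hΩ : IsLipDomain Ω) {φ : E d → ℝ} (hφ : Continuous φ) :
    MemLp φ 2 ((surf d).restrict (frontier Ω)) := by
  have := hΩ.isFiniteMeasure
  obtain ⟨C, hC⟩ := exists_bound_on hΩ.isBounded hφ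
  refine MemLp.of_bound hφ.aestronglyMeasurable C ?_
  filter_upwards [ae_restrict_mem isClosed_frontier.measurableSet] with x hx
  exact hC x (frontier_subset_closure hx)

theorem smooth_mem_smoothTraceGraph (hΩ : IsLipDomain Ω) {φ : E d → ℝ} (hφ : ContDiff ℝ ∞ φ)
    (hc : HasCompactSupport φ) :
    (smoothH1 Ω hφ hc, (hΩ.memLp_frontier hφ.continuous).toLp φ) ∈ smoothTraceGraph Ω :=
  ⟨φ, hφ, hc, fn_smoothH1 hφ hc, (hΩ.memLp_frontier hφ.continuous).coeFn_toLp⟩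

/-- The trace inequality is a closed condition on pairs, so it passes from smooth functions to the
closure of their graph. It makes the trace single-valued and bounded. -/
theorem exists_norm_trace_le (hΩ : IsLipDomain Ω) :
    ∃ C : NNReal, ∀ p ∈ traceGraph Ω, ‖p.2‖ ≤ C * ‖p.1‖ := by
  obtain ⟨C, hC⟩ := exists_trace_inequality hΩ.isOpen hΩ.isBounded hΩ.lipschitz
  refine ⟨NNReal.sqrt C, fun p hp => ?_⟩
  have hcl : IsClosed {p : H1 Ω × L2bd Ω | ‖p.2‖ ≤ NNReal.sqrt C * ‖p.1‖} :=
    isClosed_le (by fun_prop) (by fun_prop)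
  refine closure_minimal (s := (smoothTraceGraph Ω : Set (H1 Ω × L2bd Ω))) ?_ hcl hp
  rintro ⟨v, w⟩ ⟨φ, hφ, hc, h1, h2⟩
  have hv : v = smoothH1 Ω hφ hc := eq_smoothH1 hΩ.isOpen hφ hc h1
  have e1 := hC φ hφ
  have e2 : ‖w‖ₑ ^ 2 = ∫⁻ p in frontier Ω, ‖φ p‖ₑ ^ 2 ∂(surf d) := by
    rw [enorm_sq_Lp]
    refine lintegral_congr_ae ?_
    filter_upwards [h2] with x hx
    rw [hx]
  rw [← e2, ← enorm_sq_smoothH1 (Ω := Ω) hφ hc, ← hv] at e1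
  have e3 : ‖w‖₊ ^ 2 ≤ C * ‖v‖₊ ^ 2 := by
    simp only [enorm_eq_nnnorm] at e1
    exact_mod_cast e1
  have e4 : ‖w‖₊ ≤ NNReal.sqrt C * ‖v‖₊ := by
    rw [← pow_le_pow_iff_left₀ zero_le zero_le two_ne_zero, mul_pow, NNReal.sq_sqrt]
    exact e3
  have e5 : ‖w‖ ≤ (NNReal.sqrt C : ℝ) * ‖v‖ := NNReal.coe_le_coe.2 e4
  exact e5

theorem traceGraph_unique (hΩ : IsLipDomain Ω) {v : H1 Ω} {w w' : L2bd Ω}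
    (h : (v, w) ∈ traceGraph Ω) (h' : (v, w') ∈ traceGraph Ω) : w = w' := by
  obtain ⟨C, hC⟩ := exists_norm_trace_le hΩ
  have := hC _ ((traceGraph Ω).sub_mem h h')
  simp only [Prod.mk_sub_mk, sub_self, norm_zero, mul_zero] at this
  exact sub_eq_zero.1 (norm_le_zero_iff.1 this)

/-- By the trace bound the projection of the closed trace graph onto H¹ is bounded below, so its
range is closed. The range contains the smooth functions and therefore has trivial orthogonal
complement. -/
theorem exists_mem_traceGraph (hΩ : IsLipDomain Ω) (v : H1 Ω) : ∃ w, (v, w) ∈ traceGraph Ω := by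
  obtain ⟨C, hC⟩ := exists_norm_trace_le hΩ
  have hcl : IsClosed (traceGraph Ω : Set (H1 Ω × L2bd Ω)) :=
    (smoothTraceGraph Ω).isClosed_topologicalClosure
  have : CompleteSpace (traceGraph Ω) := hcl.completeSpace_coe
  let L : traceGraph Ω →L[ℝ] H1 Ω :=
    (ContinuousLinearMap.fst ℝ (H1 Ω) (L2bd Ω)).comp (traceGraph Ω).subtypeL
  have hanti : AntilipschitzWith (max 1 C) L := by
    refine L.antilipschitz_of_bound fun p => ?_
    change max ‖(p : H1 Ω × L2bd Ω).1‖ ‖(p : H1 Ω × L2bd Ω).2‖ ≤ _ * ‖(p : H1 Ω × L2bd Ω).1‖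
    have h1 := hC p p.2
    have h2 := norm_nonneg (p : H1 Ω × L2bd Ω).1
    refine max_le ?_ (h1.trans ?_)
    · calc ‖(p : H1 Ω × L2bd Ω).1‖ = 1 * ‖(p : H1 Ω × L2bd Ω).1‖ := (one_mul _).symm
        _ ≤ _ := by gcongr; exact_mod_cast le_max_left _ _
    · gcongr
      exact_mod_cast le_max_right _ _
  have hrange : IsClosed (LinearMap.range (L : traceGraph Ω →ₗ[ℝ] H1 Ω) : Set (H1 Ω)) :=
    hanti.isClosed_range L.uniformContinuous
  have : CompleteSpace (LinearMap.range (L : traceGraph Ω →ₗ[ℝ] H1 Ω)) := hrange.completeSpace_coe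
  have htop : LinearMap.range (L : traceGraph Ω →ₗ[ℝ] H1 Ω) = ⊤ := by
    rw [← Submodule.orthogonal_eq_bot_iff, Submodule.eq_bot_iff]
    intro r hr
    refine eq_zero_of_orthogonal_smooth hΩ.isOpen hΩ.isBounded hΩ.lipschitz fun φ h1 h2 => ?_
    rw [Submodule.mem_orthogonal'] at hr
    exact hr _ ⟨⟨_, Submodule.le_topologicalClosure _ (smooth_mem_smoothTraceGraph hΩ h1 h2)⟩, rfl⟩
  have hv : v ∈ LinearMap.range (L : traceGraph Ω →ₗ[ℝ] H1 Ω) := htop ▸ Submodule.mem_top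
  obtain ⟨p, hp⟩ := hv
  refine ⟨(p : H1 Ω × L2bd Ω).2, ?_⟩
  have : (p : H1 Ω × L2bd Ω) = (v, (p : H1 Ω × L2bd Ω).2) := Prod.ext hp rfl
  rw [← this]
  exact p.2

theorem trace_mem (hΩ : IsLipDomain Ω) (v : H1 Ω) : (v, trace v) ∈ traceGraph Ω := by
  have h := exists_mem_traceGraph hΩ v
  rw [trace, dif_pos h]
  exact h.choose_spec

theorem trace_eq (hΩ : IsLipDomain Ω) {v : H1 Ω} {w : L2bd Ω} (h : (v, w) ∈ traceGraph Ω) :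
    trace v = w := traceGraph_unique hΩ (trace_mem hΩ v) h

theorem trace_add (hΩ : IsLipDomain Ω) (v w : H1 Ω) : trace (v + w) = trace v + trace w :=
  trace_eq hΩ ((traceGraph Ω).add_mem (trace_mem hΩ v) (trace_mem hΩ w))

theorem trace_smul (hΩ : IsLipDomain Ω) (c : ℝ) (v : H1 Ω) : trace (c • v) = c • trace v :=
  trace_eq hΩ ((traceGraph Ω).smul_mem c (trace_mem hΩ v))

/-- The trace operator. -/
def traceL (hΩ : IsLipDomain Ω) : H1 Ω →L[ℝ] L2bd Ω :=
  LinearMap.mkContinuousOfExistsBound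
    { toFun := trace
      map_add' := trace_add hΩ
      map_smul' := trace_smul hΩ }
    (by
      obtain ⟨C, hC⟩ := exists_norm_trace_le hΩ
      exact ⟨C, fun v => hC (v, trace v) (trace_mem hΩ v)⟩)

theorem trace_smoothH1 (hΩ : IsLipDomain Ω) {φ : E d → ℝ} (hφ : ContDiff ℝ ∞ φ)
    (hc : HasCompactSupport φ) : trace (smoothH1 Ω hφ hc) =ᵐ[(surf d).restrict (frontier Ω)] φ := by
  rw [trace_eq hΩ (Submodule.le_topologicalClosure _ (smooth_mem_smoothTraceGraph hΩ hφ hc))]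
  exact MemLp.coeFn_toLp _

/-- Closed properties of pairs `(v, tr v)` may be checked on smooth functions. -/
theorem H1_induction (hΩ : IsLipDomain Ω) {P : H1 Ω → Prop} (hP : IsClosed {v | P v})
    (h : ∀ φ (hφ : ContDiff ℝ ∞ φ) (hc : HasCompactSupport φ), P (smoothH1 Ω hφ hc)) (v : H1 Ω) :
    P v := by
  have hv := trace_mem hΩ v
  have hcl : IsClosed {p : H1 Ω × L2bd Ω | P p.1} := hP.preimage continuous_fst
  refine closure_minimal (s := (smoothTraceGraph Ω : Set (H1 Ω × L2bd Ω))) ?_ hcl hv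
  rintro ⟨v, w⟩ ⟨φ, hφ, hc, h1, -⟩
  have hv : v = smoothH1 Ω hφ hc := eq_smoothH1 hΩ.isOpen hφ hc h1
  change P v
  rw [hv]
  exact h φ hφ hc

theorem exists_seq_smooth (hΩ : IsLipDomain Ω) (v : H1 Ω) : ∃ φ : ℕ → E d → ℝ,
    ∃ (hφ : ∀ n, ContDiff ℝ ∞ (φ n)) (hc : ∀ n, HasCompactSupport (φ n)),
      Tendsto (fun n => smoothH1 Ω (hφ n) (hc n)) atTop (𝓝 v) := by
  have h1 : v ∈ closure {v | ∃ φ, ∃ (hφ : ContDiff ℝ ∞ φ) (hc : HasCompactSupport φ),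
      smoothH1 Ω hφ hc = v} :=
    H1_induction hΩ (P := fun v => v ∈ closure {v | ∃ φ, ∃ (hφ : ContDiff ℝ ∞ φ)
      (hc : HasCompactSupport φ), smoothH1 Ω hφ hc = v}) isClosed_closure
      (fun φ hφ hc => subset_closure ⟨φ, hφ, hc, rfl⟩) v
  obtain ⟨u, hu, hlim⟩ := mem_closure_iff_seq_limit.1 h1
  choose φ hφ hc he using hu
  exact ⟨φ, hφ, hc, by simpa only [he] using hlim⟩

/-- Both sides are bounded operators applied to `v`, and they agree on smooth functions. -/
theorem trace_mulH1 (hΩ : IsLipDomain Ω) {ψ : E d → ℝ} (hψ : ContDiff ℝ ∞ ψ) (v : H1 Ω) :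
    trace (mulH1 hΩ.isOpen hΩ.isBounded hψ v) =ᵐ[(surf d).restrict (frontier Ω)]
      fun x => ψ x * trace v x := by
  obtain ⟨C, hC⟩ := exists_bound_on hΩ.isBounded hψ.continuous
  have hT : AEStronglyMeasurable (fun x => ψ x • ContinuousLinearMap.id ℝ ℝ)
      ((surf d).restrict (frontier Ω)) :=
    (hψ.continuous.smul continuous_const).aestronglyMeasurable
  have hTC : ∀ᵐ x ∂((surf d).restrict (frontier Ω)), ‖ψ x • ContinuousLinearMap.id ℝ ℝ‖ ≤ C := by
    filter_upwards [ae_restrict_mem isClosed_frontier.measurableSet] with x hx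
    rw [norm_smul, ContinuousLinearMap.norm_id, mul_one]
    exact hC x (frontier_subset_closure hx)
  have key : trace (mulH1 hΩ.isOpen hΩ.isBounded hψ v) = multL hT hTC (trace v) := by
    refine H1_induction hΩ (P := fun v => trace (mulH1 hΩ.isOpen hΩ.isBounded hψ v) =
      multL hT hTC (trace v)) ?_ ?_ v
    · exact isClosed_eq ((traceL hΩ).continuous.comp (mulH1L hΩ.isOpen hΩ.isBounded hψ).continuous)
        ((multL hT hTC).continuous.comp (traceL hΩ).continuous)
    · intro φ hφ hc
      have h1 : mulH1 hΩ.isOpen hΩ.isBounded hψ (smoothH1 Ω hφ hc) =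
          smoothH1 Ω (hψ.mul hφ) (hc.mul_left) := by
        refine eq_smoothH1 hΩ.isOpen _ _ ?_
        filter_upwards [fn_mulH1 hΩ.isOpen hΩ.isBounded hψ (smoothH1 Ω hφ hc),
          fn_smoothH1 (Ω := Ω) hφ hc] with x e1 e2
        rw [e1, e2]
      rw [h1]
      refine Lp.ext ?_
      filter_upwards [trace_smoothH1 hΩ (hψ.mul hφ) (hc.mul_left), trace_smoothH1 hΩ hφ hc,
        coeFn_multL hT hTC (trace (smoothH1 Ω hφ hc))] with x e1 e2 e3
      rw [e1, e3, e2]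
      simp
  rw [key]
  filter_upwards [coeFn_multL hT hTC (trace v)] with x hx
  rw [hx]
  simp

theorem mem_H1zero_iff (hΩ : IsLipDomain Ω) {v : H1 Ω} : v ∈ H1zero Ω γ ↔
    ∀ᵐ x ∂((surf d).restrict (frontier Ω)), x ∈ γ → trace v x = 0 := by
  constructor
  · rintro ⟨w, h1, h2⟩
    rwa [trace_eq hΩ h1]
  · exact fun h => ⟨trace v, trace_mem hΩ v, h⟩

/-! ### Boundary integrals -/

theorem IsBoundaryPart.subset (hγ : IsBoundaryPart Ω γ) : γ ⊆ frontier Ω := by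
  obtain ⟨U, -, rfl⟩ := hγ
  exact inter_subset_right

theorem IsBoundaryPart.measurableSet (hγ : IsBoundaryPart Ω γ) : MeasurableSet γ := by
  obtain ⟨U, hU, rfl⟩ := hγ
  exact hU.measurableSet.inter isClosed_frontier.measurableSet

theorem restrict_le_of_subset (h : γ ⊆ frontier Ω) :
    (surf d).restrict γ ≤ (surf d).restrict (frontier Ω) := Measure.restrict_mono h le_rfl

theorem ae_restrict_of_subset (h : γ ⊆ frontier Ω) {p : E d → Prop}
    (hp : ∀ᵐ x ∂((surf d).restrict (frontier Ω)), p x) : ∀ᵐ x ∂((surf d).restrict γ), p x :=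
  ae_mono (restrict_le_of_subset h) hp

theorem IsLipDomain.isFiniteMeasure_of_subset (hΩ : IsLipDomain Ω) (h : γ ⊆ frontier Ω) :
    IsFiniteMeasure ((surf d).restrict γ) := by
  have := hΩ.isFiniteMeasure
  exact isFiniteMeasure_of_le _ (restrict_le_of_subset h)

theorem memLp_one_trace (hΩ : IsLipDomain Ω) (h : γ ⊆ frontier Ω) (w : L2bd Ω) :
    MemLp w 1 ((surf d).restrict γ) := by
  have := hΩ.isFiniteMeasure
  exact ((Lp.memLp w).mono_exponent (by norm_num)).mono_measure (restrict_le_of_subset h)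

/-- The restriction operator `L²(∂Ω) → L¹(γ)`. -/
def restrictL (hΩ : IsLipDomain Ω) (h : γ ⊆ frontier Ω) :
    L2bd Ω →L[ℝ] Lp ℝ 1 ((surf d).restrict γ) :=
  LinearMap.mkContinuousOfExistsBound
    { toFun := fun w => (memLp_one_trace hΩ h w).toLp w
      map_add' := fun v w => by
        rw [← MemLp.toLp_add]
        exact MemLp.toLp_congr _ _ (ae_restrict_of_subset h (Lp.coeFn_add v w))
      map_smul' := fun c v => by
        rw [RingHom.id_apply, ← MemLp.toLp_const_smul]
        exact MemLp.toLp_congr _ _ (ae_restrict_of_subset h (Lp.coeFn_smul c v)) }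
    (by
      have := hΩ.isFiniteMeasure
      set μ := (surf d).restrict (frontier Ω)
      set A : ℝ≥0∞ := μ univ ^ (1 / (1 : ℝ≥0∞).toReal - 1 / (2 : ℝ≥0∞).toReal)
      have hA : A ≠ ⊤ := ENNReal.rpow_ne_top_of_nonneg (by norm_num) (measure_ne_top _ _)
      refine ⟨A.toReal, fun w => ?_⟩
      change ‖(memLp_one_trace hΩ h w).toLp w‖ ≤ _
      rw [Lp.norm_toLp, Lp.norm_def, mul_comm, ← ENNReal.toReal_mul]
      refine ENNReal.toReal_mono (ENNReal.mul_ne_top (Lp.eLpNorm_ne_top w) hA) ?_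
      exact (eLpNorm_mono_measure _ (restrict_le_of_subset h)).trans
        (eLpNorm_le_eLpNorm_mul_rpow_measure_univ (by norm_num) (Lp.aestronglyMeasurable w)))

theorem coeFn_restrictL (hΩ : IsLipDomain Ω) (h : γ ⊆ frontier Ω) (w : L2bd Ω) :
    restrictL hΩ h w =ᵐ[(surf d).restrict γ] w := (memLp_one_trace hΩ h w).coeFn_toLp

/-- The trace operator `H¹(Ω) → L¹(γ)`. -/
def traceOne (hΩ : IsLipDomain Ω) (h : γ ⊆ frontier Ω) :
    H1 Ω →L[ℝ] Lp ℝ 1 ((surf d).restrict γ) := (restrictL hΩ h).comp (traceL hΩ)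

theorem coeFn_traceOne (hΩ : IsLipDomain Ω) (h : γ ⊆ frontier Ω) (v : H1 Ω) :
    traceOne hΩ h v =ᵐ[(surf d).restrict γ] trace v := coeFn_restrictL hΩ h (trace v)

theorem bdNorm1_eq (hΩ : IsLipDomain Ω) (h : γ ⊆ frontier Ω) (v : H1 Ω) :
    bdNorm1 γ v = ‖traceOne hΩ h v‖ := by
  rw [L1.norm_eq_integral_norm, bdNorm1]
  refine integral_congr_ae ?_
  filter_upwards [coeFn_traceOne hΩ h v] with x hx
  rw [hx, Real.norm_eq_abs]

theorem bdPair_eq (hΩ : IsLipDomain Ω) (h : γ ⊆ frontier Ω) (b : Linf γ) (v : H1 Ω) :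
    bdPair γ b v = ∫ x in γ, b x * traceOne hΩ h v x ∂(surf d) := by
  refine integral_congr_ae ?_
  filter_upwards [coeFn_traceOne hΩ h v] with x hx
  rw [hx]

theorem traceOne_eq_zero_iff (hΩ : IsLipDomain Ω) (hγ : IsBoundaryPart Ω γ) (v : H1 Ω) :
    traceOne hΩ hγ.subset v = 0 ↔ v ∈ H1zero Ω γ := by
  have e : ((surf d).restrict (frontier Ω)).restrict γ = (surf d).restrict γ := by
    rw [Measure.restrict_restrict hγ.measurableSet, inter_eq_left.2 hγ.subset]
  rw [mem_H1zero_iff hΩ, ← ae_restrict_iff' hγ.measurableSet, e, Lp.eq_zero_iff_ae_eq_zero]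
  constructor
  · intro h
    filter_upwards [h, coeFn_traceOne hΩ hγ.subset v] with x h1 h2
    rw [← h2, h1, Pi.zero_apply]
  · intro h
    filter_upwards [h, coeFn_traceOne hΩ hγ.subset v] with x h1 h2
    rw [h2, h1, Pi.zero_apply]

theorem isClosed_H1zero (hΩ : IsLipDomain Ω) (hγ : IsBoundaryPart Ω γ) :
    IsClosed (H1zero Ω γ : Set (H1 Ω)) := by
  have : (H1zero Ω γ : Set (H1 Ω)) = {v | traceOne hΩ hγ.subset v = 0} := by
    ext v
    exact (traceOne_eq_zero_iff hΩ hγ v).symm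
  rw [this]
  exact isClosed_eq (traceOne hΩ hγ.subset).continuous continuous_const

end Insulation

namespace Insulation

variable {d : ℕ} {Ω γ : Set (E d)}

/-! ### A Poincaré inequality -/

/-- The Dirichlet integral of a smooth function. -/
def dirichlet (Ω : Set (E d)) (φ : E d → ℝ) : ℝ≥0∞ := ∫⁻ x in Ω, ‖gradient φ x‖ₑ ^ 2

theorem ennreal_add_sq_le (a b : ℝ≥0∞) : (a + b) ^ 2 ≤ 2 * a ^ 2 + 2 * b ^ 2 := by
  rcases eq_or_ne a ⊤ with rfl | ha
  · simp
  rcases eq_or_ne b ⊤ with rfl | hb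
  · simp
  lift a to NNReal using ha
  lift b to NNReal using hb
  have : ((a : ℝ) + b) ^ 2 ≤ 2 * (a : ℝ) ^ 2 + 2 * (b : ℝ) ^ 2 := by
    nlinarith [sq_nonneg ((a : ℝ) - b)]
  exact_mod_cast this

theorem measurable_enorm_gradient_sq {φ : E d → ℝ} (hφ : ContDiff ℝ ∞ φ) :
    Measurable fun y => ‖gradient φ y‖ₑ ^ 2 :=
  ((continuous_gradient hφ).enorm.measurable).pow_const 2

/-- Bound the increment along each segment from x to x + w by the gradient, exchange the order of
integration, and use translation invariance for each fixed τ. -/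
theorem lintegral_translate_sub_sq_le (hΩ : IsOpen Ω) {S : Set (E d)} (hS : MeasurableSet S)
    {w : E d} (hw : ∀ x ∈ S, ∀ τ ∈ Ioc (0 : ℝ) 1, x + τ • w ∈ Ω) {φ : E d → ℝ}
    (hφ : ContDiff ℝ ∞ φ) :
    ∫⁻ x in S, ‖φ (x + w) - φ x‖ₑ ^ 2 ≤ ‖w‖ₑ ^ 2 * dirichlet Ω φ := by
  set F : E d → ℝ≥0∞ := Ω.indicator fun y => ‖gradient φ y‖ₑ ^ 2 with hF
  have hFm : Measurable F := (measurable_enorm_gradient_sq hφ).indicator hΩ.measurableSet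
  have hpt : ∀ x ∈ S, ‖φ (x + w) - φ x‖ₑ ^ 2 ≤
      ‖w‖ₑ ^ 2 * ∫⁻ τ in Ioc (0 : ℝ) 1, F (x + τ • w) := by
    intro x hx
    have h1 := enorm_sub_sq_le_lintegral_gradient hφ x w zero_le_one (le_refl (1 : ℝ))
    rw [one_smul, ENNReal.ofReal_one, one_mul] at h1
    refine h1.trans (mul_le_mul_right ?_ _)
    refine setLIntegral_mono_ae' measurableSet_Ioc (Eventually.of_forall fun τ hτ => ?_)
    rw [hF, indicator_of_mem (hw x hx τ hτ)]
  have hm2 : Measurable fun q : E d × ℝ => F (q.1 + q.2 • w) := by fun_prop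
  calc ∫⁻ x in S, ‖φ (x + w) - φ x‖ₑ ^ 2
      ≤ ∫⁻ x in S, ‖w‖ₑ ^ 2 * ∫⁻ τ in Ioc (0 : ℝ) 1, F (x + τ • w) :=
        setLIntegral_mono_ae' hS (Eventually.of_forall hpt)
    _ ≤ ∫⁻ x, ‖w‖ₑ ^ 2 * ∫⁻ τ in Ioc (0 : ℝ) 1, F (x + τ • w) := setLIntegral_le_lintegral _ _
    _ = ‖w‖ₑ ^ 2 * ∫⁻ τ in Ioc (0 : ℝ) 1, ∫⁻ x, F (x + τ • w) := by
        rw [lintegral_const_mul _ (Measurable.lintegral_prod_right' hm2),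
          lintegral_lintegral_swap hm2.aemeasurable]
    _ = ‖w‖ₑ ^ 2 * dirichlet Ω φ := by
        simp_rw [lintegral_add_right_eq_self (μ := (volume : Measure (E d))) F]
        rw [setLIntegral_const, Real.volume_Ioc, sub_zero, ENNReal.ofReal_one, mul_one, hF,
          lintegral_indicator hΩ.measurableSet, dirichlet]

/-- After the substitution y = x + w the inner integral is the increment estimate for a fixed `w`.
Segments stay in the ball by convexity, and only `w` of norm less than `2 * ρ` contribute. -/
theorem exists_ball_sub_sq_le (hΩ : IsOpen Ω) {x₀ : E d} {ρ : ℝ} (hB : Metric.ball x₀ ρ ⊆ Ω) :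
    ∃ C : NNReal, ∀ φ : E d → ℝ, ContDiff ℝ ∞ φ →
      ∫⁻ x in Metric.ball x₀ ρ, ∫⁻ y in Metric.ball x₀ ρ, ‖φ y - φ x‖ₑ ^ 2 ≤
        C * dirichlet Ω φ := by
  set B := Metric.ball x₀ ρ with hBdef
  have hBm : MeasurableSet B := Metric.isOpen_ball.measurableSet
  set V := volume (Metric.ball (0 : E d) (2 * ρ)) with hV
  have hVt : V ≠ ⊤ := measure_ball_lt_top.ne
  refine ⟨(ENNReal.ofReal (2 * ρ) ^ 2 * V).toNNReal, fun φ hφ => ?_⟩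
  rw [ENNReal.coe_toNNReal (by finiteness)]
  have hφm := hφ.continuous.measurable
  set g : E d × E d → ℝ≥0∞ := fun q =>
    B.indicator (fun _ => B.indicator (fun _ => ‖φ (q.1 + q.2) - φ q.1‖ₑ ^ 2) (q.1 + q.2)) q.1
    with hg
  have hgm : Measurable g := by
    have h1 : g = (Prod.fst ⁻¹' B ∩ (fun q : E d × E d => q.1 + q.2) ⁻¹' B).indicator
        fun q => ‖φ (q.1 + q.2) - φ q.1‖ₑ ^ 2 := by
      funext q
      by_cases h1 : q.1 ∈ B <;> by_cases h2 : q.1 + q.2 ∈ B <;> simp [hg, h1, h2]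
    rw [h1]
    refine Measurable.indicator (by fun_prop) ?_
    exact (measurable_fst hBm).inter ((by fun_prop : Measurable fun q : E d × E d => q.1 + q.2) hBm)
  have e1 : ∫⁻ x in B, ∫⁻ y in B, ‖φ y - φ x‖ₑ ^ 2 = ∫⁻ x, ∫⁻ w, g (x, w) := by
    rw [← lintegral_indicator hBm]
    refine lintegral_congr fun x => ?_
    by_cases hx : x ∈ B
    · simp only [hg, indicator_of_mem hx]
      rw [lintegral_add_left_eq_self (μ := (volume : Measure (E d)))
        (fun y => B.indicator (fun _ => ‖φ y - φ x‖ₑ ^ 2) y) x, ← lintegral_indicator hBm]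
      rfl
    · simp [hg, hx]
  rw [e1, lintegral_lintegral_swap hgm.aemeasurable]
  have e2 : ∀ w, ∫⁻ x, g (x, w) ≤ (Metric.ball (0 : E d) (2 * ρ)).indicator
      (fun _ => ENNReal.ofReal (2 * ρ) ^ 2 * dirichlet Ω φ) w := by
    intro w
    set S : Set (E d) := B ∩ (fun x => x + w) ⁻¹' B with hS
    have hSm : MeasurableSet S := hBm.inter ((by fun_prop : Measurable fun x => x + w) hBm)
    have h1 : ∫⁻ x, g (x, w) = ∫⁻ x in S, ‖φ (x + w) - φ x‖ₑ ^ 2 := by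
      rw [← lintegral_indicator hSm]
      refine lintegral_congr fun x => ?_
      by_cases h1 : x ∈ B <;> by_cases h2 : x + w ∈ B <;> simp [hg, hS, h1, h2]
    rw [h1]
    by_cases hw : w ∈ Metric.ball (0 : E d) (2 * ρ)
    · rw [indicator_of_mem hw]
      refine (lintegral_translate_sub_sq_le hΩ hSm ?_ hφ).trans ?_
      · intro x hx τ hτ
        refine hB ?_
        have := (convex_ball x₀ ρ) hx.1 hx.2 (sub_nonneg.2 hτ.2) hτ.1.le (sub_add_cancel 1 τ)
        convert this using 1
        rw [smul_add, ← add_assoc, ← add_smul, sub_add_cancel, one_smul]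
      · gcongr
        rw [mem_ball_zero_iff] at hw
        rw [← ofReal_norm]
        exact ENNReal.ofReal_le_ofReal hw.le
    · have : S = ∅ := by
        rw [eq_empty_iff_forall_notMem]
        rintro x ⟨hx1, hx2⟩
        apply hw
        rw [hBdef, mem_ball_iff_norm] at hx1
        rw [mem_preimage, hBdef, mem_ball_iff_norm] at hx2
        rw [mem_ball_zero_iff]
        have h3 : w = (x + w - x₀) - (x - x₀) := by abel
        rw [h3]
        linarith [norm_sub_le (x + w - x₀) (x - x₀)]
      rw [this]
      simp
  refine (lintegral_mono e2).trans_eq ?_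
  rw [lintegral_indicator Metric.isOpen_ball.measurableSet, setLIntegral_const]
  ring

/-- Compare φ(x) with its ν-mean: domination of `ν` by Lebesgue measure reduces the deviation to the
double integral of increments. It is used with `ν` concentrated on a subset and with `ν` obtained by
smearing out a boundary piece. -/
theorem exists_ball_sq_le_of_measure (hΩ : IsOpen Ω) {x₀ : E d} {ρ : ℝ}
    (hB : Metric.ball x₀ ρ ⊆ Ω) {ν : Measure (E d)} {c : NNReal}
    (hν : ν ≤ (c : ℝ≥0∞) • volume.restrict (Metric.ball x₀ ρ)) (hν0 : ν univ ≠ 0) :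
    ∃ C : NNReal, ∀ φ : E d → ℝ, ContDiff ℝ ∞ φ →
      ∫⁻ x in Metric.ball x₀ ρ, ‖φ x‖ₑ ^ 2 ≤ C * (dirichlet Ω φ + (∫⁻ y, ‖φ y‖ₑ ∂ν) ^ 2) := by
  set B := Metric.ball x₀ ρ with hBdef
  have hVt : volume B ≠ ⊤ := measure_ball_lt_top.ne
  obtain ⟨C₁, hC₁⟩ := exists_ball_sub_sq_le hΩ hB
  set c₀ := ν univ with hc₀
  have hc₀t : c₀ ≠ ⊤ := by
    refine ne_top_of_le_ne_top ?_ (hν univ)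
    rw [Measure.smul_apply, Measure.restrict_apply_univ, smul_eq_mul]
    finiteness
  have hinv : (c₀ ^ 2)⁻¹ ≠ ⊤ := by simp [hν0]
  set A : ℝ≥0∞ := 2 * (c₀ * (c * C₁)) + 2 * volume B with hA
  have hAt : A ≠ ⊤ := by finiteness
  refine ⟨((c₀ ^ 2)⁻¹ * A).toNNReal, fun φ hφ => ?_⟩
  rw [ENNReal.coe_toNNReal (by finiteness)]
  set M := ∫⁻ y, ‖φ y‖ₑ ∂ν with hM
  have hφm := hφ.continuous.measurable
  have hpt : ∀ x, c₀ ^ 2 * ‖φ x‖ₑ ^ 2 ≤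
      2 * (c₀ * (c * ∫⁻ y in B, ‖φ y - φ x‖ₑ ^ 2)) + 2 * M ^ 2 := by
    intro x
    have h1 : c₀ * ‖φ x‖ₑ ≤ (∫⁻ y, ‖φ y - φ x‖ₑ ∂ν) + M := by
      rw [hM, ← lintegral_add_left (by fun_prop), mul_comm, ← lintegral_const]
      refine lintegral_mono fun y => ?_
      have : φ x = -(φ y - φ x) + φ y := by ring
      conv_lhs => rw [this]
      refine (enorm_add_le _ _).trans ?_
      rw [enorm_neg]
    calc c₀ ^ 2 * ‖φ x‖ₑ ^ 2 = (c₀ * ‖φ x‖ₑ) ^ 2 := by ring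
      _ ≤ ((∫⁻ y, ‖φ y - φ x‖ₑ ∂ν) + M) ^ 2 := by gcongr
      _ ≤ 2 * (∫⁻ y, ‖φ y - φ x‖ₑ ∂ν) ^ 2 + 2 * M ^ 2 := ennreal_add_sq_le _ _
      _ ≤ 2 * (c₀ * ∫⁻ y, ‖φ y - φ x‖ₑ ^ 2 ∂ν) + 2 * M ^ 2 := by
          gcongr
          exact lintegral_sq_le (by fun_prop)
      _ ≤ _ := by
          gcongr
          refine (lintegral_mono' hν le_rfl).trans_eq ?_
          rw [lintegral_smul_measure, smul_eq_mul]
  have hmeas : Measurable fun x => ∫⁻ y in B, ‖φ y - φ x‖ₑ ^ 2 :=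
    Measurable.lintegral_prod_right' (f := fun q : E d × E d => ‖φ q.2 - φ q.1‖ₑ ^ 2)
      (by fun_prop)
  have hI : c₀ ^ 2 * ∫⁻ x in B, ‖φ x‖ₑ ^ 2 ≤ A * (dirichlet Ω φ + M ^ 2) := by
    rw [← lintegral_const_mul _ (by fun_prop)]
    refine (lintegral_mono hpt).trans ?_
    rw [lintegral_add_right _ measurable_const, lintegral_const_mul _ (by fun_prop),
      lintegral_const_mul _ (by fun_prop), lintegral_const_mul _ hmeas, setLIntegral_const]
    calc _ ≤ 2 * (c₀ * (c * (C₁ * dirichlet Ω φ))) + 2 * M ^ 2 * volume B := by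
          gcongr
          exact hC₁ φ hφ
      _ ≤ A * dirichlet Ω φ + A * M ^ 2 := by
          refine add_le_add ?_ ?_
          · calc _ = (2 * (c₀ * (c * C₁))) * dirichlet Ω φ := by ring
              _ ≤ _ := by gcongr; exact le_self_add
          · calc _ = (2 * volume B) * M ^ 2 := by ring
              _ ≤ _ := by gcongr; exact le_add_self
      _ = _ := by ring
  calc _ = (c₀ ^ 2)⁻¹ * (c₀ ^ 2 * ∫⁻ x in B, ‖φ x‖ₑ ^ 2) := by
        rw [← mul_assoc, ENNReal.inv_mul_cancel (by simpa using hν0) (by finiteness), one_mul]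
    _ ≤ (c₀ ^ 2)⁻¹ * (A * (dirichlet Ω φ + M ^ 2)) := by gcongr
    _ = _ := by ring

/-- The `L²`-norm of smooth functions on `S ∩ Ω` is controlled by the Dirichlet integral and the
`L¹`-norm on the boundary part `γ`. -/
def Controlled (Ω γ S : Set (E d)) : Prop :=
  ∃ C : NNReal, ∀ φ : E d → ℝ, ContDiff ℝ ∞ φ →
    ∫⁻ x in S ∩ Ω, ‖φ x‖ₑ ^ 2 ≤ C * (dirichlet Ω φ + (∫⁻ p in γ, ‖φ p‖ₑ ∂(surf d)) ^ 2)

theorem Controlled.mono {S S' : Set (E d)} (h : Controlled Ω γ S') (hS : S ⊆ S') :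
    Controlled Ω γ S := by
  obtain ⟨C, hC⟩ := h
  exact ⟨C, fun φ hφ => (lintegral_mono_set (inter_subset_inter_left _ hS)).trans (hC φ hφ)⟩

theorem Controlled.union {S S' : Set (E d)} (h : Controlled Ω γ S) (h' : Controlled Ω γ S') :
    Controlled Ω γ (S ∪ S') := by
  obtain ⟨C, hC⟩ := h
  obtain ⟨C', hC'⟩ := h'
  refine ⟨C + C', fun φ hφ => ?_⟩
  rw [union_inter_distrib_right]
  refine (lintegral_union_le _ _ _).trans ?_
  push_cast
  rw [add_mul]
  exact add_le_add (hC φ hφ) (hC' φ hφ)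

/-- Control spreads from a subset of positive volume to the surrounding ball, by comparison with the
mean over the subset. -/
theorem Controlled.ball_of_subset (hΩ : IsOpen Ω) {x₀ : E d} {ρ : ℝ}
    (hB : Metric.ball x₀ ρ ⊆ Ω) {A : Set (E d)} (hA : Controlled Ω γ A)
    (hAB : A ⊆ Metric.ball x₀ ρ) (hA0 : volume A ≠ 0) : Controlled Ω γ (Metric.ball x₀ ρ) := by
  obtain ⟨C, hC⟩ := hA
  have hAt : volume A ≠ ⊤ := ((measure_mono hAB).trans_lt measure_ball_lt_top).ne
  obtain ⟨C', hC'⟩ := exists_ball_sq_le_of_measure hΩ hB (ν := volume.restrict A) (c := 1)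
    (by rw [ENNReal.coe_one, one_smul]; exact Measure.restrict_mono hAB le_rfl) (by simpa using hA0)
  refine ⟨C' * (1 + (volume A).toNNReal * C), fun φ hφ => ?_⟩
  rw [inter_eq_left.2 hB]
  have h1 := hC φ hφ
  rw [inter_eq_left.2 (hAB.trans hB)] at h1
  refine (hC' φ hφ).trans ?_
  set N := dirichlet Ω φ + (∫⁻ p in γ, ‖φ p‖ₑ ∂(surf d)) ^ 2 with hN
  push_cast
  rw [ENNReal.coe_toNNReal hAt, mul_assoc]
  gcongr
  rw [add_mul, one_mul]
  refine add_le_add le_self_add ?_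
  have h2 := lintegral_sq_le (μ := volume.restrict A) (f := fun y => ‖φ y‖ₑ)
    hφ.continuous.enorm.aemeasurable
  rw [Measure.restrict_apply_univ] at h2
  refine h2.trans ?_
  rw [mul_assoc]
  gcongr

/-- Control passes back along a translation, since the increments are bounded by the Dirichlet
integral. This reaches the points near the boundary. -/
theorem Controlled.of_translate (hΩ : IsOpen Ω) {S : Set (E d)} (hS : MeasurableSet S) {w : E d}
    (hw : ∀ x ∈ S ∩ Ω, ∀ τ ∈ Ioc (0 : ℝ) 1, x + τ • w ∈ Ω) {S' : Set (E d)}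
    (hS' : Controlled Ω γ S') (hSS' : ∀ x ∈ S, x + w ∈ S') (hm : MeasurableSet S') :
    Controlled Ω γ S := by
  obtain ⟨C, hC⟩ := hS'
  refine ⟨2 * ‖w‖₊ ^ 2 + 2 * C, fun φ hφ => ?_⟩
  set N := dirichlet Ω φ + (∫⁻ p in γ, ‖φ p‖ₑ ∂(surf d)) ^ 2 with hN
  have hφm := hφ.continuous.measurable
  have hSΩ := hS.inter hΩ.measurableSet
  calc ∫⁻ x in S ∩ Ω, ‖φ x‖ₑ ^ 2
      ≤ ∫⁻ x in S ∩ Ω, (2 * ‖φ (x + w) - φ x‖ₑ ^ 2 + 2 * ‖φ (x + w)‖ₑ ^ 2) := by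
        refine lintegral_mono fun x => ?_
        have h1 := enorm_add_sq_le (-(φ (x + w) - φ x)) (φ (x + w))
        rw [enorm_neg] at h1
        refine le_trans (le_of_eq ?_) h1
        congr 2
        ring
    _ = 2 * (∫⁻ x in S ∩ Ω, ‖φ (x + w) - φ x‖ₑ ^ 2) +
        2 * ∫⁻ x in S ∩ Ω, ‖φ (x + w)‖ₑ ^ 2 := by
        rw [lintegral_add_left (by fun_prop), lintegral_const_mul _ (by fun_prop),
          lintegral_const_mul _ (by fun_prop)]
    _ ≤ 2 * (‖w‖ₑ ^ 2 * dirichlet Ω φ) + 2 * (C * N) := by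
        gcongr
        · exact lintegral_translate_sub_sq_le hΩ hSΩ hw hφ
        · refine le_trans ?_ (hC φ hφ)
          rw [← lintegral_indicator hSΩ, ← lintegral_indicator (hm.inter hΩ.measurableSet),
            ← lintegral_add_right_eq_self (μ := (volume : Measure (E d)))
              ((S' ∩ Ω).indicator fun x => ‖φ x‖ₑ ^ 2) w]
          refine lintegral_mono fun x => ?_
          by_cases hx : x ∈ S ∩ Ω
          · have h1 : x + w ∈ S' ∩ Ω := ⟨hSS' x hx.1, by
              have := hw x hx 1 ⟨zero_lt_one, le_rfl⟩
              rwa [one_smul] at this⟩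
            rw [indicator_of_mem hx, indicator_of_mem h1]
          · rw [indicator_of_notMem hx]
            exact zero_le
    _ ≤ (2 * ‖w‖₊ ^ 2 + 2 * C : NNReal) * N := by
        push_cast
        rw [add_mul, ← enorm_eq_nnnorm]
        have : dirichlet Ω φ ≤ N := le_self_add
        calc _ ≤ 2 * (‖w‖ₑ ^ 2 * N) + 2 * (C * N) := by gcongr
          _ = _ := by ring

end Insulation

/-! ### Propagation of the L² control from the boundary part to the whole domain -/

namespace Insulation

variable {d : ℕ} {Ω γ : Set (E d)}

/-- Push a small piece of `γ` into `Ω` along the chart direction: `ν` is the image of surface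
measure times Lebesgue measure under (p, s) ↦ p + s e. The graph estimate bounds `ν` by Lebesgue
measure, and the ν-mean of φ differs from its boundary mean by gradients along the segments. -/
theorem exists_controlled_ball (hΩ : IsLipDomain Ω) (hγ : IsBoundaryPart Ω γ)
    (hne : γ.Nonempty) :
    ∃ x₀ ρ, 0 < ρ ∧ Metric.ball x₀ ρ ⊆ Ω ∧ Controlled Ω γ (Metric.ball x₀ ρ) := by
  obtain ⟨U, hU, rfl⟩ := hγ
  obtain ⟨x, hxU, hx⟩ := hne
  obtain ⟨e, K, h, r, hc⟩ := hΩ.lipschitz.exists_chart hx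
  have hr := hc.pos
  have hxt : x + (r / 4) • e ∈ Ω := hc.add_smul_mem (by positivity) (Metric.mem_ball_self hr)
    (frontier_subset_closure hx)
    (hc.mem_ball_add_smul (by positivity) (Metric.mem_ball_self (half_pos hr)) (by linarith))
  obtain ⟨ρ₁, hρ₁, hB⟩ := Metric.isOpen_iff.1 hΩ.isOpen _ hxt
  obtain ⟨ρ₂, hρ₂, hU₂⟩ := Metric.isOpen_iff.1 hU _ hxU
  -- The first bound keeps the pushed piece in the ball of radius `ρ₁`, the second makes the piece a
  -- part of the given boundary part, the third keeps the segments within length `r / 2`.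
  obtain ⟨ρ, hρ, hρ1, hρ2, hρr⟩ : ∃ ρ > 0, ρ ≤ ρ₁ / 2 ∧ ρ ≤ ρ₂ ∧ ρ ≤ r / 4 :=
    ⟨min (ρ₁ / 2) (min ρ₂ (r / 4)), by positivity, min_le_left _ _,
      (min_le_right _ _).trans (min_le_left _ _), (min_le_right _ _).trans (min_le_right _ _)⟩
  set x₀ := x + (r / 4) • e with hx₀
  set B := Metric.ball x₀ ρ₁ with hBdef
  set Γ := frontier Ω ∩ Metric.ball x ρ with hΓ
  set J : Set ℝ := Ioc (r / 4) (r / 4 + ρ) with hJ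
  have hΓm : MeasurableSet Γ :=
    isClosed_frontier.measurableSet.inter Metric.isOpen_ball.measurableSet
  have hBm : MeasurableSet B := Metric.isOpen_ball.measurableSet
  have hΓU : Γ ⊆ U ∩ frontier Ω := fun p hp =>
    ⟨hU₂ (Metric.ball_subset_ball hρ2 hp.2), hp.1⟩
  have hΓr : Γ ⊆ frontier Ω ∩ Metric.ball x (r / 2) := fun p hp =>
    ⟨hp.1, Metric.ball_subset_ball (by linarith) hp.2⟩
  have hJr : J ⊆ Ioc 0 (r / 2) := fun s hs => ⟨by linarith [hs.1], by linarith [hs.2]⟩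
  have hmaps : ∀ p ∈ Γ, ∀ s ∈ J, p + s • e ∈ B := by
    intro p hp s hs
    have h1 := hp.2
    rw [hBdef, mem_ball_iff_norm]
    rw [mem_ball_iff_norm] at h1
    have h2 : p + s • e - x₀ = (p - x) + (s - r / 4) • e := by
      rw [hx₀, sub_smul]
      abel
    rw [h2]
    refine (norm_add_le _ _).trans_lt ?_
    rw [norm_smul, hc.unit, mul_one, Real.norm_of_nonneg (by linarith [hs.1])]
    linarith [hs.2]
  have hfin : surf d Γ ≠ ⊤ := ((measure_mono inter_subset_left).trans_lt
    (surf_frontier_lt_top hΩ.isOpen hΩ.isBounded hΩ.lipschitz)).ne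
  have hfm : IsFiniteMeasure ((surf d).restrict Γ) :=
    ⟨by rw [Measure.restrict_apply_univ]; exact hfin.lt_top⟩
  set κ : Measure (E d × ℝ) := ((surf d).restrict Γ).prod (volume.restrict J) with hκ
  have hpm : Measurable fun q : E d × ℝ => q.1 + q.2 • e := by fun_prop
  set ν := κ.map fun q => q.1 + q.2 • e with hνdef
  have hJv : volume J = ENNReal.ofReal ρ := by rw [hJ, Real.volume_Ioc, add_sub_cancel_left]
  have hκu : κ univ = surf d Γ * ENNReal.ofReal ρ := by
    rw [hκ, ← univ_prod_univ, Measure.prod_prod, Measure.restrict_apply_univ,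
      Measure.restrict_apply_univ, hJv]
  have hκt : κ univ ≠ ⊤ := by rw [hκu]; finiteness
  set c : NNReal := (1 + K) ^ (d - 1) with hcdef
  have hdouble : ∀ f : E d → ℝ≥0∞, Measurable f →
      ∫⁻ p in Γ, (∫⁻ s in Ioc 0 (r / 2), f (p + s • e)) ∂(surf d) ≤ c * ∫⁻ x in Ω, f x :=
    fun f hf => (lintegral_mono_set hΓr).trans (hc.lintegral_frontier_translates_le hΩ.isOpen hf)
  have hν : ν ≤ (c : ℝ≥0∞) • volume.restrict B := by
    refine Measure.le_iff.2 fun A hA => ?_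
    have hm := hBm.inter hA
    rw [hνdef, Measure.map_apply hpm hA, ← lintegral_indicator_one (hpm hA), hκ,
      lintegral_prod _ ((measurable_one.indicator (hpm hA)).aemeasurable), Measure.smul_apply,
      Measure.restrict_apply hA, smul_eq_mul]
    refine le_trans ?_ ((hdouble ((B ∩ A).indicator 1) (measurable_one.indicator hm)).trans ?_)
    · refine setLIntegral_mono_ae' hΓm (Eventually.of_forall fun p hp => ?_)
      refine le_trans ?_ (lintegral_mono_set hJr)
      refine setLIntegral_mono_ae' measurableSet_Ioc (Eventually.of_forall fun s hs => ?_)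
      by_cases hq : p + s • e ∈ A
      · rw [indicator_of_mem (show p + s • e ∈ B ∩ A from ⟨hmaps p hp s hs, hq⟩),
          indicator_of_mem (show (p, s) ∈ (fun q : E d × ℝ => q.1 + q.2 • e) ⁻¹' A from hq)]
        rfl
      · rw [indicator_of_notMem (show (p, s) ∉ (fun q : E d × ℝ => q.1 + q.2 • e) ⁻¹' A from hq)]
        exact zero_le
    · refine mul_le_mul_right ((setLIntegral_le_lintegral _ _).trans_eq ?_) _
      rw [lintegral_indicator_one hm, inter_comm]
  have hν0 : ν univ ≠ 0 := by
    rw [hνdef, Measure.map_apply hpm MeasurableSet.univ, preimage_univ, hκu]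
    refine mul_ne_zero (surf_frontier_inter_pos hΩ.isOpen hΩ.lipschitz hx Metric.isOpen_ball
      (Metric.mem_ball_self hρ)).ne' ?_
    simpa using hρ
  obtain ⟨C, hC⟩ := exists_ball_sq_le_of_measure hΩ.isOpen hB hν hν0
  set A₁ : ℝ≥0∞ := κ univ * (ENNReal.ofReal ρ * (ENNReal.ofReal (r / 2) * c)) with hA₁
  set A₂ : ℝ≥0∞ := ENNReal.ofReal ρ ^ 2 with hA₂
  have hA₁t : A₁ ≠ ⊤ := by finiteness
  have hA₂t : A₂ ≠ ⊤ := by finiteness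
  refine ⟨x₀, ρ₁, hρ₁, hB, C * (1 + 2 * A₁.toNNReal + 2 * A₂.toNNReal), fun φ hφ => ?_⟩
  rw [inter_eq_left.2 hB]
  refine (hC φ hφ).trans ?_
  push_cast
  rw [ENNReal.coe_toNNReal hA₁t, ENNReal.coe_toNNReal hA₂t, mul_assoc]
  refine mul_le_mul_right ?_ _
  have hφm := hφ.continuous.measurable
  set T := ∫⁻ p in U ∩ frontier Ω, ‖φ p‖ₑ ∂(surf d) with hT
  set D := dirichlet Ω φ with hD
  have hM : ∫⁻ y, ‖φ y‖ₑ ∂ν ≤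
      (∫⁻ q, ‖φ (q.1 + q.2 • e) - φ q.1‖ₑ ∂κ) + ENNReal.ofReal ρ * T := by
    rw [hνdef, lintegral_map (by fun_prop) hpm]
    calc _ ≤ ∫⁻ q, (‖φ (q.1 + q.2 • e) - φ q.1‖ₑ + ‖φ q.1‖ₑ) ∂κ := by
          refine lintegral_mono fun q => ?_
          conv_lhs => rw [← sub_add_cancel (φ (q.1 + q.2 • e)) (φ q.1)]
          exact enorm_add_le _ _
      _ = (∫⁻ q, ‖φ (q.1 + q.2 • e) - φ q.1‖ₑ ∂κ) + ∫⁻ q, ‖φ q.1‖ₑ ∂κ :=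
          lintegral_add_left (by fun_prop) _
      _ ≤ _ := by
          refine add_le_add_right ?_ _
          rw [hκ, lintegral_prod _ (by fun_prop)]
          simp only [lintegral_const, Measure.restrict_apply_univ, hJv]
          rw [lintegral_mul_const _ (by fun_prop), mul_comm]
          exact mul_le_mul_right (lintegral_mono_set hΓU) _
  have hG : (∫⁻ q, ‖φ (q.1 + q.2 • e) - φ q.1‖ₑ ∂κ) ^ 2 ≤ A₁ * D := by
    refine (lintegral_sq_le (by fun_prop)).trans ?_
    rw [hA₁, mul_assoc]
    refine mul_le_mul_right ?_ _
    have hgm := measurable_enorm_gradient_sq hφ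
    have hgm2 : Measurable fun p : E d =>
        ∫⁻ τ in Ioc 0 (r / 2), ‖gradient φ (p + τ • e)‖ₑ ^ 2 :=
      Measurable.lintegral_prod_right'
        (f := fun q : E d × ℝ => ‖gradient φ (q.1 + q.2 • e)‖ₑ ^ 2) (hgm.comp hpm)
    rw [hκ, lintegral_prod _ (by fun_prop)]
    calc _ ≤ ∫⁻ p in Γ, ENNReal.ofReal ρ * (ENNReal.ofReal (r / 2) *
            ∫⁻ τ in Ioc 0 (r / 2), ‖gradient φ (p + τ • e)‖ₑ ^ 2) ∂(surf d) := by
          refine lintegral_mono fun p => ?_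
          rw [mul_comm (ENNReal.ofReal ρ), ← hJv, ← setLIntegral_const]
          refine setLIntegral_mono_ae' measurableSet_Ioc (Eventually.of_forall fun s hs => ?_)
          have h1 := enorm_sub_sq_le_lintegral_gradient hφ p e (hJr hs).1.le (hJr hs).2
          rwa [← ofReal_norm e, hc.unit, ENNReal.ofReal_one, one_pow, mul_one] at h1
      _ ≤ _ := by
          rw [lintegral_const_mul _ (by fun_prop), lintegral_const_mul _ hgm2, mul_assoc, mul_assoc]
          refine mul_le_mul_right (mul_le_mul_right ?_ _) _
          exact hdouble _ hgm
  calc D + (∫⁻ y, ‖φ y‖ₑ ∂ν) ^ 2 ≤ D + (2 * (A₁ * D) + 2 * (A₂ * T ^ 2)) := by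
        refine add_le_add_right ?_ _
        refine (pow_le_pow_left' hM 2).trans ((ennreal_add_sq_le _ _).trans ?_)
        rw [mul_pow]
        exact add_le_add (mul_le_mul_right hG _) le_rfl
    _ ≤ (1 + 2 * A₁ + 2 * A₂) * D + (1 + 2 * A₁ + 2 * A₂) * T ^ 2 := by
        rw [← add_assoc]
        refine add_le_add ?_ ?_
        · calc _ = (1 + 2 * A₁) * D := by ring
            _ ≤ _ := mul_le_mul_left le_self_add _
        · rw [← mul_assoc]
          exact mul_le_mul_left le_add_self _
    _ = _ := by ring

/-- The points having a controlled ball form an open set which is relatively closed in `Ω`, hence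
all of `Ω` by connectedness. Boundary points are reached by translating a neighbourhood into `Ω`,
and compactness of the closure leaves finitely many pieces. -/
theorem controlled_closure (hΩ : IsLipDomain Ω) (hcon : IsConnected Ω) (hγ : IsBoundaryPart Ω γ)
    (hne : γ.Nonempty) : Controlled Ω γ (closure Ω) := by
  set u : Set (E d) := {x | ∃ ρ > 0, Metric.ball x ρ ⊆ Ω ∧ Controlled Ω γ (Metric.ball x ρ)} with hu
  have hsmall : ∀ {x y : E d} {ρ : ℝ}, Metric.ball x ρ ⊆ Ω → Controlled Ω γ (Metric.ball x ρ) →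
      y ∈ Metric.ball x ρ → y ∈ u := by
    intro x y ρ h1 h2 hy
    obtain ⟨ε, hε, hyε⟩ := Metric.isOpen_iff.1 Metric.isOpen_ball _ hy
    exact ⟨ε, hε, hyε.trans h1, h2.mono hyε⟩
  have hopen : IsOpen u := by
    refine isOpen_iff_mem_nhds.2 ?_
    rintro x ⟨ρ, hρ, h1, h2⟩
    exact mem_of_superset (Metric.ball_mem_nhds x hρ) fun y hy => hsmall h1 h2 hy
  have hΩu : Ω ⊆ u := by
    refine hcon.isPreconnected.subset_of_closure_inter_subset hopen ?_ ?_
    · obtain ⟨x₀, ρ, hρ, h1, h2⟩ := exists_controlled_ball hΩ hγ hne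
      exact ⟨x₀, h1 (Metric.mem_ball_self hρ), ρ, hρ, h1, h2⟩
    · rintro x ⟨hxu, hxΩ⟩
      obtain ⟨R, hR, hxR⟩ := Metric.isOpen_iff.1 hΩ.isOpen _ hxΩ
      obtain ⟨y, hy, ρ, hρ, h1, h2⟩ := mem_closure_iff.1 hxu _ Metric.isOpen_ball
        (Metric.mem_ball_self hR)
      refine ⟨R, hR, hxR, Controlled.ball_of_subset hΩ.isOpen hxR (h2.mono inter_subset_left)
        inter_subset_right ?_⟩
      exact ((Metric.isOpen_ball.inter Metric.isOpen_ball).measure_pos _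
        ⟨y, Metric.mem_ball_self hρ, hy⟩).ne'
  refine hΩ.isBounded.isCompact_closure.induction_on ⟨0, fun φ _ => by simp⟩
    (fun _ _ h1 h2 => h2.mono h1) (fun _ _ h1 h2 => h1.union h2) fun x hx => ?_
  by_cases hxΩ : x ∈ Ω
  · obtain ⟨ρ, hρ, -, h2⟩ := hΩu hxΩ
    exact ⟨_, mem_nhdsWithin_of_mem_nhds (Metric.ball_mem_nhds x hρ), h2⟩
  have hxf : x ∈ frontier Ω := by
    rw [hΩ.isOpen.frontier_eq]
    exact ⟨hx, hxΩ⟩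
  obtain ⟨e, K, h, r, hc⟩ := hΩ.lipschitz.exists_chart hxf
  have hr := hc.pos
  have hxt : x + (r / 4) • e ∈ Ω := hc.add_smul_mem (by positivity) (Metric.mem_ball_self hr) hx
    (hc.mem_ball_add_smul (by positivity) (Metric.mem_ball_self (half_pos hr)) (by linarith))
  obtain ⟨ρ, hρ, -, h2⟩ := hΩu hxt
  refine ⟨Metric.ball x (min ρ (r / 2)), mem_nhdsWithin_of_mem_nhds
    (Metric.ball_mem_nhds x (by positivity)), ?_⟩
  refine Controlled.of_translate hΩ.isOpen Metric.isOpen_ball.measurableSet (w := (r / 4) • e)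
    ?_ h2 ?_ Metric.isOpen_ball.measurableSet
  · rintro y ⟨hy, hyΩ⟩ τ hτ
    have hy' := Metric.ball_subset_ball (min_le_right ρ (r / 2)) hy
    have h1 : τ * (r / 4) ≤ r / 4 := mul_le_of_le_one_left (by positivity) hτ.2
    have h0 : 0 < τ * (r / 4) := mul_pos hτ.1 (by positivity)
    rw [smul_smul]
    exact hc.add_smul_mem h0 (Metric.ball_subset_ball (by linarith) hy') (subset_closure hyΩ)
      (hc.mem_ball_add_smul h0.le hy' (by linarith))
  · intro y hy
    rw [Metric.mem_ball, dist_add_right]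
    exact Metric.ball_subset_ball (min_le_left ρ (r / 2)) hy

/-- The Poincaré inequality. -/
theorem exists_poincare (hΩ : IsLipDomain Ω) (hcon : IsConnected Ω) (hγ : IsBoundaryPart Ω γ)
    (hne : γ.Nonempty) :
    ∃ C : ℝ, 0 ≤ C ∧ ∀ v : H1 Ω, ‖fn v‖ ^ 2 ≤ C * (‖grad Ω v‖ ^ 2 + bdNorm1 γ v ^ 2) := by
  obtain ⟨C, hC⟩ := controlled_closure hΩ hcon hγ hne
  refine ⟨C, C.2, fun v => ?_⟩
  rw [bdNorm1_eq hΩ hγ.subset]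
  refine H1_induction hΩ
    (P := fun v => ‖fn v‖ ^ 2 ≤ C * (‖grad Ω v‖ ^ 2 + ‖traceOne hΩ hγ.subset v‖ ^ 2)) ?_ ?_ v
  · have hfn : Continuous fun v : H1 Ω => fn v := (fnL Ω).continuous
    exact isClosed_le (by fun_prop) (by fun_prop)
  · intro φ hφ hc
    have h1 := hC φ hφ
    rw [inter_eq_right.2 subset_closure] at h1
    have e1 : ∫⁻ x in Ω, ‖φ x‖ₑ ^ 2 = ‖fn (smoothH1 Ω hφ hc)‖ₑ ^ 2 := by
      rw [enorm_sq_Lp]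
      refine lintegral_congr_ae ?_
      filter_upwards [fn_smoothH1 (Ω := Ω) hφ hc] with x hx
      rw [hx]
    have e2 : dirichlet Ω φ = ‖grad Ω (smoothH1 Ω hφ hc)‖ₑ ^ 2 := by
      rw [enorm_sq_Lp]
      refine lintegral_congr_ae ?_
      filter_upwards [grad_smoothH1 (Ω := Ω) hφ hc] with x hx
      rw [hx]
    have e3 : ∫⁻ p in γ, ‖φ p‖ₑ ∂(surf d) = ‖traceOne hΩ hγ.subset (smoothH1 Ω hφ hc)‖ₑ := by
      rw [Lp.enorm_def, eLpNorm_one_eq_lintegral_enorm]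
      refine lintegral_congr_ae ?_
      filter_upwards [coeFn_traceOne hΩ hγ.subset (smoothH1 Ω hφ hc),
        ae_restrict_of_subset hγ.subset (trace_smoothH1 hΩ hφ hc)] with x hx hx'
      rw [hx, hx']
    rw [e1, e2, e3] at h1
    simp only [enorm_eq_nnnorm] at h1
    exact_mod_cast h1

end Insulation

namespace Insulation

variable {d : ℕ} {Ω γ : Set (E d)}

/-! ### Compositions and cutoff functions -/

theorem norm_le_sqrt_of_enorm_sq_le {F : Type*} [NormedAddCommGroup F] {x : F} {R : ℝ≥0∞}
    (hR : R ≠ ⊤) (h : ‖x‖ₑ ^ 2 ≤ R) : ‖x‖ ≤ √R.toReal := by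
  refine Real.le_sqrt_of_sq_le ?_
  have := ENNReal.toReal_mono hR h
  rwa [ENNReal.toReal_pow, toReal_enorm] at this

theorem norm_smoothH1_comp_le {θ : ℝ → ℝ} (hθ : ContDiff ℝ ∞ θ) (hL : LipschitzWith 1 θ)
    (h0 : θ 0 = 0) {φ : E d → ℝ} (hφ : ContDiff ℝ ∞ φ) (hc : HasCompactSupport φ) :
    ‖smoothH1 Ω (hθ.comp hφ) (hc.comp_left h0)‖ ≤ ‖smoothH1 Ω hφ hc‖ := by
  have h1 : ∀ x, ‖(θ ∘ φ) x‖ₑ ≤ ‖φ x‖ₑ := fun x => by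
    have := hL.edist_le_mul (φ x) 0
    rwa [h0, edist_zero_right, edist_zero_right, ENNReal.coe_one, one_mul] at this
  have h2 : ∀ x, ‖gradient (θ ∘ φ) x‖ₑ ≤ ‖gradient φ x‖ₑ := fun x => by
    have hd : HasFDerivAt (θ ∘ φ) (deriv θ (φ x) • fderiv ℝ φ x) x :=
      ((hθ.differentiable (by simp)).differentiableAt.hasDerivAt).comp_hasFDerivAt x
        (hφ.differentiable (by simp)).differentiableAt.hasFDerivAt
    rw [← ofReal_norm, ← ofReal_norm, norm_gradient, norm_gradient, hd.fderiv, norm_smul]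
    refine ENNReal.ofReal_le_ofReal (mul_le_of_le_one_left (norm_nonneg _) ?_)
    simpa using norm_deriv_le_of_lipschitz (x₀ := φ x) hL
  have h3 : ‖smoothH1 Ω (hθ.comp hφ) (hc.comp_left h0)‖ₑ ^ 2 ≤ ‖smoothH1 Ω hφ hc‖ₑ ^ 2 := by
    rw [enorm_sq_smoothH1, enorm_sq_smoothH1, energy, energy]
    exact add_le_add (lintegral_mono fun x => pow_le_pow_left' (h1 x) 2)
      (lintegral_mono fun x => pow_le_pow_left' (h2 x) 2)
  refine (norm_le_sqrt_of_enorm_sq_le (by finiteness) h3).trans_eq ?_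
  rw [ENNReal.toReal_pow, toReal_enorm, Real.sqrt_sq (norm_nonneg _)]

/-- Compositions of smooth approximations of `w` are bounded in H¹, while they and their traces
converge in L², because composition with a Lipschitz function is continuous there. The weak limit is
the desired function, so no chain rule for `w` itself is needed. -/
theorem exists_comp_H1 (hΩ : IsLipDomain Ω) {θ : ℝ → ℝ} (hθ : ContDiff ℝ ∞ θ)
    (hL : LipschitzWith 1 θ) (h0 : θ 0 = 0) (w : H1 Ω) :
    ∃ x : H1 Ω, ‖x‖ ≤ ‖w‖ + 1 ∧ fn x =ᵐ[volume.restrict Ω] θ ∘ fn w ∧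
      trace x =ᵐ[(surf d).restrict (frontier Ω)] θ ∘ trace w := by
  obtain ⟨φ, hφ, hc, hlim⟩ := exists_seq_smooth hΩ w
  obtain ⟨N, hN⟩ := (hlim.norm.eventually (gt_mem_nhds (lt_add_one ‖w‖))).exists_forall_of_atTop
  -- Function and trace are combined in one Hilbert space, so that a single weak limit identifies
  -- both.
  let Z := WithLp 2 (L2 Ω × L2bd Ω)
  let P : (L2 Ω × L2bd Ω) →L[ℝ] Z :=
    ((WithLp.prodContinuousLinearEquiv 2 ℝ (L2 Ω) (L2bd Ω)).symm : (L2 Ω × L2bd Ω) →L[ℝ] Z)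
  let J : H1 Ω →L[ℝ] Z := P.comp ((fnL Ω).prod (traceL hΩ))
  -- The shift by `N` makes the bound `‖w‖ + 1` valid for every index.
  let x : ℕ → H1 Ω := fun n => smoothH1 Ω (hθ.comp (hφ (n + N))) ((hc (n + N)).comp_left h0)
  let Q : H1 Ω → Z := fun v => P (hL.compLp h0 (fn v), hL.compLp h0 (trace v))
  have hQ : Continuous Q := by
    refine P.continuous.comp (Continuous.prodMk ?_ ?_)
    · exact (hL.continuous_compLp h0).comp (fnL Ω).continuous
    · exact (hL.continuous_compLp h0).comp (traceL hΩ).continuous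
  have hJx : ∀ n, J (x n) = Q (smoothH1 Ω (hφ (n + N)) (hc (n + N))) := by
    intro n
    have e1 : fn (x n) = hL.compLp h0 (fn (smoothH1 Ω (hφ (n + N)) (hc (n + N)))) := by
      refine Lp.ext ?_
      filter_upwards [fn_smoothH1 (Ω := Ω) (hθ.comp (hφ (n + N))) ((hc (n + N)).comp_left h0),
        fn_smoothH1 (Ω := Ω) (hφ (n + N)) (hc (n + N)), hL.coeFn_compLp h0
          (fn (smoothH1 Ω (hφ (n + N)) (hc (n + N))))] with y h1 h2 h3
      rw [h1, h3, Function.comp_apply, Function.comp_apply, h2]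
    have e2 : trace (x n) = hL.compLp h0 (trace (smoothH1 Ω (hφ (n + N)) (hc (n + N)))) := by
      refine Lp.ext ?_
      filter_upwards [trace_smoothH1 hΩ (hθ.comp (hφ (n + N))) ((hc (n + N)).comp_left h0),
        trace_smoothH1 hΩ (hφ (n + N)) (hc (n + N)), hL.coeFn_compLp h0
          (trace (smoothH1 Ω (hφ (n + N)) (hc (n + N))))] with y h1 h2 h3
      rw [h1, h3, Function.comp_apply, Function.comp_apply, h2]
    change P (fn (x n), trace (x n)) = _
    rw [e1, e2]
  obtain ⟨y, -, hy, hJy⟩ := exists_mem_of_tendsto_of_bounded J (K := ⊤) isClosed_univ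
    (x := x) (fun _ => trivial) (C := ‖w‖ + 1)
    (fun n => (norm_smoothH1_comp_le hθ hL h0 _ _).trans (hN (n + N) (Nat.le_add_left _ _)).le)
    (a := Q w) (by
      simp only [hJx]
      exact (hQ.tendsto w).comp (hlim.comp (tendsto_add_atTop_nat N)))
  have hPi : (fn y, trace y) = (hL.compLp h0 (fn w), hL.compLp h0 (trace w)) :=
    (WithLp.prodContinuousLinearEquiv 2 ℝ (L2 Ω) (L2bd Ω)).symm.injective hJy
  obtain ⟨h1, h2⟩ := Prod.mk.injEq _ _ _ _ ▸ hPi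
  refine ⟨y, hy, ?_, ?_⟩
  · rw [h1]
    exact hL.coeFn_compLp h0 _
  · rw [h2]
    exact hL.coeFn_compLp h0 _

/-- Mollify, at scale δ/2, a 1/δ-Lipschitz function that is 0 within distance δ of `S` and 1 beyond
2δ. Averaging preserves the Lipschitz constant, and the slack between 2δ + δ/2 and 3δ leaves an open
set on which the result is constant. -/
theorem exists_cutoff (S : Set (E d)) {δ : ℝ} (hδ : 0 < δ) :
    ∃ η : E d → ℝ, ContDiff ℝ ∞ η ∧ (∀ x, |η x| ≤ 1) ∧ (∀ x, ‖gradient η x‖ ≤ δ⁻¹) ∧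
      (∀ x ∈ Metric.thickening (δ / 2) S, η x = 0) ∧
      ∀ x ∉ Metric.cthickening (3 * δ) S, η x = 1 ∧ gradient η x = 0 := by
  set g : E d → ℝ := fun x => 1 - (thickenedIndicator hδ (Metric.cthickening δ S) x : ℝ) with hg
  have hgL : LipschitzWith δ.toNNReal⁻¹ g := by
    have h1 : LipschitzWith (1 * δ.toNNReal⁻¹)
        (fun x => (thickenedIndicator hδ (Metric.cthickening δ S) x : ℝ)) :=
      (LipschitzWith.subtype_val _).comp (lipschitzWith_thickenedIndicator hδ _)
    have h2 := (LipschitzWith.const (1 : ℝ)).sub h1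
    rwa [one_mul, zero_add] at h2
  have hg01 : ∀ x, 0 ≤ g x ∧ g x ≤ 1 := fun x => by
    have h1 : (thickenedIndicator hδ (Metric.cthickening δ S) x : ℝ) ≤ 1 := by
      exact_mod_cast thickenedIndicator_le_one hδ _ x
    have h2 : 0 ≤ (thickenedIndicator hδ (Metric.cthickening δ S) x : ℝ) := NNReal.coe_nonneg _
    simp only [hg]
    constructor <;> linarith
  have hg0 : ∀ x ∈ Metric.cthickening δ S, g x = 0 := fun x hx => by
    rw [hg]
    simp only [thickenedIndicator_one hδ _ hx, NNReal.coe_one, sub_self]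
  have hg1 : ∀ x ∉ Metric.thickening (2 * δ) S, g x = 1 := fun x hx => by
    have : x ∉ Metric.thickening δ (Metric.cthickening δ S) := fun h => hx (by
      have := Metric.thickening_cthickening_subset δ hδ.le S h
      rwa [← two_mul] at this)
    rw [hg]
    simp only [thickenedIndicator_zero hδ _ this, NNReal.coe_zero, sub_zero]
  let k : ContDiffBump (0 : E d) := ⟨δ / 4, δ / 2, by positivity, by linarith⟩
  have hkc : HasCompactSupport (k.normed volume) := k.hasCompactSupport_normed
  set η := convolution (k.normed volume) g (ContinuousLinearMap.lsmul ℝ ℝ) volume with hη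
  have hηd : ContDiff ℝ ∞ η := hkc.contDiff_convolution_left _ k.contDiff_normed
    hgL.continuous.locallyIntegrable
  have hηapp : ∀ x, η x = ∫ t, k.normed volume t * g (x - t) := fun x => rfl
  have hkcont : Continuous (k.normed (volume : Measure (E d))) := k.continuous_normed
  have hinteg : ∀ x, Integrable fun t => k.normed volume t * g (x - t) := fun x =>
    Continuous.integrable_of_hasCompactSupport
      (hkcont.mul (hgL.continuous.comp (continuous_const.sub continuous_id))) hkc.mul_right
  have hηL : LipschitzWith δ.toNNReal⁻¹ η := by
    refine LipschitzWith.of_dist_le_mul fun x y => ?_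
    rw [Real.dist_eq, hηapp, hηapp, ← integral_sub (hinteg x) (hinteg y)]
    have h1 : ∫ t, k.normed volume t * (δ.toNNReal⁻¹ * dist x y) = δ.toNNReal⁻¹ * dist x y := by
      rw [integral_mul_const, k.integral_normed, one_mul]
    rw [← h1, ← Real.norm_eq_abs]
    refine norm_integral_le_of_norm_le (k.integrable_normed.mul_const _)
      (Eventually.of_forall fun t => ?_)
    rw [← mul_sub, norm_mul, Real.norm_of_nonneg (k.nonneg_normed t)]
    refine mul_le_mul_of_nonneg_left ?_ (k.nonneg_normed t)
    have := hgL.dist_le_mul (x - t) (y - t)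
    rwa [dist_sub_right, dist_eq_norm] at this
  have hη1 : ∀ x ∉ Metric.cthickening (3 * δ) S, η x = 1 := by
    intro x hx
    have hx2 : ∀ y ∈ Metric.ball x (δ / 2), g y = 1 := by
      intro y hy
      refine hg1 y fun hyS => hx ?_
      refine Metric.thickening_subset_cthickening _ _ ?_
      obtain ⟨z, hz, hyz⟩ := Metric.mem_thickening_iff.1 hyS
      refine Metric.mem_thickening_iff.2 ⟨z, hz, ?_⟩
      rw [Metric.mem_ball, dist_comm] at hy
      linarith [dist_triangle x y z]
    have hgx := hx2 x (Metric.mem_ball_self (by positivity))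
    rw [hη, k.normed_convolution_eq_right fun y hy => (hx2 y hy).trans hgx.symm, hgx]
  refine ⟨η, hηd, fun x => ?_, fun x => ?_, fun x hx => ?_, fun x hx => ⟨hη1 x hx, ?_⟩⟩
  · rw [hηapp, ← Real.norm_eq_abs, ← k.integral_normed (μ := (volume : Measure (E d)))]
    refine norm_integral_le_of_norm_le k.integrable_normed (Eventually.of_forall fun t => ?_)
    rw [norm_mul, Real.norm_of_nonneg (k.nonneg_normed t), Real.norm_of_nonneg (hg01 _).1]
    exact mul_le_of_le_one_right (k.nonneg_normed t) (hg01 _).2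
  · rw [norm_gradient]
    refine (norm_fderiv_le_of_lipschitz ℝ hηL).trans_eq ?_
    rw [NNReal.coe_inv, Real.coe_toNNReal _ hδ.le]
  · have hx2 : ∀ y ∈ Metric.ball x (δ / 2), g y = 0 := by
      intro y hy
      refine hg0 y (Metric.thickening_subset_cthickening _ _ ?_)
      obtain ⟨z, hz, hyz⟩ := Metric.mem_thickening_iff.1 hx
      refine Metric.mem_thickening_iff.2 ⟨z, hz, ?_⟩
      rw [Metric.mem_ball] at hy
      linarith [dist_triangle y x z]
    have hgx := hx2 x (Metric.mem_ball_self (by positivity))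
    rw [hη, k.normed_convolution_eq_right fun y hy => (hx2 y hy).trans hgx.symm, hgx]
  · have h1 : η =ᶠ[𝓝 x] fun _ => 1 := by
      filter_upwards [Metric.isClosed_cthickening.isOpen_compl.mem_nhds hx] with y hy
      exact hη1 y hy
    rw [h1.gradient_eq]
    simp [gradient]

theorem exists_smooth_urysohn {A B : Set (E d)} (hA : IsClosed A) (hB : IsClosed B)
    (hAB : Disjoint A B) :
    ∃ χ : E d → ℝ, ContDiff ℝ ∞ χ ∧ (∀ x ∈ A, χ x = 0) ∧ ∀ x ∈ B, χ x = 1 := by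
  obtain ⟨f, h0, h1, -⟩ := exists_contMDiffMap_zero_one_of_isClosed (n := ⊤)
    (modelWithCornersSelf ℝ (E d)) hA hB hAB
  exact ⟨f, f.contMDiff.contDiff, h0, h1⟩

end Insulation

namespace Insulation

variable {d : ℕ} {Ω γ ΓI ΓD ΓN : Set (E d)}

/-! ### Separation of boundary conditions -/

theorem tendsto_Lp_of_enorm_sub_sq {X F : Type*} [MeasurableSpace X] {μ : Measure X}
    [NormedAddCommGroup F] {u : ℕ → Lp F 2 μ} {a : Lp F 2 μ}
    (h : Tendsto (fun n => ‖u n - a‖ₑ ^ 2) atTop (𝓝 0)) : Tendsto u atTop (𝓝 a) := by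
  have h2 : Tendsto (fun n => (‖u n - a‖ₑ ^ 2) ^ (2⁻¹ : ℝ)) atTop (𝓝 (0 ^ (2⁻¹ : ℝ))) :=
    h.ennrpow_const _
  rw [ENNReal.zero_rpow_of_pos (by norm_num)] at h2
  rw [tendsto_iff_edist_tendsto_0]
  refine h2.congr fun n => ?_
  rw [edist_eq_enorm_sub, ← ENNReal.rpow_natCast, ← ENNReal.rpow_mul]
  norm_num

theorem mulH1_mem_H1zero (hΩ : IsLipDomain Ω) {ψ : E d → ℝ} (hψ : ContDiff ℝ ∞ ψ)
    (h0 : ∀ x ∈ γ, ψ x = 0) (v : H1 Ω) : mulH1 hΩ.isOpen hΩ.isBounded hψ v ∈ H1zero Ω γ := by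
  rw [mem_H1zero_iff hΩ]
  filter_upwards [trace_mulH1 hΩ hψ v] with x hx hxγ
  rw [hx, h0 x hxγ, zero_mul]

theorem mulH1_mem_H1zero_of_mem (hΩ : IsLipDomain Ω) {ψ : E d → ℝ} (hψ : ContDiff ℝ ∞ ψ)
    {v : H1 Ω} (hv : v ∈ H1zero Ω γ) : mulH1 hΩ.isOpen hΩ.isBounded hψ v ∈ H1zero Ω γ := by
  rw [mem_H1zero_iff hΩ] at hv ⊢
  filter_upwards [trace_mulH1 hΩ hψ v, hv] with x hx hx' hxγ
  rw [hx, hx' hxγ, mul_zero]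

/-- Splitting off the two boundary parts away from their common boundary. -/
theorem map_mulH1_eq_zero (hΩ : IsLipDomain Ω) {Φ : H1 Ω →L[ℝ] ℝ}
    (h1 : ∀ v ∈ H1zero Ω ΓD ⊓ H1zero Ω ΓN, Φ v = 0)
    (h2 : ∀ v ∈ H1zero Ω ΓI ⊓ H1zero Ω ΓD, Φ v = 0) {v : H1 Ω} (hv : v ∈ H1zero Ω ΓD)
    {η : E d → ℝ} (hη : ContDiff ℝ ∞ η) {δ : ℝ} (hδ : 0 < δ)
    (hη0 : ∀ x ∈ Metric.thickening δ (closure ΓI ∩ closure ΓN), η x = 0) :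
    Φ (mulH1 hΩ.isOpen hΩ.isBounded hη v) = 0 := by
  set V := Metric.thickening δ (closure ΓI ∩ closure ΓN) with hV
  have hVo : IsOpen V := Metric.isOpen_thickening
  -- Outside `V` the closures of `ΓI` and `ΓN` are disjoint, and inside `V` the cutoff `η` vanishes.
  -- So `χ η v` vanishes on `ΓN`, `(1 - χ) η v` vanishes on `ΓI`, and both inherit the zero values
  -- on `ΓD`.
  obtain ⟨χ, hχ, hχ0, hχ1⟩ := exists_smooth_urysohn (A := closure ΓN \ V) (B := closure ΓI \ V)
    (isClosed_closure.sdiff hVo) (isClosed_closure.sdiff hVo)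
    (disjoint_left.2 fun x hx hx' =>
      hx.2 (Metric.self_subset_thickening hδ _ ⟨hx'.1, hx.1⟩))
  have hs1 : ContDiff ℝ ∞ fun x => χ x * η x := hχ.mul hη
  have hs2 : ContDiff ℝ ∞ fun x => (1 - χ x) * η x := (contDiff_const.sub hχ).mul hη
  have hsum : mulH1 hΩ.isOpen hΩ.isBounded hη v =
      mulH1 hΩ.isOpen hΩ.isBounded hs1 v + mulH1 hΩ.isOpen hΩ.isBounded hs2 v := by
    refine fn_injective hΩ.isOpen (Lp.ext ?_)
    rw [fn_add]
    filter_upwards [fn_mulH1 hΩ.isOpen hΩ.isBounded hη v, fn_mulH1 hΩ.isOpen hΩ.isBounded hs1 v,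
      fn_mulH1 hΩ.isOpen hΩ.isBounded hs2 v,
      Lp.coeFn_add (fn (mulH1 hΩ.isOpen hΩ.isBounded hs1 v))
        (fn (mulH1 hΩ.isOpen hΩ.isBounded hs2 v))] with x e1 e2 e3 e4
    rw [e1, e4, Pi.add_apply, e2, e3]
    ring
  rw [hsum, map_add, h1 _ ⟨mulH1_mem_H1zero_of_mem hΩ hs1 hv, mulH1_mem_H1zero hΩ hs1 ?_ v⟩,
    h2 _ ⟨mulH1_mem_H1zero hΩ hs2 ?_ v, mulH1_mem_H1zero_of_mem hΩ hs2 hv⟩, add_zero]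
  · intro x hx
    by_cases hxV : x ∈ V
    · rw [hη0 x hxV, mul_zero]
    · rw [hχ1 x ⟨subset_closure hx, hxV⟩, sub_self, zero_mul]
  · intro x hx
    by_cases hxV : x ∈ V
    · rw [hη0 x hxV, mul_zero]
    · rw [hχ0 x ⟨subset_closure hx, hxV⟩, zero_mul]

/-- The tubes around `S` have quadratically decaying volume, as is the case for finite unions of
pieces of codimension two. -/
def SmallTubes (S : Set (E d)) : Prop :=
  ∃ C : NNReal, ∀ n : ℕ, volume (Metric.cthickening (3 * ((n : ℝ) + 1)⁻¹) S) ≤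
    C * (ENNReal.ofReal ((n : ℝ) + 1)⁻¹) ^ 2

/-- The cutoffs have gradients of order n on tubes of volume O(n⁻²), so for bounded `v` the products
stay bounded in H¹ while converging to `v` in L². The kernel of `Φ` is a closed subspace and thus
contains the weak limit. -/
theorem map_eq_zero_of_bounded (hΩ : IsLipDomain Ω)
    (hS : SmallTubes (closure ΓI ∩ closure ΓN)) {Φ : H1 Ω →L[ℝ] ℝ}
    (h1 : ∀ v ∈ H1zero Ω ΓD ⊓ H1zero Ω ΓN, Φ v = 0)
    (h2 : ∀ v ∈ H1zero Ω ΓI ⊓ H1zero Ω ΓD, Φ v = 0) {v : H1 Ω} (hv : v ∈ H1zero Ω ΓD)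
    {k : NNReal} (hk : ∀ᵐ x ∂(volume.restrict Ω), ‖fn v x‖ₑ ≤ k) : Φ v = 0 := by
  obtain ⟨C, hC⟩ := hS
  set S := closure ΓI ∩ closure ΓN with hSdef
  have hδ : ∀ n : ℕ, 0 < ((n : ℝ) + 1)⁻¹ := fun n => by positivity
  choose η hη hη1 hηg hη0 hηe using fun n : ℕ => exists_cutoff S (hδ n)
  set T : ℕ → Set (E d) := fun n => Metric.cthickening (3 * ((n : ℝ) + 1)⁻¹) S with hT
  have hTm : ∀ n, MeasurableSet (T n) := fun n => Metric.isClosed_cthickening.measurableSet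
  let x : ℕ → H1 Ω := fun n => mulH1 hΩ.isOpen hΩ.isBounded (hη n) v
  have hΦx : ∀ n, x n ∈ LinearMap.ker (Φ : H1 Ω →ₗ[ℝ] ℝ) := fun n =>
    map_mulH1_eq_zero hΩ h1 h2 hv (hη n) (half_pos (hδ n)) (hη0 n)
  have hηe' : ∀ n y, ‖η n y‖ₑ ≤ 1 := fun n y => by
    rw [← ofReal_norm, Real.norm_eq_abs]
    exact ENNReal.ofReal_le_one.2 (hη1 n y)
  have hlim : Tendsto (fun n => fnL Ω (x n)) atTop (𝓝 (fn v)) := by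
    refine tendsto_Lp_of_enorm_sub_sq ?_
    have hle : ∀ n, ‖fnL Ω (x n) - fn v‖ₑ ^ 2 ≤
        (2 * k) ^ 2 * (C * ENNReal.ofReal ((n : ℝ) + 1)⁻¹ ^ 2) := by
      intro n
      rw [enorm_sq_Lp]
      refine le_trans ?_ (mul_le_mul_right (hC n) _)
      calc ∫⁻ y in Ω, ‖(fnL Ω (x n) - fn v) y‖ₑ ^ 2
          ≤ ∫⁻ y in Ω, (T n).indicator (fun _ => (2 * (k : ℝ≥0∞)) ^ 2) y := by
            refine lintegral_mono_ae ?_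
            filter_upwards [Lp.coeFn_sub (fnL Ω (x n)) (fn v),
              fn_mulH1 hΩ.isOpen hΩ.isBounded (hη n) v, hk] with y e1 e2 e3
            have e4 : (fnL Ω (x n) - fn v) y = (η n y - 1) * fn v y := by
              rw [e1, Pi.sub_apply, fnL_apply, e2]
              ring
            rw [e4]
            by_cases hy : y ∈ T n
            · rw [indicator_of_mem hy, enorm_mul]
              refine pow_le_pow_left' (mul_le_mul' ?_ e3) 2
              refine (enorm_sub_le).trans ?_
              rw [enorm_one, ← one_add_one_eq_two]
              exact add_le_add (hηe' n y) le_rfl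
            · rw [indicator_of_notMem hy, (hηe n y hy).1]
              simp
        _ ≤ ∫⁻ y, (T n).indicator (fun _ => (2 * (k : ℝ≥0∞)) ^ 2) y :=
            setLIntegral_le_lintegral _ _
        _ = _ := by rw [lintegral_indicator (hTm n), setLIntegral_const]
    have h0 : Tendsto (fun n : ℕ => (2 * (k : ℝ≥0∞)) ^ 2 *
        (C * ENNReal.ofReal ((n : ℝ) + 1)⁻¹ ^ 2)) atTop (𝓝 0) := by
      have e1 : Tendsto (fun n : ℕ => ((n : ℝ) + 1)⁻¹) atTop (𝓝 0) := by
        simpa only [one_div] using tendsto_one_div_add_atTop_nhds_zero_nat (𝕜 := ℝ)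
      have e2 := ENNReal.tendsto_ofReal e1
      have e3 := ENNReal.Tendsto.const_mul (a := (2 * (k : ℝ≥0∞)) ^ 2) (ENNReal.Tendsto.const_mul
        (a := (C : ℝ≥0∞)) (ENNReal.Tendsto.pow (n := 2) e2) (Or.inr (by finiteness)))
        (Or.inr (by finiteness))
      simpa using e3
    exact tendsto_of_tendsto_of_tendsto_of_le_of_le tendsto_const_nhds h0
      (fun n => zero_le) hle
  -- The last term is the contribution of v ∇η: at most k(n + 1) on a tube of volume at most C/(n +
  -- 1)².
  set R : ℝ≥0∞ := ‖fn v‖ₑ ^ 2 + (2 * ‖grad Ω v‖ₑ ^ 2 + 2 * ((k : ℝ≥0∞) ^ 2 * C)) with hR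
  have hRt : R ≠ ⊤ := by finiteness
  have hbound : ∀ n, ‖x n‖ ≤ √R.toReal := by
    intro n
    refine norm_le_sqrt_of_enorm_sq_le hRt ?_
    rw [enorm_sq_H1, hR]
    refine add_le_add ?_ ?_
    · rw [enorm_sq_Lp, enorm_sq_Lp]
      refine lintegral_mono_ae ?_
      filter_upwards [fn_mulH1 hΩ.isOpen hΩ.isBounded (hη n) v] with y e2
      rw [e2, enorm_mul]
      exact pow_le_pow_left' (mul_le_of_le_one_left' (hηe' n y)) 2
    · have hm : Measurable fun y => 2 * (T n).indicator
          (fun _ => (k * ENNReal.ofReal ((n : ℝ) + 1)) ^ 2) y :=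
        (measurable_const.indicator (hTm n)).const_mul 2
      calc ‖grad Ω (x n)‖ₑ ^ 2 = ∫⁻ y in Ω, ‖grad Ω (x n) y‖ₑ ^ 2 := enorm_sq_Lp _
        _ ≤ ∫⁻ y in Ω, (2 * ‖grad Ω v y‖ₑ ^ 2 + 2 * (T n).indicator
              (fun _ => (k * ENNReal.ofReal ((n : ℝ) + 1)) ^ 2) y) := by
            refine lintegral_mono_ae ?_
            filter_upwards [grad_mulH1 hΩ.isOpen hΩ.isBounded (hη n) v, hk] with y e1 e2
            rw [e1]
            refine (enorm_add_sq_le _ _).trans (add_le_add ?_ ?_)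
            · rw [enorm_smul]
              gcongr
              exact mul_le_of_le_one_left' (hηe' n y)
            · refine mul_le_mul_right ?_ _
              by_cases hy : y ∈ T n
              · rw [indicator_of_mem hy, enorm_smul]
                refine pow_le_pow_left' (mul_le_mul' e2 ?_) 2
                rw [← ofReal_norm]
                refine ENNReal.ofReal_le_ofReal ((hηg n y).trans_eq (inv_inv _))
              · rw [indicator_of_notMem hy, (hηe n y hy).2]
                simp
        _ = 2 * ‖grad Ω v‖ₑ ^ 2 + 2 * ∫⁻ y in Ω, (T n).indicator
              (fun _ => (k * ENNReal.ofReal ((n : ℝ) + 1)) ^ 2) y := by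
            rw [lintegral_add_right _ hm, lintegral_const_mul' _ _ (by simp),
              lintegral_const_mul' _ _ (by simp), enorm_sq_Lp]
        _ ≤ _ := by
            refine add_le_add le_rfl (mul_le_mul_right ((setLIntegral_le_lintegral _ _).trans ?_) _)
            rw [lintegral_indicator (hTm n), setLIntegral_const, mul_pow, mul_assoc]
            refine mul_le_mul_right ((mul_le_mul_right (hC n) _).trans_eq ?_) _
            rw [mul_left_comm, ← mul_pow, ← ENNReal.ofReal_mul (by positivity),
              mul_inv_cancel₀ (by positivity), ENNReal.ofReal_one, one_pow, mul_one]
  obtain ⟨y, hy, -, hyv⟩ := exists_mem_of_tendsto_of_bounded (fnL Ω) Φ.isClosed_ker hΦx hbound hlim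
  rw [← fn_injective hΩ.isOpen hyv]
  exact hy

theorem tendsto_mul_sin_div (s : ℝ) :
    Tendsto (fun n : ℕ => ((n : ℝ) + 1) * Real.sin (s / ((n : ℝ) + 1))) atTop (𝓝 s) := by
  have e1 : Tendsto (fun n : ℕ => ((n : ℝ) + 1)⁻¹) atTop (𝓝 0) := by
    simpa only [one_div] using tendsto_one_div_add_atTop_nhds_zero_nat (𝕜 := ℝ)
  have e2 : Tendsto (fun n : ℕ => s * Real.sinc (s * ((n : ℝ) + 1)⁻¹)) atTop (𝓝 (s * 1)) := by
    refine Tendsto.const_mul s ?_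
    have := (Real.continuous_sinc.tendsto 0).comp (by simpa using e1.const_mul s)
    rwa [Real.sinc_zero] at this
  rw [mul_one] at e2
  refine e2.congr fun n => ?_
  have hn : (n : ℝ) + 1 ≠ 0 := by positivity
  rcases eq_or_ne s 0 with rfl | hs
  · simp
  · rw [Real.sinc_of_ne_zero (by positivity)]
    field_simp

/-- A functional on `H¹(Ω)` that vanishes on the functions vanishing on `ΓD` and in addition on `ΓN`
or on `ΓI` vanishes on all functions vanishing on `ΓD`. -/
theorem map_eq_zero_of_separate (hΩ : IsLipDomain Ω)
    (hS : SmallTubes (closure ΓI ∩ closure ΓN)) {Φ : H1 Ω →L[ℝ] ℝ}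
    (h1 : ∀ v ∈ H1zero Ω ΓD ⊓ H1zero Ω ΓN, Φ v = 0)
    (h2 : ∀ v ∈ H1zero Ω ΓI ⊓ H1zero Ω ΓD, Φ v = 0) {v : H1 Ω} (hv : v ∈ H1zero Ω ΓD) :
    Φ v = 0 := by
  -- A smooth substitute for truncation: bounded by n + 1, 1-Lipschitz, convergent to the identity,
  -- and zero at 0, so that the boundary condition on `ΓD` survives.
  let θ : ℕ → ℝ → ℝ := fun n s => ((n : ℝ) + 1) * Real.sin (s / ((n : ℝ) + 1))
  have hθ : ∀ n, ContDiff ℝ ∞ (θ n) := fun n =>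
    contDiff_const.mul (Real.contDiff_sin.comp (contDiff_id.div_const _))
  have hθ0 : ∀ n, θ n 0 = 0 := fun n => by simp [θ]
  have hθL : ∀ n, LipschitzWith 1 (θ n) := by
    intro n
    refine lipschitzWith_of_nnnorm_deriv_le ((hθ n).differentiable (by simp)) fun s => ?_
    have hn : (n : ℝ) + 1 ≠ 0 := by positivity
    have hd : HasDerivAt (θ n) (((n : ℝ) + 1) * (Real.cos (s / ((n : ℝ) + 1)) *
        (1 / ((n : ℝ) + 1)))) s :=
      (((hasDerivAt_id s).div_const _).sin).const_mul _
    rw [hd.deriv, ← NNReal.coe_le_coe, coe_nnnorm, NNReal.coe_one, Real.norm_eq_abs]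
    have e : ((n : ℝ) + 1) * (Real.cos (s / ((n : ℝ) + 1)) * (1 / ((n : ℝ) + 1))) =
        Real.cos (s / ((n : ℝ) + 1)) := by field_simp
    rw [e]
    exact Real.abs_cos_le_one _
  choose x hxn hxf hxt using fun n => exists_comp_H1 hΩ (hθ n) (hθL n) (hθ0 n) v
  have hΦx : ∀ n, x n ∈ LinearMap.ker (Φ : H1 Ω →ₗ[ℝ] ℝ) := by
    intro n
    refine map_eq_zero_of_bounded hΩ hS h1 h2 (v := x n) ?_ (k := n + 1) ?_
    · rw [mem_H1zero_iff hΩ] at hv ⊢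
      filter_upwards [hxt n, hv] with y hy hy' hyD
      rw [hy, Function.comp_apply, hy' hyD, hθ0]
    · filter_upwards [hxf n] with y hy
      rw [hy, Function.comp_apply, ← ofReal_norm, ENNReal.ofReal_le_iff_le_toReal (by finiteness)]
      simp only [θ, norm_mul, Real.norm_eq_abs]
      have e1 : |(n : ℝ) + 1| = n + 1 := abs_of_pos (by positivity)
      rw [e1]
      push_cast
      rw [ENNReal.toReal_add (by finiteness) (by finiteness), ENNReal.toReal_natCast,
        ENNReal.toReal_one]
      exact mul_le_of_le_one_right (by positivity) (Real.abs_sin_le_one _)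
  have hlim : Tendsto (fun n => fnL Ω (x n)) atTop (𝓝 (fn v)) := by
    refine tendsto_Lp_of_enorm_sub_sq ?_
    have e0 : ∀ n, ‖fnL Ω (x n) - fn v‖ₑ ^ 2 = ∫⁻ y in Ω, ‖θ n (fn v y) - fn v y‖ₑ ^ 2 := by
      intro n
      rw [enorm_sq_Lp]
      refine lintegral_congr_ae ?_
      filter_upwards [Lp.coeFn_sub (fnL Ω (x n)) (fn v), hxf n] with y e1 e2
      rw [e1, Pi.sub_apply, fnL_apply, e2, Function.comp_apply]
    simp only [e0]
    have hm := (Lp.aestronglyMeasurable (fn v)).aemeasurable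
    have e1 := tendsto_lintegral_of_dominated_convergence' (μ := volume.restrict Ω)
      (F := fun n y => ‖θ n (fn v y) - fn v y‖ₑ ^ 2) (f := fun _ => 0)
      (fun y => 2 * ‖fn v y‖ₑ ^ 2 + 2 * ‖fn v y‖ₑ ^ 2)
      (fun n => ((((hθ n).continuous.measurable.comp_aemeasurable hm).sub hm).enorm.pow_const 2))
      (fun n => Eventually.of_forall fun y => ?_) ?_ (Eventually.of_forall fun y => ?_)
    · simpa using e1
    · have e2 : ‖θ n (fn v y)‖ₑ ≤ ‖fn v y‖ₑ := by
        have := (hθL n).edist_le_mul (fn v y) 0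
        rwa [hθ0, edist_zero_right, edist_zero_right, ENNReal.coe_one, one_mul] at this
      have e3 := enorm_add_sq_le (θ n (fn v y)) (-fn v y)
      rw [enorm_neg, ← sub_eq_add_neg] at e3
      exact e3.trans (add_le_add (mul_le_mul_right (pow_le_pow_left' e2 2) _) le_rfl)
    · rw [lintegral_add_left' (by fun_prop), lintegral_const_mul' _ _ (by simp), ← enorm_sq_Lp]
      finiteness
    · have e2 := ENNReal.Tendsto.pow (n := 2)
        ((tendsto_mul_sin_div (fn v y)).sub_const (fn v y)).enorm
      simpa [θ] using e2
  obtain ⟨y, hy, -, hyv⟩ := exists_mem_of_tendsto_of_bounded (fnL Ω) Φ.isClosed_ker hΦx hxn hlim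
  rw [← fn_injective hΩ.isOpen hyv]
  exact hy

end Insulation

namespace Insulation

variable {d : ℕ} {Ω γ ΓI ΓD ΓN : Set (E d)}

/-! ### Tubes around simplices of codimension two -/

theorem SmallTubes.mono {S S' : Set (E d)} (h : SmallTubes S') (hS : S ⊆ S') : SmallTubes S := by
  obtain ⟨C, hC⟩ := h
  exact ⟨C, fun n => (measure_mono (Metric.cthickening_subset_of_subset _ hS)).trans (hC n)⟩

theorem SmallTubes.union {S S' : Set (E d)} (h : SmallTubes S) (h' : SmallTubes S') :
    SmallTubes (S ∪ S') := by
  obtain ⟨C, hC⟩ := h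
  obtain ⟨C', hC'⟩ := h'
  refine ⟨C + C', fun n => ?_⟩
  rw [Metric.cthickening_union, ENNReal.coe_add, add_mul]
  exact (measure_union_le _ _).trans (add_le_add (hC n) (hC' n))

theorem SmallTubes.biUnion {ι : Type*} {I : Set ι} (hI : I.Finite) {S : ι → Set (E d)}
    (h : ∀ i ∈ I, SmallTubes (S i)) : SmallTubes (⋃ i ∈ I, S i) := by
  induction I, hI using Set.Finite.induction_on with
  | empty => exact ⟨0, fun n => by simp⟩
  | @insert a I _ _ ih =>
    rw [biUnion_insert]
    exact (h a (mem_insert _ _)).union (ih fun i hi => h i (mem_insert_of_mem _ hi))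

/-- Rounding the barycentric coordinates of all vertices but one to multiples of δ = 1/(n + 1)
covers the tube by (n + 2)^(card - 1) balls of radius O(δ). Since card - 1 ≤ d - 2, their total
volume is O(δ²). -/
theorem smallTubes_convexHull {s : Finset (E d)} (hne : s.Nonempty) (hs : s.card < d) :
    SmallTubes (convexHull ℝ (s : Set (E d))) := by
  classical
  obtain ⟨v₀, hv₀⟩ := hne
  set s' := s.erase v₀ with hs'
  have hcard : s'.card + 1 = s.card := Finset.card_erase_add_one hv₀
  set R : ℝ := ∑ y ∈ s', ‖y - v₀‖ with hR
  have hR0 : 0 ≤ R := Finset.sum_nonneg fun _ _ => norm_nonneg _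
  set B := volume (Metric.ball (0 : E d) 1) with hB
  have hBt : B ≠ ⊤ := measure_ball_lt_top.ne
  refine ⟨(2 ^ s'.card * (R + 4) ^ d).toNNReal * B.toNNReal, fun n => ?_⟩
  set δ : ℝ := ((n : ℝ) + 1)⁻¹ with hδ
  have hδ0 : 0 < δ := by positivity
  have hδ1 : δ ≤ 1 := inv_le_one_of_one_le₀ (by linarith [(Nat.cast_nonneg n : (0 : ℝ) ≤ n)])
  have hNδ : ((n : ℝ) + 1) * δ = 1 := mul_inv_cancel₀ (by positivity)
  -- The rounded coordinates take the n + 2 values 0, δ, ..., (n + 1)δ = 1.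
  set c : (s' → Fin (n + 2)) → E d := fun a => v₀ + ∑ y, ((a y : ℕ) * δ : ℝ) • ((y : E d) - v₀)
    with hc
  have hcover : Metric.cthickening (3 * δ) (convexHull ℝ (s : Set (E d))) ⊆
      ⋃ a, Metric.closedBall (c a) ((R + 4) * δ) := by
    intro z hz
    -- Enlarging 3δ to 4δ provides an actual point of the simplex near `z`; this is the 4 in the
    -- radius, while `R` bounds the rounding error.
    have hz' := Metric.cthickening_subset_thickening' (by positivity : 0 < 4 * δ)
      (by linarith : 3 * δ < 4 * δ) _ hz
    obtain ⟨x, hx, hzx⟩ := Metric.mem_thickening_iff.1 hz'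
    obtain ⟨w, hw0, hw1, hwx⟩ := Finset.mem_convexHull'.1 hx
    have hwle : ∀ y ∈ s, w y ≤ 1 := fun y hy => hw1 ▸ Finset.single_le_sum hw0 hy
    have hsum : w v₀ + ∑ y ∈ s', w y = 1 := by rw [hs', Finset.add_sum_erase s w hv₀, hw1]
    have hx' : x = v₀ + ∑ y : s', w y • ((y : E d) - v₀) := by
      rw [Finset.sum_coe_sort s' (fun y => w y • (y - v₀)), ← hwx,
        ← Finset.add_sum_erase s (fun y => w y • y) hv₀, ← hs']
      simp only [smul_sub, Finset.sum_sub_distrib]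
      rw [← Finset.sum_smul, eq_sub_of_add_eq hsum, sub_smul, one_smul]
      abel
    have hfl : ∀ y : s', ⌊((n : ℝ) + 1) * w y⌋₊ < n + 2 := fun y => by
      rw [Nat.floor_lt' (by omega)]
      have hy := hwle y (Finset.mem_of_mem_erase y.2)
      push_cast
      nlinarith [(Nat.cast_nonneg n : (0 : ℝ) ≤ n)]
    refine mem_iUnion.2 ⟨fun y => ⟨⌊((n : ℝ) + 1) * w y⌋₊, hfl y⟩, ?_⟩
    rw [Metric.mem_closedBall]
    refine (dist_triangle z x _).trans ?_
    rw [add_mul, add_comm]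
    refine add_le_add ?_ hzx.le
    rw [dist_eq_norm, hx', hc]
    simp only [add_sub_add_left_eq_sub]
    rw [← Finset.sum_sub_distrib, hR, ← Finset.sum_coe_sort s' (fun y => ‖y - v₀‖),
      Finset.sum_mul]
    refine (norm_sum_le _ _).trans (Finset.sum_le_sum fun y _ => ?_)
    rw [← sub_smul, norm_smul, mul_comm]
    refine mul_le_mul_of_nonneg_left ?_ (norm_nonneg _)
    have h0 : 0 ≤ ((n : ℝ) + 1) * w y :=
      mul_nonneg (by positivity) (hw0 y (Finset.mem_of_mem_erase y.2))
    have h1 := Nat.floor_le h0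
    have h2 := (Nat.lt_floor_add_one (((n : ℝ) + 1) * w y)).le
    have h3 : w y = (((n : ℝ) + 1) * w y) * δ := by
      rw [mul_right_comm, hNδ, one_mul]
    rw [Real.norm_eq_abs, h3, ← sub_mul, abs_mul, abs_of_pos hδ0]
    refine mul_le_of_le_one_left hδ0.le (abs_le.2 ⟨?_, ?_⟩)
    · rw [← h3]; linarith
    · rw [← h3]; linarith
  have hreal : ((n + 2 : ℕ) : ℝ) ^ s'.card * ((R + 4) * δ) ^ d ≤
      (2 ^ s'.card * (R + 4) ^ d) * δ ^ 2 := by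
    have h1 : ((n + 2 : ℕ) : ℝ) ≤ 2 * ((n : ℝ) + 1) := by
      push_cast
      linarith [(Nat.cast_nonneg n : (0 : ℝ) ≤ n)]
    have h2 : ((n : ℝ) + 1) ^ s'.card * δ ^ d ≤ δ ^ 2 := by
      obtain ⟨j, hj, hj2⟩ : ∃ j, s'.card + j = d ∧ 2 ≤ j := ⟨d - s'.card, by omega, by omega⟩
      have e : δ ^ d = δ ^ s'.card * δ ^ j := by rw [← pow_add, hj]
      rw [e, ← mul_assoc, ← mul_pow, hNδ, one_pow, one_mul]
      exact pow_le_pow_of_le_one hδ0.le hδ1 hj2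
    calc ((n + 2 : ℕ) : ℝ) ^ s'.card * ((R + 4) * δ) ^ d
        ≤ (2 * ((n : ℝ) + 1)) ^ s'.card * ((R + 4) * δ) ^ d := by gcongr
      _ = (2 ^ s'.card * (R + 4) ^ d) * (((n : ℝ) + 1) ^ s'.card * δ ^ d) := by
          rw [mul_pow, mul_pow]; ring
      _ ≤ _ := by gcongr
  calc volume (Metric.cthickening (3 * δ) (convexHull ℝ (s : Set (E d))))
      ≤ ∑ a, volume (Metric.closedBall (c a) ((R + 4) * δ)) :=
        (measure_mono hcover).trans (measure_iUnion_fintype_le _ _)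
    _ = ENNReal.ofReal (((n + 2 : ℕ) : ℝ) ^ s'.card * ((R + 4) * δ) ^ d) * B := by
        simp only [Measure.addHaar_closedBall volume _ (by positivity : 0 ≤ (R + 4) * δ),
          finrank_euclideanSpace_fin, Finset.sum_const, Finset.card_univ, nsmul_eq_mul]
        rw [ENNReal.ofReal_mul (by positivity), Fintype.card_fun, Fintype.card_fin,
          Fintype.card_coe, ← Nat.cast_pow, ENNReal.ofReal_natCast, mul_assoc]
    _ ≤ ENNReal.ofReal ((2 ^ s'.card * (R + 4) ^ d) * δ ^ 2) * B := by gcongr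
    _ = _ := by
        rw [ENNReal.ofReal_mul (by positivity), ENNReal.ofReal_pow hδ0.le, ENNReal.coe_mul,
          ENNReal.coe_toNNReal hBt, ENNReal.ofReal]
        ring

/-! ### Relative interiors of simplices -/

/-- `x` is a convex combination of the points of `s` with positive coefficients. -/
def InOpenSimplex (s : Finset (E d)) (x : E d) : Prop :=
  ∃ w : E d → ℝ, (∀ y ∈ s, 0 < w y) ∧ ∑ y ∈ s, w y = 1 ∧ ∑ y ∈ s, w y • y = x

theorem inOpenSimplex_of_minimal {s : Finset (E d)} {x : E d}
    (hx : x ∈ convexHull ℝ (s : Set (E d)))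
    (hmin : ∀ t ⊂ s, x ∉ convexHull ℝ (t : Set (E d))) : InOpenSimplex s x := by
  classical
  obtain ⟨w, hw0, hw1, hwx⟩ := Finset.mem_convexHull'.1 hx
  refine ⟨w, fun y hy => (hw0 y hy).lt_of_ne' fun h0 => ?_, hw1, hwx⟩
  refine hmin _ (Finset.erase_ssubset hy) (Finset.mem_convexHull'.2
    ⟨w, fun z hz => hw0 z (Finset.mem_of_mem_erase hz), ?_, ?_⟩)
  · rw [Finset.sum_erase s h0, hw1]
  · rw [Finset.sum_erase s (by rw [h0, zero_smul]), hwx]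

namespace InOpenSimplex

variable {s t : Finset (E d)} {x q : E d}

theorem mem_convexHull (h : InOpenSimplex s x) : x ∈ convexHull ℝ (s : Set (E d)) := by
  obtain ⟨w, hw0, hw1, hwx⟩ := h
  exact Finset.mem_convexHull'.2 ⟨w, fun y hy => (hw0 y hy).le, hw1, hwx⟩

theorem combo (h : InOpenSimplex s x) (hq : q ∈ convexHull ℝ (s : Set (E d))) {a b : ℝ}
    (ha : 0 ≤ a) (hb : 0 < b) (hab : a + b = 1) : InOpenSimplex s (a • q + b • x) := by
  obtain ⟨w, hw0, hw1, hwx⟩ := h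
  obtain ⟨u, hu0, hu1, hux⟩ := Finset.mem_convexHull'.1 hq
  refine ⟨fun y => a * u y + b * w y, fun y hy => ?_, ?_, ?_⟩
  · have := mul_nonneg ha (hu0 y hy)
    have := mul_pos hb (hw0 y hy)
    positivity
  · rw [Finset.sum_add_distrib, ← Finset.mul_sum, ← Finset.mul_sum, hu1, hw1, mul_one, mul_one, hab]
  · simp only [add_smul, mul_smul]
    rw [Finset.sum_add_distrib, ← Finset.smul_sum, ← Finset.smul_sum, hux, hwx]

/-- As all coefficients of `x` are positive, the segment from `q` to `x` can be prolonged a little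
beyond `x` within the simplex. -/
theorem exists_combo (h : InOpenSimplex s x) (hq : q ∈ convexHull ℝ (s : Set (E d))) :
    ∃ τ > (0 : ℝ), τ < 1 ∧ ∃ x' ∈ convexHull ℝ (s : Set (E d)), (1 - τ) • x' + τ • q = x := by
  obtain ⟨w, hw0, hw1, hwx⟩ := h
  obtain ⟨u, hu0, hu1, hux⟩ := Finset.mem_convexHull'.1 hq
  have hne : s.Nonempty := by
    rw [Finset.nonempty_iff_ne_empty]
    rintro rfl
    simp at hw1
  obtain ⟨y₀, hy₀, hmin⟩ := s.exists_min_image w hne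
  have hw₀ := hw0 y₀ hy₀
  have hle : w y₀ ≤ 1 := hw1 ▸ Finset.single_le_sum (fun y hy => (hw0 y hy).le) hy₀
  -- Half the smallest coefficient: `w - τ u` stays nonnegative because `u ≤ 1`, and `τ < 1` because
  -- `w y₀ ≤ 1`.
  set τ := w y₀ / 2 with hτ
  have hτ1 : 0 < 1 - τ := by linarith
  refine ⟨τ, by positivity, by linarith, ∑ y ∈ s, ((1 - τ)⁻¹ * (w y - τ * u y)) • y,
    Finset.mem_convexHull'.2 ⟨_, fun y hy => ?_, ?_, rfl⟩, ?_⟩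
  · refine mul_nonneg (by positivity) ?_
    have h1 : u y ≤ 1 := hu1 ▸ Finset.single_le_sum hu0 hy
    have h2 := hmin y hy
    nlinarith
  · rw [← Finset.mul_sum, Finset.sum_sub_distrib, ← Finset.mul_sum, hw1, hu1, mul_one,
      inv_mul_cancel₀ hτ1.ne']
  · rw [Finset.smul_sum]
    have e : ∀ y : E d, (1 - τ) • ((1 - τ)⁻¹ * (w y - τ * u y)) • y = w y • y - τ • u y • y := by
      intro y
      rw [smul_smul, mul_inv_cancel_left₀ hτ1.ne', sub_smul, smul_smul]
    simp only [e]
    rw [Finset.sum_sub_distrib, ← Finset.smul_sum, hux, hwx, sub_add_cancel]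

/-- Barycentric coordinates are unique, so a representation of `x` over `t` must involve every
vertex of `s`. -/
theorem subset_of_mem (h : InOpenSimplex s x) (hs : AffineIndependent ℝ ((↑) : s → E d))
    (ht : t ⊆ s) (hx : x ∈ convexHull ℝ (t : Set (E d))) : s ⊆ t := by
  classical
  obtain ⟨w, hw0, hw1, hwx⟩ := h
  obtain ⟨u, hu0, hu1, hux⟩ := Finset.mem_convexHull'.1 hx
  intro y hy
  by_contra hyt
  set u' : E d → ℝ := fun y => if y ∈ t then u y else 0 with hu'
  have e1 : ∑ y ∈ s, u' y = 1 := by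
    rw [hu', Finset.sum_ite_mem, Finset.inter_eq_right.2 ht, hu1]
  have e2 : ∑ y ∈ s, u' y • y = x := by
    simp only [hu', ite_smul, zero_smul]
    rw [Finset.sum_ite_mem, Finset.inter_eq_right.2 ht, hux]
  have key := (affineIndependent_iff.1 hs) Finset.univ (fun y => w y - u' y)
    (by rw [Finset.sum_coe_sort s (fun y => w y - u' y), Finset.sum_sub_distrib, hw1, e1, sub_self])
    (by rw [Finset.sum_coe_sort s (fun y => (w y - u' y) • y)]
        simp only [sub_smul]
        rw [Finset.sum_sub_distrib, hwx, e2, sub_self]) ⟨y, hy⟩ (Finset.mem_univ _)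
  have : w y = 0 := by simpa [hu', hyt] using key
  exact (hw0 y hy).ne' this

/-- A homothety with ratio `τ`, centred at a point `x'` of the simplex, takes a relatively interior
point `q` to `x`. By convexity it takes a neighbourhood of `q` in the simplex to a neighbourhood of
`x`. -/
theorem mem_intrinsicInterior (h : InOpenSimplex s x) :
    x ∈ intrinsicInterior ℝ (convexHull ℝ (s : Set (E d))) := by
  set C := convexHull ℝ (s : Set (E d)) with hC
  obtain ⟨q, hq⟩ := Set.Nonempty.intrinsicInterior (convex_convexHull ℝ (s : Set (E d)))
    ⟨x, h.mem_convexHull⟩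
  obtain ⟨τ, hτ, hτ1, x', hx', hcx⟩ := h.exists_combo (intrinsicInterior_subset hq)
  rw [_root_.mem_intrinsicInterior] at hq ⊢
  obtain ⟨q', hq', rfl⟩ := hq
  have hxC : x ∈ affineSpan ℝ C := subset_affineSpan ℝ C h.mem_convexHull
  refine ⟨⟨x, hxC⟩, ?_, rfl⟩
  have hmem : ∀ y : affineSpan ℝ C, τ⁻¹ • ((y : E d) - x) + (q' : E d) ∈ affineSpan ℝ C := fun y =>
    AffineSubspace.smul_vsub_vadd_mem _ _ y.2 hxC q'.2
  let m : affineSpan ℝ C → affineSpan ℝ C := fun y => ⟨_, hmem y⟩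
  have hm : Continuous m := Continuous.subtype_mk (by fun_prop) _
  have hmx : m ⟨x, hxC⟩ = q' := Subtype.ext (by simp [m])
  rw [mem_interior_iff_mem_nhds] at hq' ⊢
  have := hm.continuousAt.preimage_mem_nhds (hmx.symm ▸ hq')
  refine mem_of_superset this fun y hy => ?_
  have hy' : τ⁻¹ • ((y : E d) - x) + (q' : E d) ∈ C := hy
  have := convex_convexHull ℝ (s : Set (E d)) hx' hy' (by linarith) hτ.le (sub_add_cancel 1 τ)
  have e : (1 - τ) • x' + τ • (τ⁻¹ • ((y : E d) - x) + (q' : E d)) = y := by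
    rw [smul_add, smul_inv_smul₀ hτ.ne', ← add_assoc, add_right_comm, hcx, add_sub_cancel]
  rwa [e] at this

theorem mem_interior (h : InOpenSimplex s x) (hs : AffineIndependent ℝ ((↑) : s → E d))
    (hcard : s.card = d + 1) : x ∈ interior (convexHull ℝ (s : Set (E d))) := by
  have htop : affineSpan ℝ (s : Set (E d)) = ⊤ := by
    have := hs.affineSpan_eq_top_iff_card_eq_finrank_add_one.2 (by simp [hcard])
    simpa using this
  obtain ⟨q, hq⟩ := interior_convexHull_nonempty_iff_affineSpan_eq_top.2 htop
  obtain ⟨τ, hτ, hτ1, x', hx', hcx⟩ := h.exists_combo (interior_subset hq)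
  rw [← hcx]
  exact (convex_convexHull ℝ _).combo_self_interior_mem_interior hx' hq (by linarith) hτ
    (sub_add_cancel 1 τ)

end InOpenSimplex

theorem exists_inOpenSimplex {T : Geometry.SimplicialComplex ℝ (E d)} {x : E d}
    (hx : x ∈ T.space) : ∃ s ∈ T.faces, InOpenSimplex s x := by
  obtain ⟨s₀, hs₀, hxs₀⟩ := T.mem_space_iff.1 hx
  obtain ⟨s, ⟨hs, hxs⟩, hmin⟩ := (wellFounded_lt (α := Finset (E d))).has_min
    {s | s ∈ T.faces ∧ x ∈ convexHull ℝ (s : Set (E d))} ⟨s₀, hs₀, hxs₀⟩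
  refine ⟨s, hs, inOpenSimplex_of_minimal hxs fun t ht hxt => hmin t ⟨?_, hxt⟩ ht⟩
  refine T.down_closed hs ht.1 ?_
  rw [Finset.nonempty_iff_ne_empty]
  rintro rfl
  simp at hxt

/-- If one point of a simplex is an interior point of the complex, then so are all points of the
corresponding open simplex. -/
theorem InOpenSimplex.mem_interior_space {T : Geometry.SimplicialComplex ℝ (E d)}
    (hT : T.faces.Finite) {s : Finset (E d)} (hs : s ∈ T.faces) {x q : E d}
    (hx : InOpenSimplex s x) (hq : q ∈ convexHull ℝ (s : Set (E d))) (hqi : q ∈ interior T.space) :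
    x ∈ interior T.space := by
  classical
  -- A small step from `q` towards `x` enters the open simplex without leaving the interior of the
  -- space.
  obtain ⟨p, hp, hpi⟩ : ∃ p, InOpenSimplex s p ∧ p ∈ interior T.space := by
    have hc : Continuous fun b : ℝ => (1 - b) • q + b • x := by fun_prop
    have hn : (fun b : ℝ => (1 - b) • q + b • x) ⁻¹' interior T.space ∈ 𝓝 (0 : ℝ) := by
      refine hc.continuousAt.preimage_mem_nhds (isOpen_interior.mem_nhds ?_)
      simpa using hqi
    obtain ⟨ε, hε, hball⟩ := Metric.mem_nhds_iff.1 hn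
    have h0 : 0 < min (ε / 2) 1 := by positivity
    refine ⟨_, hx.combo hq (sub_nonneg.2 (min_le_right (ε / 2) 1)) h0 (sub_add_cancel _ _),
      hball ?_⟩
    rw [mem_ball_zero_iff, Real.norm_of_nonneg h0.le]
    linarith [min_le_left (ε / 2) 1]
  obtain ⟨τ, hτ, hτ1, x', hx', hcx⟩ := hx.exists_combo hp.mem_convexHull
  -- Near `p` only faces containing `p` occur, and each of these contains all vertices of `s`, since
  -- `p` lies in the open simplex. Contracting `N` towards `x'` therefore stays within each such
  -- face and yields a neighbourhood of `x`.
  set N : Set (E d) := interior T.space ∩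
    (⋃ t ∈ {t ∈ T.faces | p ∉ convexHull ℝ (t : Set (E d))}, convexHull ℝ (t : Set (E d)))ᶜ with hN
  have hNo : IsOpen N := by
    refine isOpen_interior.inter (isOpen_compl_iff.2 ?_)
    exact (hT.subset (sep_subset _ _)).isClosed_biUnion fun t _ =>
      (t.finite_toSet.isCompact_convexHull ℝ).isClosed
  have hpN : p ∈ N := by
    refine ⟨hpi, fun h => ?_⟩
    obtain ⟨t, ht, hpt⟩ := mem_iUnion₂.1 h
    exact ht.2 hpt
  have hNs : ∀ y ∈ N, (1 - τ) • x' + τ • y ∈ T.space := by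
    rintro y ⟨hy1, hy2⟩
    obtain ⟨t, ht, hyt⟩ := T.mem_space_iff.1 (interior_subset hy1)
    have hpt : p ∈ convexHull ℝ (t : Set (E d)) := by
      by_contra hpt
      exact hy2 (mem_iUnion₂.2 ⟨t, ⟨ht, hpt⟩, hyt⟩)
    have hpst : p ∈ convexHull ℝ ((s ∩ t : Finset (E d)) : Set (E d)) := by
      rw [Finset.coe_inter]
      exact T.inter_subset_convexHull hs ht ⟨hp.mem_convexHull, hpt⟩
    have hst : s ⊆ t :=
      (hp.subset_of_mem (T.indep hs) Finset.inter_subset_left hpst).trans Finset.inter_subset_right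
    refine T.convexHull_subset_space ht (convex_convexHull ℝ _ ?_ hyt (by linarith) hτ.le
      (sub_add_cancel 1 τ))
    exact convexHull_mono (Finset.coe_subset.2 hst) hx'
  have hm : Continuous fun y : E d => τ⁻¹ • (y - (1 - τ) • x') := by fun_prop
  have hmx : τ⁻¹ • (x - (1 - τ) • x') = p := by
    rw [← hcx, add_sub_cancel_left, inv_smul_smul₀ hτ.ne']
  rw [mem_interior_iff_mem_nhds]
  refine mem_of_superset (hm.continuousAt.preimage_mem_nhds
    (hNo.mem_nhds (by rw [hmx]; exact hpN) : N ∈ 𝓝 (τ⁻¹ • (x - (1 - τ) • x')))) fun y hy => ?_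
  have := hNs _ hy
  rwa [smul_inv_smul₀ hτ.ne', add_sub_cancel] at this

/-! ### The common boundary of the insulated and the Neumann part -/

theorem IsBoundaryPart.notMem_of_mem_closure {γ' : Set (E d)} (hγ : IsBoundaryPart Ω γ)
    (hγ' : IsBoundaryPart Ω γ') (hd : Disjoint γ γ') {x : E d} (hx : x ∈ closure γ') : x ∉ γ := by
  intro hxγ
  obtain ⟨U, hU, rfl⟩ := hγ
  obtain ⟨y, hyU, hy⟩ := mem_closure_iff.1 hx U hU hxγ.1
  exact disjoint_left.1 hd ⟨hyU, hγ'.subset hy⟩ hy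

theorem IsInsulationDomain.isLipDomain (hΩ : IsInsulationDomain Ω ΓI ΓD ΓN) : IsLipDomain Ω :=
  ⟨hΩ.isOpen, hΩ.isBounded, hΩ.lipschitz⟩

/-- A common point `x` lies in the open simplex of some face. A face of full dimension would put `x`
into `Ω`. A face of dimension d - 1 would lie in the boundary entirely, with `x` in a single
relatively open part, which excludes `x` from the closure of any other part. So the dimension is at
most d - 2. -/
theorem IsInsulationDomain.smallTubes (hΩ : IsInsulationDomain Ω ΓI ΓD ΓN) :
    SmallTubes (closure ΓI ∩ closure ΓN) := by
  obtain ⟨T, hT, hsp, hside⟩ := hΩ.simplicial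
  refine SmallTubes.mono (S' := ⋃ s ∈ {s ∈ T.faces | s.card < d}, convexHull ℝ (s : Set (E d)))
    (SmallTubes.biUnion (hT.subset (sep_subset _ _)) fun s hs =>
      smallTubes_convexHull (T.nonempty_of_mem_faces hs.1) hs.2) ?_
  rintro x ⟨hxI, hxN⟩
  have hxf : x ∈ frontier Ω := closure_minimal hΩ.partI.subset isClosed_frontier hxI
  have hinteg : interior T.space = Ω := by rw [hsp, interior_closure_eq hΩ.isOpen hΩ.lipschitz]
  have hxΩ : x ∉ Ω := (hΩ.isOpen.frontier_eq ▸ hxf : x ∈ closure Ω \ Ω).2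
  obtain ⟨s, hs, hxs⟩ := exists_inOpenSimplex (T := T) (hsp ▸ frontier_subset_closure hxf)
  refine mem_iUnion₂.2 ⟨s, ⟨hs, ?_⟩, hxs.mem_convexHull⟩
  by_contra hlt
  have hle : s.card ≤ d + 1 := by
    have := (T.indep hs).card_le_finrank_succ
    have h2 := Submodule.finrank_le (vectorSpan ℝ (range ((↑) : s → E d)))
    rw [finrank_euclideanSpace_fin] at h2
    rw [Fintype.card_coe] at this
    omega
  rcases (by omega : s.card = d + 1 ∨ s.card = d) with hc | hc
  · refine hxΩ (hinteg ▸ interior_mono (T.convexHull_subset_space hs) ?_)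
    exact hxs.mem_interior (T.indep hs) hc
  · have hsub : convexHull ℝ (s : Set (E d)) ⊆ frontier Ω := by
      intro q hq
      rw [hΩ.isOpen.frontier_eq]
      refine ⟨hsp ▸ T.convexHull_subset_space hs hq, fun hqΩ => hxΩ ?_⟩
      rw [← hinteg] at hqΩ ⊢
      exact hxs.mem_interior_space hT hs hq hqΩ
    rcases hside s hs hc hsub with h | h | h
    · exact hΩ.partI.notMem_of_mem_closure hΩ.partN hΩ.disjointIN hxN (h hxs.mem_intrinsicInterior)
    · exact hΩ.partD.notMem_of_mem_closure hΩ.partI hΩ.disjointID.symm hxI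
        (h hxs.mem_intrinsicInterior)
    · exact hΩ.partN.notMem_of_mem_closure hΩ.partI hΩ.disjointIN.symm hxI
        (h hxs.mem_intrinsicInterior)

end Insulation

namespace Insulation

variable {d : ℕ} {Ω γ ΓI ΓD ΓN : Set (E d)}

/-! ### The pairing of `L^∞` and `L¹` on the boundary -/

section Pairing

variable {X : Type*} [MeasurableSpace X] {μ : Measure X}

/-- The functional `f ↦ ∫ b f` on `L¹` defined by `b ∈ L^∞`. -/
def pairL (b : Lp ℝ ∞ μ) : StrongDual ℝ (Lp ℝ 1 μ) :=
  LinearMap.mkContinuous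
    { toFun := fun f => ∫ x, b x * f x ∂μ
      map_add' := fun f g => by
        rw [← integral_add (Linf_integrable_mul b (L1.integrable_coeFn f))
          (Linf_integrable_mul b (L1.integrable_coeFn g))]
        refine integral_congr_ae ?_
        filter_upwards [Lp.coeFn_add f g] with x hx
        rw [hx, Pi.add_apply, mul_add]
      map_smul' := fun c f => by
        rw [RingHom.id_apply, smul_eq_mul, ← integral_const_mul]
        refine integral_congr_ae ?_
        filter_upwards [Lp.coeFn_smul c f] with x hx
        rw [hx, Pi.smul_apply, smul_eq_mul]
        ring }
    ‖b‖ fun f => by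
      rw [L1.norm_eq_integral_norm]
      exact Linf_integral_le b (L1.integrable_coeFn f)

theorem pairL_apply (b : Lp ℝ ∞ μ) (f : Lp ℝ 1 μ) : pairL b f = ∫ x, b x * f x ∂μ := rfl

theorem abs_pairL_le (b : Lp ℝ ∞ μ) (f : Lp ℝ 1 μ) : |pairL b f| ≤ ‖b‖ * ‖f‖ := by
  rw [L1.norm_eq_integral_norm]
  exact Linf_integral_le b (L1.integrable_coeFn f)

theorem pairL_neg (b : Lp ℝ ∞ μ) (f : Lp ℝ 1 μ) : pairL (-b) f = -pairL b f := by
  rw [pairL_apply, pairL_apply, ← integral_neg]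
  refine integral_congr_ae ?_
  filter_upwards [Lp.coeFn_neg b] with x hx
  rw [hx, Pi.neg_apply, neg_mul]

theorem pairL_sub (b b' : Lp ℝ ∞ μ) (f : Lp ℝ 1 μ) :
    pairL (b - b') f = pairL b f - pairL b' f := by
  rw [pairL_apply, pairL_apply, pairL_apply, ← integral_sub
    (Linf_integrable_mul b (L1.integrable_coeFn f))
    (Linf_integrable_mul b' (L1.integrable_coeFn f))]
  refine integral_congr_ae ?_
  filter_upwards [Lp.coeFn_sub b b'] with x hx
  rw [hx, Pi.sub_apply, sub_mul]

theorem pairL_injective [IsFiniteMeasure μ] :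
    Function.Injective (pairL : Lp ℝ ∞ μ → StrongDual ℝ (Lp ℝ 1 μ)) := by
  intro b b' h
  have hinteg : ∀ b : Lp ℝ ∞ μ, Integrable b μ := fun b => (Lp.memLp b).integrable (by simp)
  refine Lp.ext ((hinteg b).ae_eq_of_forall_setIntegral_eq _ _ (hinteg b') fun s hs _ => ?_)
  have hi : Integrable (s.indicator (1 : X → ℝ)) μ := (integrable_const 1).indicator hs
  have h1 := DFunLike.congr_fun h (hi.toL1 _)
  have e : ∀ b : Lp ℝ ∞ μ, pairL b (hi.toL1 _) = ∫ x in s, b x ∂μ := fun b => by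
    rw [pairL_apply, ← integral_indicator hs]
    refine integral_congr_ae ?_
    filter_upwards [hi.coeFn_toL1] with x hx
    rw [hx]
    by_cases hxs : x ∈ s <;> simp [hxs]
  rwa [e, e] at h1

theorem norm_le_norm_pairL [IsFiniteMeasure μ] (b : Lp ℝ ∞ μ) : ‖b‖ ≤ ‖pairL b‖ := by
  obtain ⟨b', h1, h2⟩ := exists_Linf_of_dual (pairL b)
  have : b = b' := pairL_injective (ContinuousLinearMap.ext fun f => h2 f)
  rwa [← this] at h1

/-- The nontrivial half of the formula for the conjugate of 1/(2m) ‖·‖² on L¹: it is m/2 times the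
squared dual norm. -/
theorem norm_sq_le_of_forall_pairL_le [IsFiniteMeasure μ] {b : Lp ℝ ∞ μ} {m c : ℝ} (hm : 0 < m)
    (h : ∀ f, -pairL b f - 1 / (2 * m) * ‖f‖ ^ 2 ≤ c) : m / 2 * ‖b‖ ^ 2 ≤ c := by
  have hc : 0 ≤ c := by simpa using h 0
  have hl : ‖pairL b‖ ≤ √(2 * c / m) := by
    refine ContinuousLinearMap.opNorm_le_bound _ (Real.sqrt_nonneg _) fun f => ?_
    rcases eq_or_ne f 0 with rfl | hf
    · simp
    have hf' : 0 < ‖f‖ := norm_pos_iff.2 hf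
    -- This multiple maximizes the left-hand side of the hypothesis along the line spanned by `f`.
    have h1 := h ((-(m * pairL b f / ‖f‖ ^ 2)) • f)
    rw [map_smul, norm_smul, mul_pow, Real.norm_eq_abs, sq_abs, smul_eq_mul] at h1
    have h2 : -(-(m * pairL b f / ‖f‖ ^ 2) * pairL b f) -
        1 / (2 * m) * ((-(m * pairL b f / ‖f‖ ^ 2)) ^ 2 * ‖f‖ ^ 2) =
        m * pairL b f ^ 2 / (2 * ‖f‖ ^ 2) := by
      field_simp
      ring
    rw [h2, div_le_iff₀ (by positivity)] at h1
    refine abs_le_of_sq_le_sq ?_ (by positivity)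
    rw [mul_pow, Real.sq_sqrt (by positivity)]
    have : pairL b f ^ 2 = (m * pairL b f ^ 2) / m := by field_simp
    rw [this, div_mul_eq_mul_div, div_le_div_iff_of_pos_right hm]
    linarith
  have h3 := (norm_le_norm_pairL b).trans hl
  have h4 : ‖b‖ ^ 2 ≤ 2 * c / m := by
    rw [← Real.sq_sqrt (by positivity : 0 ≤ 2 * c / m)]
    exact pow_le_pow_left₀ (norm_nonneg _) h3 2
  calc m / 2 * ‖b‖ ^ 2 ≤ m / 2 * (2 * c / m) := by gcongr
    _ = c := by field_simp

/-- Hölder's inequality followed by Young's inequality, the latter as a completed square. -/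
theorem neg_pairL_le {m : ℝ} (hm : 0 < m) (b : Lp ℝ ∞ μ) (f : Lp ℝ 1 μ) :
    -pairL b f ≤ m / 2 * ‖b‖ ^ 2 + 1 / (2 * m) * ‖f‖ ^ 2 := by
  have h1 := (neg_le_abs _).trans (abs_pairL_le b f)
  have h2 : m / 2 * ‖b‖ ^ 2 + 1 / (2 * m) * ‖f‖ ^ 2 - ‖b‖ * ‖f‖ =
      1 / (2 * m) * (m * ‖b‖ - ‖f‖) ^ 2 := by
    field_simp
    ring
  have h3 : 0 ≤ 1 / (2 * m) * (m * ‖b‖ - ‖f‖) ^ 2 := by positivity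
  linarith

end Pairing

/-! ### Uniqueness of the boundary flux and density of traces -/

theorem bdPair_eq_pairL (hΩ : IsLipDomain Ω) (h : γ ⊆ frontier Ω) (b : Linf γ) (v : H1 Ω) :
    bdPair γ b v = pairL b (traceOne hΩ h v) := bdPair_eq hΩ h b v

/-- An element of `L^∞` that annihilates all traces of smooth functions supported away from the rest
of the boundary vanishes. -/
theorem eq_zero_of_forall_smooth (hΩ : IsLipDomain Ω) {U : Set (E d)} (hU : IsOpen U)
    (hγ : γ = U ∩ frontier Ω) {b : Linf γ}
    (h : ∀ φ (hφ : ContDiff ℝ ∞ φ) (hc : HasCompactSupport φ), tsupport φ ⊆ U →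
      bdPair γ b (smoothH1 Ω hφ hc) = 0) : b = 0 := by
  have hsub : γ ⊆ frontier Ω := hγ ▸ inter_subset_right
  have hfin := hΩ.isFiniteMeasure_of_subset hsub
  have hm : MeasurableSet γ := hγ ▸ hU.measurableSet.inter isClosed_frontier.measurableSet
  have hinteg : Integrable b ((surf d).restrict γ) := (Lp.memLp b).integrable (by simp)
  have key := hU.ae_eq_zero_of_integral_contDiff_smul_eq_zero (μ := (surf d).restrict γ)
    (hinteg.locallyIntegrable.locallyIntegrableOn U) (fun φ hφ hc hφU => by
      rw [← h φ hφ hc hφU, bdPair]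
      refine integral_congr_ae ?_
      filter_upwards [ae_restrict_of_subset hsub (trace_smoothH1 hΩ hφ hc)] with x hx
      rw [hx, smul_eq_mul, mul_comm])
  refine Lp.ext ?_
  filter_upwards [key, ae_restrict_mem hm, Lp.coeFn_zero ℝ ∞ ((surf d).restrict γ)] with x h1 h2 h3
  rw [h3, h1 (hγ ▸ h2).1]
  rfl

theorem smoothH1_mem_H1zero (hΩ : IsLipDomain Ω) {φ : E d → ℝ} (hφ : ContDiff ℝ ∞ φ)
    (hc : HasCompactSupport φ) (h : ∀ x ∈ γ, x ∉ tsupport φ) : smoothH1 Ω hφ hc ∈ H1zero Ω γ := by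
  rw [mem_H1zero_iff hΩ]
  filter_upwards [trace_smoothH1 hΩ hφ hc] with x hx hxγ
  rw [hx, image_eq_zero_of_notMem_tsupport (h x hxγ)]

theorem normalExt_spec {y : HDiv Ω} (hy : y ∈ HBar Ω ΓI ΓD ΓN) :
    IsNormalExt ΓI ΓD ΓN y (normalExt ΓI ΓD ΓN y) := by
  have h : ∃ b : Linf ΓI, IsNormalExt ΓI ΓD ΓN y b := hy
  rw [normalExt, dif_pos h]
  exact h.choose_spec

namespace IsInsulationDomain

theorem isFiniteMeasure (hΩ : IsInsulationDomain Ω ΓI ΓD ΓN) :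
    IsFiniteMeasure ((surf d).restrict ΓI) :=
  hΩ.isLipDomain.isFiniteMeasure_of_subset hΩ.partI.subset

/-- `ΓI` is the trace on the boundary of an open set `U` which the other two parts avoid, so smooth
functions supported in `U` are admissible, and they determine an element of L^∞(ΓI). -/
theorem eq_zero_of_annihilates (hΩ : IsInsulationDomain Ω ΓI ΓD ΓN) {b : Linf ΓI}
    (h : ∀ v ∈ H1zero Ω ΓD ⊓ H1zero Ω ΓN, bdPair ΓI b v = 0) : b = 0 := by
  obtain ⟨U, hU, hγ⟩ := hΩ.partI
  have hdis : ∀ {γ' : Set (E d)}, IsBoundaryPart Ω γ' → Disjoint ΓI γ' → ∀ x ∈ γ', x ∉ U :=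
    fun hγ' hd x hx hxU => disjoint_left.1 hd (hγ ▸ ⟨hxU, hγ'.subset hx⟩) hx
  refine eq_zero_of_forall_smooth hΩ.isLipDomain hU hγ fun φ hφ hc hφU => h _ ⟨?_, ?_⟩
  · exact smoothH1_mem_H1zero hΩ.isLipDomain hφ hc fun x hx hx' =>
      hdis hΩ.partD hΩ.disjointID x hx (hφU hx')
  · exact smoothH1_mem_H1zero hΩ.isLipDomain hφ hc fun x hx hx' =>
      hdis hΩ.partN hΩ.disjointIN x hx (hφU hx')

theorem bdPair_eq (hΩ : IsInsulationDomain Ω ΓI ΓD ΓN) (b : Linf ΓI) (v : H1 Ω) :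
    bdPair ΓI b v = pairL b (traceOne hΩ.isLipDomain hΩ.partI.subset v) :=
  bdPair_eq_pairL _ _ _ _

/-- The extended normal trace is unique. -/
theorem isNormalExt_unique (hΩ : IsInsulationDomain Ω ΓI ΓD ΓN) {y : HDiv Ω}
    {b b' : Linf ΓI} (h : IsNormalExt ΓI ΓD ΓN y b) (h' : IsNormalExt ΓI ΓD ΓN y b') : b = b' := by
  refine sub_eq_zero.1 (hΩ.eq_zero_of_annihilates fun v hv => ?_)
  have e := (h v hv).trans (h' v hv).symm
  rw [hΩ.bdPair_eq, hΩ.bdPair_eq] at e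
  rw [hΩ.bdPair_eq, pairL_sub, e, sub_self]

theorem normalExt_eq (hΩ : IsInsulationDomain Ω ΓI ΓD ΓN) {y : HDiv Ω} {b : Linf ΓI}
    (h : IsNormalExt ΓI ΓD ΓN y b) :
    normalExt ΓI ΓD ΓN y = b :=
  hΩ.isNormalExt_unique (normalExt_spec ⟨b, h⟩) h

/-- The traces of functions vanishing on `ΓD` are dense in `L¹(ΓI)`. -/
theorem mem_closure_traceOne (hΩ : IsInsulationDomain Ω ΓI ΓD ΓN)
    (x : Lp ℝ 1 ((surf d).restrict ΓI)) :
    x ∈ closure ((fun v => traceOne hΩ.isLipDomain hΩ.partI.subset v) '' (H1zero Ω ΓD)) := by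
  have hfin := hΩ.isFiniteMeasure
  set T := traceOne hΩ.isLipDomain hΩ.partI.subset with hT
  set S : Submodule ℝ (Lp ℝ 1 ((surf d).restrict ΓI)) :=
    (H1zero Ω ΓD).map (T : H1 Ω →ₗ[ℝ] Lp ℝ 1 ((surf d).restrict ΓI)) with hS
  change x ∈ closure (S : Set (Lp ℝ 1 ((surf d).restrict ΓI)))
  by_contra hx
  obtain ⟨l, c, hlx, hl⟩ := geometric_hahn_banach_point_closed
    (S.topologicalClosure.convex) (S.isClosed_topologicalClosure) hx
  have hc0 : c < 0 := by simpa using hl 0 (Submodule.zero_mem _)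
  have hl0 : ∀ y ∈ S, l y = 0 := by
    intro y hy
    by_contra hne
    have := hl (((c - 1) / l y) • y) (S.le_topologicalClosure (S.smul_mem _ hy))
    rw [map_smul, smul_eq_mul, div_mul_cancel₀ _ hne] at this
    linarith
  obtain ⟨b, -, hb⟩ := exists_Linf_of_dual l
  have hb0 : b = 0 := hΩ.eq_zero_of_annihilates fun v hv => by
    rw [hΩ.bdPair_eq, pairL_apply, ← hb]
    exact hl0 _ ⟨v, hv.1, rfl⟩
  have : l x = 0 := by
    rw [hb, hb0]
    refine (integral_congr_ae ?_).trans (integral_zero _ _)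
    filter_upwards [Lp.coeFn_zero ℝ ∞ ((surf d).restrict ΓI)] with y hy
    rw [hy, Pi.zero_apply, zero_mul]
  linarith

end IsInsulationDomain

end Insulation

namespace Insulation

variable {d : ℕ} {Ω γ ΓI ΓD ΓN : Set (E d)}

/-! ### Extended-real-valued functionals -/

theorem ind_of_true {P : Prop} (h : P) : ind P = 0 := if_pos h

theorem ind_of_false {P : Prop} (h : ¬P) : ind P = ⊤ := if_neg h

theorem coe_add_ind_le_iff {r c : ℝ} {P : Prop} :
    (r : EReal) + ind P ≤ (c : EReal) ↔ P ∧ r ≤ c := by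
  by_cases h : P
  · rw [ind_of_true h, add_zero, EReal.coe_le_coe_iff, and_iff_right h]
  · rw [ind_of_false h, EReal.coe_add_top, top_le_iff]
    exact iff_of_false (EReal.coe_ne_top c) fun h' => h h'.1

theorem properConvexLsc_coe_add_ind {V : Type*} [NormedAddCommGroup V] [NormedSpace ℝ V] {r : V → ℝ}
    (hr : Continuous r) (hc : ConvexOn ℝ univ r) {P : V → Prop} (hcl : IsClosed {v | P v})
    (hcv : Convex ℝ {v | P v}) (hne : ∃ v, P v) :
    ProperConvexLsc fun v => (r v : EReal) + ind (P v) := by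
  refine ⟨⟨?_, fun v => ?_⟩, ?_, ?_⟩
  · obtain ⟨v, hv⟩ := hne
    refine ⟨v, ?_⟩
    simp [ind_of_true hv]
  · by_cases h : P v
    · simp [ind_of_true h]
    · simp [ind_of_false h]
  · rintro ⟨v, s⟩ hv ⟨w, t⟩ hw a b ha hb hab
    simp only [mem_ofPred_eq, coe_add_ind_le_iff] at hv hw
    change ((r (a • v + b • w) : EReal) + ind (P (a • v + b • w))) ≤ ((a • s + b • t : ℝ) : EReal)
    rw [coe_add_ind_le_iff]
    refine ⟨hcv hv.1 hw.1 ha hb hab, (hc.2 (mem_univ v) (mem_univ w) ha hb hab).trans ?_⟩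
    simp only [smul_eq_mul]
    exact add_le_add (mul_le_mul_of_nonneg_left hv.2 ha) (mul_le_mul_of_nonneg_left hw.2 hb)
  · rw [lowerSemicontinuous_iff_isClosed_preimage]
    intro y
    induction y with
    | bot =>
      convert isClosed_empty
      ext v
      simp only [mem_preimage, mem_Iic, le_bot_iff, mem_empty_iff_false, iff_false]
      by_cases h : P v
      · simp [ind_of_true h]
      · simp [ind_of_false h]
    | coe c =>
      have : (fun v => (r v : EReal) + ind (P v)) ⁻¹' Iic (c : EReal) =
          {v | P v} ∩ {v | r v ≤ c} := by
        ext v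
        exact coe_add_ind_le_iff
      rw [this]
      exact hcl.inter (isClosed_le hr continuous_const)
    | top => simp

theorem convexOn_const_mul_norm_comp_sq {V Z : Type*} [NormedAddCommGroup V] [NormedSpace ℝ V]
    [NormedAddCommGroup Z] [NormedSpace ℝ Z] (A : V →L[ℝ] Z) {c : ℝ} (hc : 0 ≤ c) :
    ConvexOn ℝ univ fun v => c * ‖A v‖ ^ 2 := by
  have h1 : ConvexOn ℝ univ fun v => ‖A v‖ :=
    (convexOn_univ_norm (E := Z)).comp_linearMap (A : V →ₗ[ℝ] Z)
  have h2 := (h1.pow (fun _ _ => norm_nonneg _) 2).smul hc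
  simpa using h2

theorem convexOn_clm {V : Type*} [NormedAddCommGroup V] [NormedSpace ℝ V] (A : V →L[ℝ] ℝ) :
    ConvexOn ℝ univ fun v => A v := (A : V →ₗ[ℝ] ℝ).convexOn convex_univ

/-! ### The functionals of the problem -/

theorem traceOn_eq_iff {v w : H1 Ω} : traceOn γ v = traceOn γ w ↔ v - w ∈ H1zero Ω γ :=
  Submodule.Quotient.eq _

theorem traceOn_eq_zero {v : H1 Ω} (hv : v ∈ H1zero Ω γ) : traceOn γ v = 0 :=
  (Submodule.Quotient.mk_eq_zero _).2 hv

/-- The linear functional `v ↦ (f, v)_Ω + ⟨g, v⟩_{ΓN}`. -/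
def load (f : L2 Ω) (g : StrongDual ℝ (HHalf Ω ΓN)) : H1 Ω →L[ℝ] ℝ :=
  (innerSL ℝ f).comp (fnL Ω) + g.comp ⟨(H1zero Ω ΓN).mkQ, continuous_quot_mk⟩

theorem load_apply (f : L2 Ω) (g : StrongDual ℝ (HHalf Ω ΓN)) (v : H1 Ω) :
    load f g v = ⟪f, fn v⟫_ℝ + g (traceOn ΓN v) := rfl

/-- The linear functional `v ↦ (f, v)_Ω + ⟨g, v⟩_{ΓN} - (y, ∇v)_Ω`. -/
def residual (f : L2 Ω) (g : StrongDual ℝ (HHalf Ω ΓN)) (y : L2v Ω) : H1 Ω →L[ℝ] ℝ :=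
  load f g - (innerSL ℝ y).comp (grad Ω)

theorem residual_apply (f : L2 Ω) (g : StrongDual ℝ (HHalf Ω ΓN)) (y : L2v Ω) (v : H1 Ω) :
    residual f g y v = ⟪f, fn v⟫_ℝ + g (traceOn ΓN v) - ⟪y, grad Ω v⟫_ℝ := rfl

theorem residual_eq_sub_normalTrace {f : L2 Ω} (g : StrongDual ℝ (HHalf Ω ΓN)) {y : HDiv Ω}
    (hy : div y = -f) (v : H1 Ω) :
    residual f g (vec y) v = g (traceOn ΓN v) - normalTrace y v := by
  rw [residual_apply, normalTrace, hy, inner_neg_right, real_inner_comm (vec y),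
    real_inner_comm f]
  ring

/-- The weak divergence is determined by the field, so uniqueness in H(div) may be checked in L². -/
theorem HDiv_ext_of_isOpen (hΩ : IsOpen Ω) {y y' : HDiv Ω} (h : vec y = vec y') : y = y' := by
  have hd : div y = div y' := by
    have hloc : LocallyIntegrableOn (fun x => div y x - div y' x) Ω (volume.restrict Ω) :=
      LocallyIntegrable.locallyIntegrableOn
        (((Lp.memLp (div y)).sub (Lp.memLp (div y'))).locallyIntegrable (by norm_num)) Ω
    have := hΩ.ae_eq_zero_of_integral_contDiff_smul_eq_zero hloc (fun φ h1 h2 h3 => by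
      have hφ : IsTest Ω φ := ⟨h1, h2, h3⟩
      have e1 : ∫ x in Ω, fderiv ℝ φ x (vec y x) = -∫ x in Ω, div y x * φ x := y.2 φ hφ
      have e2 : ∫ x in Ω, fderiv ℝ φ x (vec y' x) = -∫ x in Ω, div y' x * φ x := y'.2 φ hφ
      rw [h, e2, neg_inj] at e1
      have : ∀ x, φ x • (div y x - div y' x) = div y x * φ x - div y' x * φ x := fun x => by
        rw [smul_eq_mul]
        ring
      simp_rw [this]
      rw [integral_sub (hφ.integrable_mul _) (hφ.integrable_mul _), e1, sub_self])
    refine Lp.ext ?_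
    filter_upwards [this, ae_restrict_mem hΩ.measurableSet] with x hx hxΩ
    exact sub_eq_zero.1 (hx hxΩ)
  exact Subtype.ext ((WithLp.ofLp_injective 2) (Prod.ext h hd))

/-- `y` is in equilibrium with the loads `f`, `g` and the boundary flux `b`. -/
def IsEquilibrium (ΓI ΓD : Set (E d)) (f : L2 Ω) (g : StrongDual ℝ (HHalf Ω ΓN)) (y : L2v Ω)
    (b : Linf ΓI) : Prop :=
  ∀ w ∈ H1zero Ω ΓD, residual f g y w = -bdPair ΓI b w

namespace IsInsulationDomain

/-- The trace operator `H¹(Ω) → L¹(ΓI)`. -/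
abbrev tr (hΩ : IsInsulationDomain Ω ΓI ΓD ΓN) : H1 Ω →L[ℝ] Lp ℝ 1 ((surf d).restrict ΓI) :=
  traceOne hΩ.isLipDomain hΩ.partI.subset

theorem bdNorm1_eq (hΩ : IsInsulationDomain Ω ΓI ΓD ΓN) (v : H1 Ω) :
    bdNorm1 ΓI v = ‖hΩ.tr v‖ := Insulation.bdNorm1_eq _ _ v

theorem bdPair_eq_zero (hΩ : IsInsulationDomain Ω ΓI ΓD ΓN) (b : Linf ΓI) {v : H1 Ω}
    (hv : v ∈ H1zero Ω ΓI) : bdPair ΓI b v = 0 := by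
  rw [hΩ.bdPair_eq, (traceOne_eq_zero_iff hΩ.isLipDomain hΩ.partI v).2 hv, map_zero]

/-- Testing with functions compactly supported in `Ω` yields the divergence; the two boundary
conditions are the balance for test functions that vanish in addition on `ΓN` or on `ΓI`. -/
theorem exists_HDiv_of_isEquilibrium (hΩ : IsInsulationDomain Ω ΓI ΓD ΓN) {f : L2 Ω}
    {g : StrongDual ℝ (HHalf Ω ΓN)} {y : L2v Ω} {b : Linf ΓI}
    (h : IsEquilibrium ΓI ΓD f g y b) :
    ∃ z : HDiv Ω, vec z = y ∧ div z = -f ∧ IsNormalExt ΓI ΓD ΓN z b ∧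
      ∀ v ∈ H1zero Ω ΓI ⊓ H1zero Ω ΓD, normalTrace z v = g (traceOn ΓN v) := by
  have hw : IsWeakDiv Ω y (-f) := by
    intro φ hφ
    have hout : ∀ {γ : Set (E d)}, γ ⊆ frontier Ω → smoothH1 Ω hφ.1 hφ.2.1 ∈ H1zero Ω γ :=
      fun hγ => smoothH1_mem_H1zero hΩ.isLipDomain hφ.1 hφ.2.1 fun x hx hx' =>
        (hΩ.isOpen.frontier_eq ▸ hγ hx : x ∈ closure Ω \ Ω).2 (hφ.2.2 hx')
    have h1 := h _ (hout hΩ.partD.subset)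
    rw [hΩ.bdPair_eq_zero b (hout hΩ.partI.subset), neg_zero, residual_apply,
      traceOn_eq_zero (hout hΩ.partN.subset), map_zero, add_zero, sub_eq_zero, L2.inner_def,
      L2.inner_def] at h1
    have e1 : ∫ x in Ω, ⟪f x, fn (smoothH1 Ω hφ.1 hφ.2.1) x⟫_ℝ = -∫ x in Ω, (-f) x * φ x := by
      rw [← integral_neg]
      refine integral_congr_ae ?_
      filter_upwards [fn_smoothH1 (Ω := Ω) hφ.1 hφ.2.1, Lp.coeFn_neg f] with x e1 e2
      rw [e1, e2, RCLike.inner_apply, conj_trivial, Pi.neg_apply]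
      ring
    have e2 : ∫ x in Ω, ⟪y x, grad Ω (smoothH1 Ω hφ.1 hφ.2.1) x⟫_ℝ =
        ∫ x in Ω, fderiv ℝ φ x (y x) := by
      refine integral_congr_ae ?_
      filter_upwards [grad_smoothH1 (Ω := Ω) hφ.1 hφ.2.1] with x e1
      rw [e1, real_inner_comm, gradient, InnerProductSpace.toDual_symm_apply]
    rw [← e1, ← e2, h1]
  have hv : ∀ v, normalTrace (⟨WithLp.toLp 2 (y, -f), hw⟩ : HDiv Ω) v =
      g (traceOn ΓN v) - residual f g y v := by
    intro v
    have := residual_eq_sub_normalTrace (f := f) g (y := ⟨WithLp.toLp 2 (y, -f), hw⟩) rfl v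
    change residual f g y v = _ at this
    rw [this, sub_sub_cancel]
  refine ⟨⟨WithLp.toLp 2 (y, -f), hw⟩, rfl, rfl, fun v hvm => ?_, fun v hvm => ?_⟩
  · rw [hv, h v hvm.1, traceOn_eq_zero hvm.2, map_zero, zero_sub, neg_neg]
  · rw [hv, h v hvm.2, hΩ.bdPair_eq_zero b hvm.1, neg_zero, sub_zero]

/-- The converse passage, from the two restricted families of test functions to all functions
vanishing on `ΓD`. The separation theorem is applied to the residual plus the boundary pairing, and
this is where the triangulation enters. -/
theorem isEquilibrium_of_mem (hΩ : IsInsulationDomain Ω ΓI ΓD ΓN) {f : L2 Ω}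
    {g : StrongDual ℝ (HHalf Ω ΓN)} {y : HDiv Ω} (hy : y ∈ HBar Ω ΓI ΓD ΓN) (hdiv : div y = -f)
    (h : ∀ v ∈ H1zero Ω ΓI ⊓ H1zero Ω ΓD, normalTrace y v = g (traceOn ΓN v)) :
    IsEquilibrium ΓI ΓD f g (vec y) (normalExt ΓI ΓD ΓN y) := by
  intro w hw
  set b := normalExt ΓI ΓD ΓN y with hb
  have happ : ∀ v, (residual f g (vec y) + (pairL b).comp hΩ.tr) v =
      g (traceOn ΓN v) - normalTrace y v + bdPair ΓI b v := fun v => by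
    rw [hΩ.bdPair_eq, ← residual_eq_sub_normalTrace g hdiv]
    rfl
  have key := map_eq_zero_of_separate hΩ.isLipDomain hΩ.smallTubes
    (Φ := residual f g (vec y) + (pairL b).comp hΩ.tr)
    (fun v hv => by
      rw [happ, traceOn_eq_zero hv.2, map_zero, ← normalExt_spec hy v hv]
      ring)
    (fun v hv => by
      rw [happ, hΩ.bdPair_eq_zero b hv.1, h v hv]
      ring) hw
  rw [happ, ← residual_eq_sub_normalTrace g hdiv] at key
  linarith

/-- Along rays `t • w` the residual grows linearly while the only term opposing it depends on the
trace on `ΓI`. The bound therefore forces the residual to be dominated by ‖tr w‖_1, and Hahn-Banach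
represents it by a bounded flux. -/
theorem exists_isEquilibrium_of_bound (hΩ : IsInsulationDomain Ω ΓI ΓD ΓN) {m : ℝ} (hm : 0 < m)
    {f : L2 Ω} {g : StrongDual ℝ (HHalf Ω ΓN)} {y : L2v Ω} {u : H1 Ω} {c : ℝ}
    (h : ∀ w ∈ H1zero Ω ΓD,
      residual f g y (u + w) - 1 / (2 * m) * bdNorm1 ΓI (u + w) ^ 2 ≤ c) :
    ∃ b, IsEquilibrium ΓI ΓD f g y b := by
  have hfin := hΩ.isFiniteMeasure
  set A := residual f g y with hA
  set T := hΩ.tr with hT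
  have h1 : ∀ w ∈ H1zero Ω ΓD, ∀ t : ℝ, 0 ≤ t →
      t * A w ≤ (c - A u) + 1 / (2 * m) * (‖T u‖ + t * ‖T w‖) ^ 2 := by
    intro w hw t ht
    have e1 := h (t • w) (Submodule.smul_mem _ _ hw)
    rw [hΩ.bdNorm1_eq, map_add, map_add, map_smul, map_smul, smul_eq_mul] at e1
    have e2 : ‖T u + t • T w‖ ≤ ‖T u‖ + t * ‖T w‖ :=
      (norm_add_le _ _).trans_eq (by rw [norm_smul, Real.norm_of_nonneg ht])
    have e3 : 1 / (2 * m) * ‖T u + t • T w‖ ^ 2 ≤ 1 / (2 * m) * (‖T u‖ + t * ‖T w‖) ^ 2 := by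
      gcongr
    linarith
  set κ := max ((c - A u) + 1 / (2 * m) * (‖T u‖ + 1) ^ 2) 0 with hκ
  have h2 : ∀ w : H1zero Ω ΓD, A w ≤ κ * ‖T w‖ := by
    rintro ⟨w, hw⟩
    rcases (norm_nonneg (T w)).eq_or_lt with h0 | h0
    · rw [← h0, mul_zero]
      by_contra! hpos
      set q := (c - A u) + 1 / (2 * m) * ‖T u‖ ^ 2 with hq
      -- For vanishing trace the bound does not depend on `t`; this `t` makes the left-hand side |q|
      -- + 1 and hence exceed `q`.
      have e1 := h1 w hw ((|q| + 1) / A w) (by positivity)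
      rw [← h0, mul_zero, add_zero, div_mul_cancel₀ _ hpos.ne'] at e1
      linarith [le_abs_self q]
    -- Normalizing the trace to norm 1 gives the constant `κ`.
    · have e1 := h1 w hw ‖T w‖⁻¹ (by positivity)
      rw [inv_mul_cancel₀ h0.ne'] at e1
      have e2 := e1.trans (le_max_left _ 0)
      rwa [inv_mul_le_iff₀ h0, mul_comm] at e2
  obtain ⟨l, -, hl⟩ := exists_dual_comp_eq
    ((T : H1 Ω →ₗ[ℝ] Lp ℝ 1 ((surf d).restrict ΓI)).comp (H1zero Ω ΓD).subtype)
    ((A : H1 Ω →ₗ[ℝ] ℝ).comp (H1zero Ω ΓD).subtype) (le_max_right _ _ : 0 ≤ κ) h2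
  obtain ⟨b, -, hb⟩ := exists_Linf_of_dual l
  refine ⟨-b, fun w hw => ?_⟩
  rw [hΩ.bdPair_eq, pairL_neg, neg_neg, pairL_apply, ← hb]
  exact (hl ⟨w, hw⟩).symm

end IsInsulationDomain

/-! ### The conjugate functionals -/

theorem conjugate_G (y : L2v Ω) :
    conjugate (G Ω) (innerSL ℝ y) = ((1 / 2 * ‖y‖ ^ 2 : ℝ) : EReal) := by
  refine le_antisymm (iSup_le fun v => ?_) (le_trans (le_of_eq ?_) (le_iSup _ y))
  · rw [G, ← EReal.coe_sub, EReal.coe_le_coe_iff, innerSL_apply_apply]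
    have := norm_sub_sq_real y v
    nlinarith [sq_nonneg ‖y - v‖]
  · rw [G, ← EReal.coe_sub, EReal.coe_eq_coe_iff, innerSL_apply_apply, real_inner_self_eq_norm_sq]
    ring

theorem conjugate_F_le_iff {m : ℝ} {f : L2 Ω} {g : StrongDual ℝ (HHalf Ω ΓN)} {u : H1 Ω}
    {y : L2v Ω} {c : ℝ} :
    conjugate (F ΓI ΓD ΓN m f g (traceOn ΓD u)) (-((innerSL ℝ y).comp (grad Ω))) ≤ (c : EReal) ↔
      ∀ w ∈ H1zero Ω ΓD, residual f g y (u + w) - 1 / (2 * m) * bdNorm1 ΓI (u + w) ^ 2 ≤ c := by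
  have hval : ∀ v, traceOn ΓD v = traceOn ΓD u →
      (((-((innerSL ℝ y).comp (grad Ω))) v : ℝ) : EReal) -
        F ΓI ΓD ΓN m f g (traceOn ΓD u) v =
      ((residual f g y v - 1 / (2 * m) * bdNorm1 ΓI v ^ 2 : ℝ) : EReal) := by
    intro v hv
    rw [F, ind_of_true hv, add_zero, ← EReal.coe_sub, EReal.coe_eq_coe_iff, residual_apply]
    change -⟪y, grad Ω v⟫_ℝ - _ = _
    ring
  rw [conjugate, iSup_le_iff]
  constructor
  · intro h w hw
    have h1 := h (u + w)
    rwa [hval _ (traceOn_eq_iff.2 (by rwa [add_sub_cancel_left])), EReal.coe_le_coe_iff] at h1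
  · intro h v
    by_cases hv : traceOn ΓD v = traceOn ΓD u
    · rw [hval v hv, EReal.coe_le_coe_iff]
      have := h (v - u) (traceOn_eq_iff.1 hv)
      rwa [add_sub_cancel] at this
    · rw [F, ind_of_false hv, EReal.coe_add_top, EReal.sub_top]
      exact bot_le

theorem conjugate_F_ne_bot {m : ℝ} {f : L2 Ω} {g : StrongDual ℝ (HHalf Ω ΓN)} {u : H1 Ω}
    (l : StrongDual ℝ (H1 Ω)) : conjugate (F ΓI ΓD ΓN m f g (traceOn ΓD u)) l ≠ ⊥ := by
  intro h
  have h1 := (le_iSup (fun v => ((l v : ℝ) : EReal) -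
    F ΓI ΓD ΓN m f g (traceOn ΓD u) v) u).trans_eq h
  rw [F, ind_of_true rfl, add_zero, ← EReal.coe_sub, le_bot_iff] at h1
  exact EReal.coe_ne_bot _ h1

namespace IsInsulationDomain

/-- In equilibrium the functional to be maximized depends on the competitor only through its trace
on `ΓI`. These traces are dense in L¹(ΓI), so the supremum is that of -(b, x) - 1/(2m) ‖x‖² over all
of L¹, namely m/2 ‖b‖². -/
theorem conjugate_F (hΩ : IsInsulationDomain Ω ΓI ΓD ΓN) {m : ℝ} (hm : 0 < m) {f : L2 Ω}
    {g : StrongDual ℝ (HHalf Ω ΓN)} (u : H1 Ω) {y : L2v Ω} {b : Linf ΓI}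
    (h : IsEquilibrium ΓI ΓD f g y b) :
    conjugate (F ΓI ΓD ΓN m f g (traceOn ΓD u)) (-((innerSL ℝ y).comp (grad Ω))) =
      ((residual f g y u + bdPair ΓI b u + m / 2 * ‖b‖ ^ 2 : ℝ) : EReal) := by
  have hfin := hΩ.isFiniteMeasure
  have hval : ∀ w ∈ H1zero Ω ΓD, residual f g y (u + w) - 1 / (2 * m) * bdNorm1 ΓI (u + w) ^ 2 =
      residual f g y u + bdPair ΓI b u +
        (-pairL b (hΩ.tr (u + w)) - 1 / (2 * m) * ‖hΩ.tr (u + w)‖ ^ 2) := by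
    intro w hw
    rw [map_add, h w hw, hΩ.bdNorm1_eq, hΩ.bdPair_eq, hΩ.bdPair_eq, map_add, map_add]
    ring
  refine le_antisymm (conjugate_F_le_iff.2 fun w hw => ?_) ?_
  · rw [hval w hw]
    linarith [neg_pairL_le hm b (hΩ.tr (u + w))]
  · set X := conjugate (F ΓI ΓD ΓN m f g (traceOn ΓD u)) (-((innerSL ℝ y).comp (grad Ω))) with hX
    rcases eq_or_ne X ⊤ with ht | ht
    · rw [ht]
      exact le_top
    lift X to ℝ using ⟨ht, conjugate_F_ne_bot _⟩ with c hc
    rw [EReal.coe_le_coe_iff, add_comm, ← le_sub_iff_add_le]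
    have hle := conjugate_F_le_iff.1 hX.symm.le
    refine norm_sq_le_of_forall_pairL_le hm fun x => ?_
    have hcl : IsClosed {x : Lp ℝ 1 ((surf d).restrict ΓI) |
        -pairL b (hΩ.tr u + x) - 1 / (2 * m) * ‖hΩ.tr u + x‖ ^ 2 ≤
          c - (residual f g y u + bdPair ΓI b u)} :=
      isClosed_le (by fun_prop) continuous_const
    have := closure_minimal ?_ hcl (hΩ.mem_closure_traceOne (x - hΩ.tr u))
    · simpa only [mem_ofPred_eq, add_sub_cancel] using this
    · rintro _ ⟨w, hw, rfl⟩
      have := hle w hw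
      rw [hval w hw, map_add] at this
      change -pairL b (hΩ.tr u + hΩ.tr w) - 1 / (2 * m) * ‖hΩ.tr u + hΩ.tr w‖ ^ 2 ≤ _
      linarith

end IsInsulationDomain

end Insulation

namespace Insulation

variable {d : ℕ} {Ω γ ΓI ΓD ΓN : Set (E d)}

/-! ### The dual problem -/

theorem dual_of_conditions {m : ℝ} {f : L2 Ω} {g : StrongDual ℝ (HHalf Ω ΓN)} {u : H1 Ω}
    {y : HDiv Ω} (h1 : div y = -f)
    (h2 : ∀ v ∈ H1zero Ω ΓI ⊓ H1zero Ω ΓD, normalTrace y v = g (traceOn ΓN v)) :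
    dual ΓI ΓD ΓN m f g u y = ((-(1 / 2) * ‖vec y‖ ^ 2 - m / 2 * ‖normalExt ΓI ΓD ΓN y‖ ^ 2
      + normalTrace y u - bdPair ΓI (normalExt ΓI ΓD ΓN y) u - g (traceOn ΓN u) : ℝ) : EReal) := by
  rw [dual, ind_of_true h1, ind_of_true h2, sub_zero, sub_zero]

theorem dual_of_not_conditions {m : ℝ} {f : L2 Ω} {g : StrongDual ℝ (HHalf Ω ΓN)} {u : H1 Ω}
    {y : HDiv Ω} (h : ¬(div y = -f ∧
      ∀ v ∈ H1zero Ω ΓI ⊓ H1zero Ω ΓD, normalTrace y v = g (traceOn ΓN v))) :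
    dual ΓI ΓD ΓN m f g u y = ⊥ := by
  rw [dual]
  by_cases h1 : div y = -f
  · rw [ind_of_false fun h2 => h ⟨h1, h2⟩, EReal.sub_top]
  · rw [ind_of_false h1, EReal.sub_top, EReal.bot_sub]

namespace IsInsulationDomain

theorem conjugate_F_eq_top (hΩ : IsInsulationDomain Ω ΓI ΓD ΓN) {m : ℝ} (hm : 0 < m) {f : L2 Ω}
    {g : StrongDual ℝ (HHalf Ω ΓN)} (u : H1 Ω) {y : L2v Ω}
    (h : ¬∃ b, IsEquilibrium ΓI ΓD f g y b) :
    conjugate (F ΓI ΓD ΓN m f g (traceOn ΓD u)) (-((innerSL ℝ y).comp (grad Ω))) = ⊤ := by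
  by_contra ht
  exact h (hΩ.exists_isEquilibrium_of_bound hm (conjugate_F_le_iff.1 (EReal.le_coe_toReal ht)))

theorem fenchelDual_eq_bot (hΩ : IsInsulationDomain Ω ΓI ΓD ΓN) {m : ℝ} (hm : 0 < m) {f : L2 Ω}
    {g : StrongDual ℝ (HHalf Ω ΓN)} (u : H1 Ω) {y : L2v Ω}
    (h : ¬∃ b, IsEquilibrium ΓI ΓD f g y b) :
    fenchelDual (G Ω) (F ΓI ΓD ΓN m f g (traceOn ΓD u)) (grad Ω) (innerSL ℝ y) = ⊥ := by
  rw [fenchelDual, hΩ.conjugate_F_eq_top hm u h, EReal.sub_top]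

theorem fenchelDual_eq_dual (hΩ : IsInsulationDomain Ω ΓI ΓD ΓN) {m : ℝ} (hm : 0 < m) {f : L2 Ω}
    {g : StrongDual ℝ (HHalf Ω ΓN)} (u : H1 Ω) {y : HDiv Ω} (hy : y ∈ HBar Ω ΓI ΓD ΓN) :
    fenchelDual (G Ω) (F ΓI ΓD ΓN m f g (traceOn ΓD u)) (grad Ω) (innerSL ℝ (vec y)) =
      dual ΓI ΓD ΓN m f g u y := by
  by_cases h : div y = -f ∧
      ∀ v ∈ H1zero Ω ΓI ⊓ H1zero Ω ΓD, normalTrace y v = g (traceOn ΓN v)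
  · rw [dual_of_conditions h.1 h.2, fenchelDual, conjugate_G,
      hΩ.conjugate_F hm u (hΩ.isEquilibrium_of_mem hy h.1 h.2), ← EReal.coe_neg, ← EReal.coe_sub,
      EReal.coe_eq_coe_iff, residual_eq_sub_normalTrace g h.1]
    ring
  · rw [dual_of_not_conditions h]
    -- If a constraint fails there is no equilibrium flux: one would give an element of H(div) with
    -- the same field that satisfies both constraints.
    refine hΩ.fenchelDual_eq_bot hm u fun ⟨b, hb⟩ => h ?_
    obtain ⟨z, hz, hd, -, hc⟩ := hΩ.exists_HDiv_of_isEquilibrium hb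
    rw [← HDiv_ext_of_isOpen hΩ.isOpen hz]
    exact ⟨hd, hc⟩

end IsInsulationDomain

/-! ### The primal problem -/

theorem convex_setOf_sub_mem {V : Type*} [AddCommGroup V] [Module ℝ V] (S : Submodule ℝ V) (u : V) :
    Convex ℝ {v | v - u ∈ S} := by
  intro v hv w hw a b ha hb hab
  have : a • v + b • w - u = a • (v - u) + b • (w - u) := by
    conv_lhs => rw [← one_smul ℝ u, ← hab]
    module
  change a • v + b • w - u ∈ S
  rw [this]
  exact S.add_mem (S.smul_mem _ hv) (S.smul_mem _ hw)

theorem properConvexLsc_G : ProperConvexLsc (G Ω) := by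
  have h := properConvexLsc_coe_add_ind (r := fun y : L2v Ω => 1 / 2 * ‖y‖ ^ 2) (by fun_prop)
    (convexOn_const_mul_norm_comp_sq (ContinuousLinearMap.id ℝ (L2v Ω)) (by norm_num))
    (P := fun _ => True) isClosed_univ convex_univ ⟨0, trivial⟩
  simp only [ind_of_true trivial, add_zero] at h
  exact h

theorem primal_eq_add {m : ℝ} {f : L2 Ω} {g : StrongDual ℝ (HHalf Ω ΓN)} {uD : HHalf Ω ΓD}
    (v : H1 Ω) :
    primal ΓI ΓD ΓN m f g uD v = G Ω (grad Ω v) + F ΓI ΓD ΓN m f g uD v := by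
  rw [primal, G, F, ← add_assoc, ← EReal.coe_add]
  congr 2
  ring

namespace IsInsulationDomain

theorem isClosed_feasible (hΩ : IsInsulationDomain Ω ΓI ΓD ΓN) (u : H1 Ω) :
    IsClosed {v : H1 Ω | traceOn ΓD v = traceOn ΓD u} := by
  have : {v : H1 Ω | traceOn ΓD v = traceOn ΓD u} = (fun v => v - u) ⁻¹' (H1zero Ω ΓD) := by
    ext v
    exact traceOn_eq_iff
  rw [this]
  exact (isClosed_H1zero hΩ.isLipDomain hΩ.partD).preimage (by fun_prop)

theorem convex_feasible (u : H1 Ω) : Convex ℝ {v : H1 Ω | traceOn ΓD v = traceOn ΓD u} := by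
  have : {v : H1 Ω | traceOn ΓD v = traceOn ΓD u} = {v | v - u ∈ H1zero Ω ΓD} := by
    ext v
    exact traceOn_eq_iff
  rw [this]
  exact convex_setOf_sub_mem _ u

theorem properConvexLsc_F (hΩ : IsInsulationDomain Ω ΓI ΓD ΓN) {m : ℝ} (hm : 0 < m) (f : L2 Ω)
    (g : StrongDual ℝ (HHalf Ω ΓN)) (u : H1 Ω) :
    ProperConvexLsc (F ΓI ΓD ΓN m f g (traceOn ΓD u)) := by
  have h := properConvexLsc_coe_add_ind
    (r := fun v => (-load f g) v + 1 / (2 * m) * ‖hΩ.tr v‖ ^ 2)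
    ((-load f g).continuous.add (continuous_const.mul (hΩ.tr.continuous.norm.pow 2)))
    ((convexOn_clm _).add (convexOn_const_mul_norm_comp_sq hΩ.tr (by positivity)))
    (hΩ.isClosed_feasible u) (convex_feasible u) ⟨u, rfl⟩
  refine (congrArg ProperConvexLsc (funext fun v => ?_)).mp h
  rw [F, hΩ.bdNorm1_eq]
  congr 2
  change -load f g v + _ = _
  rw [load_apply]
  ring

theorem properConvexLsc_primal (hΩ : IsInsulationDomain Ω ΓI ΓD ΓN) {m : ℝ} (hm : 0 < m) (f : L2 Ω)
    (g : StrongDual ℝ (HHalf Ω ΓN)) (u : H1 Ω) :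
    ProperConvexLsc (primal ΓI ΓD ΓN m f g (traceOn ΓD u)) := by
  have h := properConvexLsc_coe_add_ind
    (r := fun v => (1 / 2 * ‖grad Ω v‖ ^ 2 + 1 / (2 * m) * ‖hΩ.tr v‖ ^ 2) + (-load f g) v)
    (((continuous_const.mul ((grad Ω).continuous.norm.pow 2)).add
      (continuous_const.mul (hΩ.tr.continuous.norm.pow 2))).add (-load f g).continuous)
    (((convexOn_const_mul_norm_comp_sq (grad Ω) (by norm_num)).add
      (convexOn_const_mul_norm_comp_sq hΩ.tr (by positivity))).add (convexOn_clm _))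
    (hΩ.isClosed_feasible u) (convex_feasible u) ⟨u, rfl⟩
  refine (congrArg ProperConvexLsc (funext fun v => ?_)).mp h
  rw [primal, hΩ.bdNorm1_eq]
  congr 2
  change _ + -load f g v = _
  rw [load_apply]
  ring

theorem exists_minimizer (hΩ : IsInsulationDomain Ω ΓI ΓD ΓN) {m : ℝ} (hm : 0 < m) (f : L2 Ω)
    (g : StrongDual ℝ (HHalf Ω ΓN)) (u : H1 Ω) :
    ∃ v : H1 Ω, ∀ w, primal ΓI ΓD ΓN m f g (traceOn ΓD u) v ≤
      primal ΓI ΓD ΓN m f g (traceOn ΓD u) w := by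
  refine (hΩ.properConvexLsc_primal hm f g u).exists_forall_le fun c => ?_
  obtain ⟨C, hC0, hC⟩ := exists_poincare hΩ.isLipDomain hΩ.isConnected hΩ.partI hΩ.nonemptyI
  obtain ⟨α, hα, hα1, hα2⟩ : ∃ α > 0, α ≤ 1 / 2 ∧ α ≤ 1 / (2 * m) :=
    ⟨min (1 / 2) (1 / (2 * m)), by positivity, min_le_left _ _, min_le_right _ _⟩
  set L := ‖load f g‖ with hL
  set β := α / (C + 1) with hβ
  have hβ0 : 0 < β := by positivity
  -- On a sublevel set β ‖v‖² ≤ c + L ‖v‖. For ‖v‖ ≥ 1 the right-hand side is at most (|c| + L) ‖v‖,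
  -- whence the radius.
  refine (Metric.isBounded_closedBall (x := (0 : H1 Ω)) (r := max 1 ((|c| + L) / β))).subset
    fun v hv => ?_
  rw [mem_ofPred_eq, primal, coe_add_ind_le_iff] at hv
  have h1 := hv.2
  have h2 : load f g v ≤ L * ‖v‖ := (le_abs_self _).trans ((load f g).le_opNorm v)
  rw [load_apply] at h2
  set Q := ‖grad Ω v‖ ^ 2 + bdNorm1 ΓI v ^ 2 with hQ
  have h3 : ‖v‖ ^ 2 ≤ (C + 1) * Q := by
    rw [norm_sq_H1]
    linarith [hC v, sq_nonneg (bdNorm1 ΓI v)]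
  have h4 : β * ‖v‖ ^ 2 ≤ c + L * ‖v‖ := by
    have e1 : β * ‖v‖ ^ 2 ≤ α * Q := by
      calc β * ‖v‖ ^ 2 ≤ β * ((C + 1) * Q) := by gcongr
        _ = α * Q := by rw [hβ]; field_simp
    have e2 : α * ‖grad Ω v‖ ^ 2 ≤ 1 / 2 * ‖grad Ω v‖ ^ 2 := by gcongr
    have e3 : α * bdNorm1 ΓI v ^ 2 ≤ 1 / (2 * m) * bdNorm1 ΓI v ^ 2 := by gcongr
    linarith
  rw [mem_closedBall_zero_iff]
  rcases le_total ‖v‖ 1 with h5 | h5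
  · exact h5.trans (le_max_left _ _)
  · refine le_trans ?_ (le_max_right _ _)
    rw [le_div_iff₀ hβ0]
    have h6 : c ≤ |c| * ‖v‖ :=
      (le_abs_self c).trans (le_mul_of_one_le_right (abs_nonneg c) h5)
    have h7 : ‖v‖ * β * ‖v‖ ≤ (|c| + L) * ‖v‖ := by nlinarith
    exact le_of_mul_le_mul_right h7 (by linarith)

/-! ### Duality gap, optimality relations and the flux of a minimizer -/

theorem bdPair_add_nonneg (hΩ : IsInsulationDomain Ω ΓI ΓD ΓN) {m : ℝ} (hm : 0 < m) (b : Linf ΓI)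
    (v : H1 Ω) :
    0 ≤ m / 2 * ‖b‖ ^ 2 + 1 / (2 * m) * bdNorm1 ΓI v ^ 2 + bdPair ΓI b v := by
  have := neg_pairL_le hm b (hΩ.tr v)
  rw [hΩ.bdPair_eq, hΩ.bdNorm1_eq]
  linarith

/-- The duality gap. -/
theorem primal_eq_dual_add (hΩ : IsInsulationDomain Ω ΓI ΓD ΓN) (m : ℝ) {f : L2 Ω}
    {g : StrongDual ℝ (HHalf Ω ΓN)} {u v : H1 Ω} (hv : traceOn ΓD v = traceOn ΓD u) {y : HDiv Ω}
    (hy : y ∈ HBar Ω ΓI ΓD ΓN) (h1 : div y = -f)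
    (h2 : ∀ v ∈ H1zero Ω ΓI ⊓ H1zero Ω ΓD, normalTrace y v = g (traceOn ΓN v)) :
    primal ΓI ΓD ΓN m f g (traceOn ΓD u) v = dual ΓI ΓD ΓN m f g u y +
      ((1 / 2 * ‖grad Ω v - vec y‖ ^ 2 + (m / 2 * ‖normalExt ΓI ΓD ΓN y‖ ^ 2 +
        1 / (2 * m) * bdNorm1 ΓI v ^ 2 + bdPair ΓI (normalExt ΓI ΓD ΓN y) v) : ℝ) : EReal) := by
  rw [dual_of_conditions h1 h2, primal, ind_of_true hv, add_zero, ← EReal.coe_add,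
    EReal.coe_eq_coe_iff]
  -- The balance of forces is needed for `v - u`, which vanishes on `ΓD` only; the restricted test
  -- functions would not do.
  have e1 := hΩ.isEquilibrium_of_mem hy h1 h2 _ (traceOn_eq_iff.1 hv)
  rw [map_sub, residual_eq_sub_normalTrace g h1 u, residual_apply, hΩ.bdPair_eq, map_sub,
    map_sub, ← hΩ.bdPair_eq, ← hΩ.bdPair_eq] at e1
  have e2 := norm_sub_sq_real (grad Ω v) (vec y)
  rw [real_inner_comm] at e2
  linarith

theorem dual_le_primal (hΩ : IsInsulationDomain Ω ΓI ΓD ΓN) {m : ℝ} (hm : 0 < m) {f : L2 Ω}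
    {g : StrongDual ℝ (HHalf Ω ΓN)} {u : H1 Ω} (v : H1 Ω) {y : HDiv Ω}
    (hy : y ∈ HBar Ω ΓI ΓD ΓN) :
    dual ΓI ΓD ΓN m f g u y ≤ primal ΓI ΓD ΓN m f g (traceOn ΓD u) v := by
  by_cases hv : traceOn ΓD v = traceOn ΓD u
  · by_cases h : div y = -f ∧
        ∀ v ∈ H1zero Ω ΓI ⊓ H1zero Ω ΓD, normalTrace y v = g (traceOn ΓN v)
    · rw [hΩ.primal_eq_dual_add m hv hy h.1 h.2]
      refine le_add_of_nonneg_right (EReal.coe_nonneg.2 ?_)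
      have := hΩ.bdPair_add_nonneg hm (normalExt ΓI ΓD ΓN y) v
      positivity
    · rw [dual_of_not_conditions h]
      exact bot_le
  · rw [primal, ind_of_false hv, EReal.coe_add_top]
    exact le_top

/-- Optimality relations for a pair without duality gap. -/
theorem optimality_of_primal_eq_dual (hΩ : IsInsulationDomain Ω ΓI ΓD ΓN) {m : ℝ} (hm : 0 < m)
    {f : L2 Ω} {g : StrongDual ℝ (HHalf Ω ΓN)} {u v : H1 Ω}
    (hv : traceOn ΓD v = traceOn ΓD u) {y : HDiv Ω} (hy : y ∈ HBar Ω ΓI ΓD ΓN)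
    (h : primal ΓI ΓD ΓN m f g (traceOn ΓD u) v = dual ΓI ΓD ΓN m f g u y) :
    vec y = grad Ω v ∧ -bdPair ΓI (normalExt ΓI ΓD ΓN y) v =
      m / 2 * ‖normalExt ΓI ΓD ΓN y‖ ^ 2 + 1 / (2 * m) * bdNorm1 ΓI v ^ 2 := by
  have hc : div y = -f ∧
      ∀ v ∈ H1zero Ω ΓI ⊓ H1zero Ω ΓD, normalTrace y v = g (traceOn ΓN v) := by
    by_contra hc
    rw [dual_of_not_conditions hc, primal, ind_of_true hv, add_zero] at h
    exact EReal.coe_ne_bot _ h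
  have h1 := hΩ.primal_eq_dual_add m hv hy hc.1 hc.2
  rw [h, dual_of_conditions hc.1 hc.2, ← EReal.coe_add, EReal.coe_eq_coe_iff] at h1
  have h2 := hΩ.bdPair_add_nonneg hm (normalExt ΓI ΓD ΓN y) v
  have h3 := sq_nonneg ‖grad Ω v - vec y‖
  refine ⟨?_, by linarith⟩
  have h4 : ‖grad Ω v - vec y‖ ^ 2 = 0 := by linarith
  exact (sub_eq_zero.1 (norm_eq_zero.1 (pow_eq_zero_iff (by norm_num) |>.1 h4))).symm

theorem feasible_of_minimizer {m : ℝ} {f : L2 Ω} {g : StrongDual ℝ (HHalf Ω ΓN)} {u v : H1 Ω}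
    (h : ∀ w, primal ΓI ΓD ΓN m f g (traceOn ΓD u) v ≤
      primal ΓI ΓD ΓN m f g (traceOn ΓD u) w) : traceOn ΓD v = traceOn ΓD u := by
  by_contra hv
  have h1 := h u
  rw [primal, ind_of_false hv, EReal.coe_add_top, primal, ind_of_true rfl, add_zero,
    top_le_iff] at h1
  exact EReal.coe_ne_top _ h1

/-- The variational inequality satisfied by a minimizer. -/
theorem residual_le_of_minimizer (hΩ : IsInsulationDomain Ω ΓI ΓD ΓN) {m : ℝ} (hm : 0 < m)
    {f : L2 Ω} {g : StrongDual ℝ (HHalf Ω ΓN)} {u v : H1 Ω}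
    (h : ∀ w, primal ΓI ΓD ΓN m f g (traceOn ΓD u) v ≤
      primal ΓI ΓD ΓN m f g (traceOn ΓD u) w) {w : H1 Ω} (hw : w ∈ H1zero Ω ΓD) :
    residual f g (grad Ω v) w ≤ ‖hΩ.tr v‖ / m * (‖hΩ.tr (v + w)‖ - ‖hΩ.tr v‖) := by
  have hv := feasible_of_minimizer h
  set A := residual f g (grad Ω v) w with hA
  set N := ‖hΩ.tr v‖ with hN
  set Δ := ‖hΩ.tr (v + w)‖ - N with hΔ
  -- Compare the energy at `v` with that at `v + t • w`, using convexity of the trace norm in `t`,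
  -- and divide by `t`; the limit t → 0 removes the quadratic terms.
  have key : ∀ t ∈ Ioc (0 : ℝ) 1,
      A ≤ N / m * Δ + t * (1 / 2 * ‖grad Ω w‖ ^ 2 + 1 / (2 * m) * Δ ^ 2) := by
    intro t ht
    have h1 := h (v + t • w)
    have hvt : traceOn ΓD (v + t • w) = traceOn ΓD u := by
      rw [← hv, traceOn_eq_iff, add_sub_cancel_left]
      exact Submodule.smul_mem _ _ hw
    rw [primal, ind_of_true hv, add_zero, primal, ind_of_true hvt, add_zero,
      EReal.coe_le_coe_iff, hΩ.bdNorm1_eq, hΩ.bdNorm1_eq] at h1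
    have e1 : ‖hΩ.tr (v + t • w)‖ ≤ N + t * Δ := by
      have : hΩ.tr (v + t • w) = (1 - t) • hΩ.tr v + t • hΩ.tr (v + w) := by
        simp only [map_add, map_smul]
        module
      rw [this]
      refine (norm_add_le _ _).trans_eq ?_
      rw [norm_smul, norm_smul, Real.norm_of_nonneg ht.1.le,
        Real.norm_of_nonneg (by linarith [ht.2])]
      ring
    have e2 : 1 / (2 * m) * ‖hΩ.tr (v + t • w)‖ ^ 2 ≤ 1 / (2 * m) * (N + t * Δ) ^ 2 := by
      gcongr
    have e3 : ‖grad Ω (v + t • w)‖ ^ 2 =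
        ‖grad Ω v‖ ^ 2 + 2 * (t * ⟪grad Ω v, grad Ω w⟫_ℝ) + t ^ 2 * ‖grad Ω w‖ ^ 2 := by
      rw [map_add, map_smul, norm_add_sq_real, inner_smul_right, norm_smul, mul_pow,
        Real.norm_eq_abs, sq_abs]
    have e4 : load f g (v + t • w) = load f g v + t * load f g w := by
      rw [map_add, map_smul, smul_eq_mul]
    have e5 : A = load f g w - ⟪grad Ω v, grad Ω w⟫_ℝ := rfl
    simp only [load_apply] at e4 e5
    have e6 : 1 / (2 * m) * (N + t * Δ) ^ 2 =
        1 / (2 * m) * N ^ 2 + t * (N / m * Δ) + t * (t * (1 / (2 * m) * Δ ^ 2)) := by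
      field_simp
      ring
    have e7 : t * A ≤ t * (N / m * Δ + t * (1 / 2 * ‖grad Ω w‖ ^ 2 + 1 / (2 * m) * Δ ^ 2)) := by
      rw [e5]
      rw [e3] at h1
      nlinarith
    exact le_of_mul_le_mul_left e7 ht.1
  have hlim : Tendsto (fun t : ℝ => N / m * Δ + t * (1 / 2 * ‖grad Ω w‖ ^ 2 + 1 / (2 * m) * Δ ^ 2))
      (𝓝[>] 0) (𝓝 (N / m * Δ)) := by
    have hc : Continuous fun t : ℝ =>
        N / m * Δ + t * (1 / 2 * ‖grad Ω w‖ ^ 2 + 1 / (2 * m) * Δ ^ 2) := by fun_prop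
    have := hc.tendsto 0
    rw [zero_mul, add_zero] at this
    exact this.mono_left nhdsWithin_le_nhds
  refine ge_of_tendsto hlim ?_
  filter_upwards [Ioc_mem_nhdsGT (zero_lt_one' ℝ)] with t ht using key t ht

/-- The gradient of a minimizer is in equilibrium with a boundary flux that satisfies the optimality
relation. -/
theorem exists_flux_of_minimizer (hΩ : IsInsulationDomain Ω ΓI ΓD ΓN) {m : ℝ} (hm : 0 < m)
    {f : L2 Ω} {g : StrongDual ℝ (HHalf Ω ΓN)} {u v : H1 Ω}
    (h : ∀ w, primal ΓI ΓD ΓN m f g (traceOn ΓD u) v ≤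
      primal ΓI ΓD ΓN m f g (traceOn ΓD u) w) :
    ∃ b : Linf ΓI, IsEquilibrium ΓI ΓD f g (grad Ω v) b ∧
      m / 2 * ‖b‖ ^ 2 + 1 / (2 * m) * bdNorm1 ΓI v ^ 2 + bdPair ΓI b v ≤ 0 := by
  have hfin := hΩ.isFiniteMeasure
  set A := residual f g (grad Ω v) with hA
  set N := ‖hΩ.tr v‖ with hN
  have hN0 : 0 ≤ N := norm_nonneg _
  have hκ : 0 ≤ N / m := by positivity
  -- The trace of `v` is adjoined as an extra direction with the prescribed value N²/m. The
  -- extension then satisfies both ‖l‖ ≤ N/m and l(tr v) = N²/m, which is equality in the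
  -- Fenchel-Young inequality.
  let T : (H1zero Ω ΓD × ℝ) →ₗ[ℝ] Lp ℝ 1 ((surf d).restrict ΓI) :=
    ((hΩ.tr : H1 Ω →ₗ[ℝ] Lp ℝ 1 ((surf d).restrict ΓI)).comp (H1zero Ω ΓD).subtype).coprod
      (LinearMap.toSpanSingleton ℝ _ (hΩ.tr v))
  let M : (H1zero Ω ΓD × ℝ) →ₗ[ℝ] ℝ :=
    ((A : H1 Ω →ₗ[ℝ] ℝ).comp (H1zero Ω ΓD).subtype).coprod
      (LinearMap.toSpanSingleton ℝ _ (N ^ 2 / m))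
  have hT : ∀ w t, T (w, t) = hΩ.tr w + t • hΩ.tr v := fun w t => rfl
  have hM : ∀ w t, M (w, t) = A w + t * (N ^ 2 / m) := fun w t => rfl
  have hMT : ∀ p, M p ≤ N / m * ‖T p‖ := by
    rintro ⟨⟨w, hw⟩, t⟩
    rw [hT, hM]
    have eN : N ^ 2 / m = N / m * N := by ring
    rw [eN]
    change A w + t * (N / m * N) ≤ N / m * ‖hΩ.tr w + t • hΩ.tr v‖
    -- For t ≤ 0 the triangle inequality suffices; for t > 0 the variational inequality is applied
    -- to t⁻¹ w and rescaled.
    rcases le_or_gt t 0 with ht | ht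
    · have h1 := hΩ.residual_le_of_minimizer hm h hw
      rw [map_add] at h1
      have h2 : ‖hΩ.tr v + hΩ.tr w‖ ≤ N + ‖hΩ.tr w‖ := norm_add_le _ _
      have h3 : ‖hΩ.tr w‖ ≤ ‖hΩ.tr w + t • hΩ.tr v‖ + (-t) * N := by
        have e : hΩ.tr w = (hΩ.tr w + t • hΩ.tr v) + (-t) • hΩ.tr v := by
          rw [neg_smul, add_neg_cancel_right]
        conv_lhs => rw [e]
        refine (norm_add_le _ _).trans_eq ?_
        rw [norm_smul, Real.norm_of_nonneg (by linarith)]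
      have h4 := mul_le_mul_of_nonneg_left (h2.trans (add_le_add_right h3 N)) hκ
      linarith
    · have h1 := hΩ.residual_le_of_minimizer hm h (Submodule.smul_mem _ t⁻¹ hw)
      rw [map_smul, smul_eq_mul] at h1
      have h2 : ‖hΩ.tr w + t • hΩ.tr v‖ = t * ‖hΩ.tr (v + t⁻¹ • w)‖ := by
        rw [← Real.norm_of_nonneg ht.le, ← norm_smul, Real.norm_of_nonneg ht.le, map_add, map_smul,
          smul_add, smul_inv_smul₀ ht.ne', add_comm]
      rw [h2]
      have h3 := mul_le_mul_of_nonneg_left h1 ht.le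
      rw [mul_inv_cancel_left₀ ht.ne'] at h3
      linarith
  obtain ⟨l, hl, hlT⟩ := exists_dual_comp_eq T M hκ hMT
  obtain ⟨b, hb, hbl⟩ := exists_Linf_of_dual l
  have hpair : ∀ x, pairL b x = l x := fun x => (hbl x).symm
  -- The residual equals l ∘ tr, whereas equilibrium is stated with the opposite sign of the flux.
  refine ⟨-b, fun w hw => ?_, ?_⟩
  · rw [hΩ.bdPair_eq, pairL_neg, neg_neg, hpair]
    have := hlT (⟨w, hw⟩, 0)
    rw [hT, hM, zero_smul, zero_mul, add_zero, add_zero] at this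
    exact this.symm
  · have h1 := hlT (0, 1)
    rw [hT, hM, one_smul, one_mul, ZeroMemClass.coe_zero, map_zero, map_zero, zero_add,
      zero_add] at h1
    rw [hΩ.bdPair_eq, pairL_neg, hpair, h1, norm_neg, hΩ.bdNorm1_eq]
    have h2 : ‖b‖ ^ 2 ≤ (N / m) ^ 2 := pow_le_pow_left₀ (norm_nonneg _) (hb.trans hl) 2
    have h3 : m / 2 * ‖b‖ ^ 2 ≤ m / 2 * (N / m) ^ 2 := by gcongr
    have h4 : m / 2 * (N / m) ^ 2 + 1 / (2 * m) * N ^ 2 - N ^ 2 / m = 0 := by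
      field_simp
      ring
    linarith

/-- The dual solution obtained from a minimizer. -/
theorem exists_dual_of_minimizer (hΩ : IsInsulationDomain Ω ΓI ΓD ΓN) {m : ℝ} (hm : 0 < m)
    {f : L2 Ω} {g : StrongDual ℝ (HHalf Ω ΓN)} {u v : H1 Ω}
    (h : ∀ w, primal ΓI ΓD ΓN m f g (traceOn ΓD u) v ≤
      primal ΓI ΓD ΓN m f g (traceOn ΓD u) w) :
    ∃ z ∈ HBar Ω ΓI ΓD ΓN, div z = -f ∧
      (∀ v ∈ H1zero Ω ΓI ⊓ H1zero Ω ΓD, normalTrace z v = g (traceOn ΓN v)) ∧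
      primal ΓI ΓD ΓN m f g (traceOn ΓD u) v = dual ΓI ΓD ΓN m f g u z := by
  obtain ⟨b, hb, hle⟩ := hΩ.exists_flux_of_minimizer hm h
  obtain ⟨z, hz, hd, hn, hc⟩ := hΩ.exists_HDiv_of_isEquilibrium hb
  refine ⟨z, ⟨b, hn⟩, hd, hc, ?_⟩
  have h1 := hΩ.primal_eq_dual_add m (feasible_of_minimizer h) ⟨b, hn⟩ hd hc
  rw [hz, sub_self, norm_zero, hΩ.normalExt_eq hn,
    le_antisymm hle (hΩ.bdPair_add_nonneg hm b v)] at h1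
  simpa using h1

end IsInsulationDomain

end Insulation

end

/-! ### The duality theorem -/

theorem theorem3p1 {d : ℕ} {Ω ΓI ΓD ΓN : Set (Insulation.E d)}
    (hΩ : Insulation.IsInsulationDomain Ω ΓI ΓD ΓN)
    (m : ℝ) (hm : 0 < m) (f : Insulation.L2 Ω)
    (g : StrongDual ℝ (Insulation.HHalf Ω ΓN))
    (uD : Insulation.HHalf Ω ΓD) (hatu : Insulation.H1 Ω)
    (hlift : Insulation.traceOn ΓD hatu = uD) :
    -- (i) the primal problem has the form `G ∘ ∇ + F`, and its Fenchel dual functional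
    -- `y ↦ -G*(y) - F*(-∇* y)` on `L²(Ω)^d` is `D` on `H̄_I(div; Ω)` and `-∞` elsewhere
    (Insulation.ProperConvexLsc (Insulation.G Ω) ∧
      Insulation.ProperConvexLsc (Insulation.F ΓI ΓD ΓN m f g uD) ∧
      (∀ v, Insulation.primal ΓI ΓD ΓN m f g uD v =
        Insulation.G Ω (Insulation.grad Ω v) + Insulation.F ΓI ΓD ΓN m f g uD v) ∧
      (∀ y ∈ Insulation.HBar Ω ΓI ΓD ΓN,
        Insulation.fenchelDual (Insulation.G Ω) (Insulation.F ΓI ΓD ΓN m f g uD)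
          (Insulation.grad Ω) (innerSL ℝ (Insulation.vec y)) =
        Insulation.dual ΓI ΓD ΓN m f g hatu y) ∧
      (∀ y : Insulation.L2v Ω, (¬ ∃ y' ∈ Insulation.HBar Ω ΓI ΓD ΓN, Insulation.vec y' = y) →
        Insulation.fenchelDual (Insulation.G Ω) (Insulation.F ΓI ΓD ΓN m f g uD)
          (Insulation.grad Ω) (innerSL ℝ y) = ⊥)) ∧
    -- primal solutions exist
    (∃ u : Insulation.H1 Ω, ∀ v, Insulation.primal ΓI ΓD ΓN m f g uD u ≤
      Insulation.primal ΓI ΓD ΓN m f g uD v) ∧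
    -- (ii) unique dual solution
    ∃ z ∈ Insulation.HBar Ω ΓI ΓD ΓN,
      (∀ y ∈ Insulation.HBar Ω ΓI ΓD ΓN,
        Insulation.dual ΓI ΓD ΓN m f g hatu y ≤ Insulation.dual ΓI ΓD ΓN m f g hatu z) ∧
      (∀ z' ∈ Insulation.HBar Ω ΓI ΓD ΓN,
        (∀ y ∈ Insulation.HBar Ω ΓI ΓD ΓN,
          Insulation.dual ΓI ΓD ΓN m f g hatu y ≤ Insulation.dual ΓI ΓD ΓN m f g hatu z') →
        z' = z) ∧
      -- admissibility conditions
      Insulation.div z = -f ∧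
      (∀ v ∈ Insulation.H1zero Ω ΓD,
        Insulation.normalTrace z v -
          Insulation.bdPair ΓI (Insulation.normalExt ΓI ΓD ΓN z) v =
        g (Insulation.traceOn ΓN v)) ∧
      -- for every primal solution `u`: strong duality and (iii) the optimality relations
      ∀ u : Insulation.H1 Ω,
        (∀ v, Insulation.primal ΓI ΓD ΓN m f g uD u ≤ Insulation.primal ΓI ΓD ΓN m f g uD v) →
        Insulation.primal ΓI ΓD ΓN m f g uD u = Insulation.dual ΓI ΓD ΓN m f g hatu z ∧
        Insulation.vec z = Insulation.grad Ω u ∧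
        -Insulation.bdPair ΓI (Insulation.normalExt ΓI ΓD ΓN z) u =
          m / 2 * ‖Insulation.normalExt ΓI ΓD ΓN z‖ ^ 2
            + 1 / (2 * m) * Insulation.bdNorm1 ΓI u ^ 2 := by
  subst hlift
  obtain ⟨u₀, hu₀⟩ := hΩ.exists_minimizer hm f g hatu
  obtain ⟨z, hz, hdiv, hcond, hgap⟩ := hΩ.exists_dual_of_minimizer hm hu₀
  have hmax : ∀ y ∈ Insulation.HBar Ω ΓI ΓD ΓN,
      Insulation.dual ΓI ΓD ΓN m f g hatu y ≤ Insulation.dual ΓI ΓD ΓN m f g hatu z :=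
    fun y hy => hgap ▸ hΩ.dual_le_primal hm u₀ hy
  have hfeas := Insulation.IsInsulationDomain.feasible_of_minimizer hu₀
  refine ⟨⟨Insulation.properConvexLsc_G, hΩ.properConvexLsc_F hm f g hatu,
    fun v => Insulation.primal_eq_add v, fun y hy => hΩ.fenchelDual_eq_dual hm hatu hy,
    fun y hy => hΩ.fenchelDual_eq_bot hm hatu fun ⟨b, hb⟩ => hy ?_⟩, ⟨u₀, hu₀⟩,
    z, hz, hmax, fun z' hz' hmax' => ?_, hdiv, fun v hv => ?_, fun u hu => ?_⟩
  · obtain ⟨y', hy', -, hn, -⟩ := hΩ.exists_HDiv_of_isEquilibrium hb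
    exact ⟨y', ⟨b, hn⟩, hy'⟩
  -- Another maximizer has zero gap with the same `u₀` as well, so its field is the gradient of `u₀`
  -- too.
  · have hgap' := hgap.trans (le_antisymm (hmax' z hz) (hmax z' hz'))
    refine Insulation.HDiv_ext_of_isOpen hΩ.isOpen ?_
    rw [(hΩ.optimality_of_primal_eq_dual hm hfeas hz' hgap').1,
      (hΩ.optimality_of_primal_eq_dual hm hfeas hz hgap).1]
  · have h := hΩ.isEquilibrium_of_mem hz hdiv hcond v hv
    rw [Insulation.residual_eq_sub_normalTrace g hdiv] at h
    linarith
  · have hgapu := (le_antisymm (hu u₀) (hu₀ u)).trans hgap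
    exact ⟨hgapu, hΩ.optimality_of_primal_eq_dual hm
      (Insulation.IsInsulationDomain.feasible_of_minimizer hu) hz hgapu⟩
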